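/- All posets are strict partial orders on non-empty sets. Let $\mathcal P$ be the (countable) set of isomorphism classes of finite posets. For finite posets $Q,P$ let $t(Q,P)$ be the proportion of all maps $Q\to P$ that satisfy $x<_Qy\Rightarrow\varphi(x)<_P\varphi(y)$, and let $t_{\mathrm{ind}}(Q,P)$ be the proportion of all injective maps $Q\to P$ that satisfy $x<_Qy\Leftrightarrow\varphi(x)<_P\varphi(y)$ (and $t_{\mathrm{ind}}(Q,P)=0$ if $|Q|>|P|$). Identify $P\in\mathcal P$ with the point $\bigl((t(Q,P))_{Q\in\mathcal P},|P|^{-1}\bigr)$ of $[0,1]^{\mathcal P}\times[0,1]$, let $\overline{\mathcal P}$ be the closure of $\mathcal P$ in this product (the space of poset limits), and let $\mathcal P_\infty=\overline{\mathcal P}\setminus\mathcal P$ be the set of proper poset limits. The functionals $t(Q,\cdot)$ and $t_{\mathrm{ind}}(Q,\cdot)$ extend continuously to $\overline{\mathcal P}$. An ordered probability space is a probability space $(S,\mathcal F,\mu)$ with a partial order $\prec$ such that $\{(x,y):x\prec y\}$ is measurable in $S\times S$. A kernel on it is a measurable $W:S\times S\to[0,1]$ such that $W(x,y)>0\Rightarrow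 x\prec y$, and $W(x,y),W(y,z)>0\Rightarrow W(x,z)=1$. The random poset $P(\infty,W)$ on $\mathbb N$ is defined by $i<j\iff\xi_{ij}<W(X_i,X_j)$, where the $X_i$ are i.i.d. with law $\mu$ and the $\xi_{ij}$ are i.i.d. uniform on $(0,1)$ and independent of the $X_i$. The kernel $W$ represents $\Pi\in\mathcal P_\infty$ if $t(Q,\Pi)=\int_{S^{|Q|}}\prod_{i<_Qj}W(x_i,x_j)\,d\mu(x_1)\cdots d\mu(x_{|Q|})$ for every finite poset $Q$. Every $\Pi\in\mathcal P_\infty$ is represented by some kernel, and the law of $P(\infty,W)$ is the same for all kernels $W$ that represent $\Pi$; $P(\infty,\Pi)$ denotes a random poset with this law. If $\Pi$ is random, $P(\infty,\Pi)$ has the corresponding mixture of these laws. A random poset $R$ on $\mathbb N$ is exchangeable if its law is invariant under all permutations of $\mathbb N$. For a finite labelled poset $Q$ with ground set $A\subset\mathbb N$, $R\supset Q$ means that $x<_Qy\Rightarrow x<_Ry$ for $x,y\in A$. The restriction $R|_{[n]}$ of $R$ to $[n]=\{1,\dots,n\}$ is regarded as an element of $\mathcal P\subset\overline{\mathcal P}$.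 **Theorem.** (i) There is a one-to-one correspondence between the distributions of random elements $\Pi$ of $\mathcal P_\infty$ and the distributions of exchangeable random posets $R$ on $\mathbb N$, given by $R\overset{d}{=}P(\infty,\Pi)$. For random $\Pi\in\mathcal P_\infty$ and exchangeable $R$ this relation is equivalent to $$\mathbb E\,t(Q,\Pi)=\mathbb P(R\supset Q)\quad\text{for every finite labelled poset $Q$ with ground set $A\subset\mathbb N$,}$$ and also equivalent to $$\mathbb E\,t_{\mathrm{ind}}(Q,\Pi)=\mathbb P(R|_A=Q)\quad\text{for every finite labelled poset $Q$ with ground set $A\subset\mathbb N$.}$$ If it holds, then $R|_{[n]}\to\Pi$ in distribution in $\overline{\mathcal P}$ as $n\to\infty$. (ii) There is a one-to-one correspondence between the proper poset limits $\Pi\in\mathcal P_\infty$ and the extreme points of the set of distributions of exchangeable random posets $R$ on $\mathbb N$, given by $R\overset{d}{=}P(\infty,\Pi)$. For $\Pi\in\mathcal P_\infty$ and exchangeable $R$ this relation is equivalent to $$t(Q,\Pi)=\mathbb P(R\supset Q)\quad\text{for every finite labelled poset $Q$ with ground set $A\subset\mathbb N$,}$$ and also equivalent to $$t_{\mathrm{ind}}(Q,\Pi)=\mathbb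 P(R|_A=Q)\quad\text{for every finite labelled poset $Q$ with ground set $A\subset\mathbb N$.}$$ If it holds, then $R|_{[n]}\to\Pi$ almost surely in $\overline{\mathcal P}$ as $n\to\infty$. -/

import Mathlib

open MeasureTheory Filter Topology

universe u

noncomputable section

namespace PosetLimits

/-! ### Labelled posets -/

/-- The (strict) partial orders on the ground set `V`, given by their indicators
`1[x < y]`. For `V = ℕ` this carries the product `σ`-field of `{0,1}^(ℕ × ℕ)`. -/
abbrev PosetOn (V : Type*) : Type _ :=
  {r : V → V → Bool //
    (∀ x, r x x = false) ∧ ∀ x y z, r x y = true → r y z = true → r x z = true}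

namespace PosetOn

variable {V U V' U' : Type*}

/-- The strict order relation of a labelled poset. -/
def lt (P : PosetOn V) (x y : V) : Prop := P.1 x y = true

/-- The poset on `U` pulled back along a map `U → V`. -/
def comap (P : PosetOn V) (f : U → V) : PosetOn U :=
  ⟨fun x y => P.1 (f x) (f y),
    fun x => P.2.1 (f x), fun x y z => P.2.2 (f x) (f y) (f z)⟩

/-- Isomorphism of labelled posets. -/
def Iso (P : PosetOn V) (Q : PosetOn U) : Prop :=
  ∃ e : V ≃ U, ∀ x y, P.lt x y ↔ Q.lt (e x) (e y)

/-- `t(Q,P)`: the proportion of all maps `Q → P` that are poset homomorphisms. -/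
def homDensity (Q : PosetOn V) (P : PosetOn U) : ℝ :=
  (Nat.card {f : V → U // ∀ x y, Q.lt x y → P.lt (f x) (f y)} : ℝ) / Nat.card (V → U)

/-- `t_ind(Q,P)`: the proportion of all injective maps `Q → P` that are isomorphisms onto an
induced subposet of `P`; it is `0` if there are no injective maps. -/
def indDensity (Q : PosetOn V) (P : PosetOn U) : ℝ :=
  (Nat.card {f : V ↪ U // ∀ x y, Q.lt x y ↔ P.lt (f x) (f y)} : ℝ) / Nat.card (V ↪ U)

theorem homDensity_mem [Finite V] [Finite U] (Q : PosetOn V) (P : PosetOn U) :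
    homDensity Q P ∈ unitInterval := by
  refine ⟨div_nonneg (Nat.cast_nonneg _) (Nat.cast_nonneg _), ?_⟩
  refine div_le_one_of_le₀ ?_ (Nat.cast_nonneg _)
  exact_mod_cast Nat.card_le_card_of_injective _
    (Subtype.val_injective (p := fun f : V → U => ∀ x y, Q.lt x y → P.lt (f x) (f y)))

theorem homDensity_congr {Q : PosetOn V} {Q' : PosetOn V'} {P : PosetOn U} {P' : PosetOn U'}
    (hQ : Q.Iso Q') (hP : P.Iso P') : homDensity Q P = homDensity Q' P' := by
  obtain ⟨e, he⟩ := hQ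
  obtain ⟨g, hg⟩ := hP
  unfold homDensity
  rw [Nat.card_congr (e.arrowCongr g)]
  congr 2
  refine Nat.card_congr ((e.arrowCongr g).subtypeEquiv fun f => ?_)
  rw [← e.forall_congr_right]
  refine forall_congr' fun x => ?_
  rw [← e.forall_congr_right]
  refine forall_congr' fun y => ?_
  simp [← he, ← hg]

theorem indDensity_congr {Q : PosetOn V} {Q' : PosetOn V'} {P : PosetOn U} {P' : PosetOn U'}
    (hQ : Q.Iso Q') (hP : P.Iso P') : indDensity Q P = indDensity Q' P' := by
  obtain ⟨e, he⟩ := hQ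
  obtain ⟨g, hg⟩ := hP
  unfold indDensity
  rw [Nat.card_congr (e.embeddingCongr g)]
  congr 2
  refine Nat.card_congr ((e.embeddingCongr g).subtypeEquiv fun f => ?_)
  rw [← e.forall_congr_right]
  refine forall_congr' fun x => ?_
  rw [← e.forall_congr_right]
  refine forall_congr' fun y => ?_
  simp [← he, ← hg]

end PosetOn

/-! ### Unlabelled finite posets -/

/-- Labelled finite non-empty posets on the standard ground sets. -/
abbrev FinPosetL : Type := Σ n : ℕ, PosetOn (Fin (n + 1))

/-- Isomorphism of labelled finite posets. -/
instance finPosetSetoid : Setoid FinPosetL where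
  r P Q := P.2.Iso Q.2
  iseqv :=
    { refl := fun _ => ⟨Equiv.refl _, fun _ _ => Iff.rfl⟩
      symm := fun ⟨e, he⟩ => ⟨e.symm, fun x y => by simp [he]⟩
      trans := fun ⟨e, he⟩ ⟨g, hg⟩ => ⟨e.trans g, fun x y => by simp [he, hg]⟩ }

/-- The countable set of unlabelled finite (non-empty) posets. -/
def FinPoset : Type := Quotient finPosetSetoid

instance : Countable FinPoset := by
  unfold FinPoset
  infer_instance

/-- The isomorphism class of a poset on a finite non-empty ground set. -/
def PosetOn.unlabelled {V : Type*} [Fintype V] [Nonempty V] (Q : PosetOn V) : FinPoset :=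
  Quotient.mk finPosetSetoid
    ⟨Fintype.card V - 1,
      Q.comap (Fintype.equivFinOfCardEq
        (Nat.sub_add_cancel (Fintype.card_pos (α := V))).symm).symm⟩

namespace FinPoset

/-- `t(Q,P)` for unlabelled finite posets. -/
def t (Q P : FinPoset) : unitInterval :=
  Quotient.liftOn₂ Q P (fun Q P => ⟨Q.2.homDensity P.2, Q.2.homDensity_mem P.2⟩)
    fun _ _ _ _ hQ hP => Subtype.ext (PosetOn.homDensity_congr hQ hP)

/-- `t_ind(Q,P)` for unlabelled finite posets. -/
def tInd (Q P : FinPoset) : ℝ :=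
  Quotient.liftOn₂ Q P (fun Q P => Q.2.indDensity P.2)
    fun _ _ _ _ hQ hP => PosetOn.indDensity_congr hQ hP

/-- The number `|P|` of points of `P`. -/
def size (P : FinPoset) : ℕ :=
  Quotient.liftOn P (fun P => P.1 + 1) fun P Q h => by
    obtain ⟨e, -⟩ := h
    simpa using Fintype.card_congr e

/-- `|P|⁻¹` as an element of `[0,1]`. -/
def invSize (P : FinPoset) : unitInterval :=
  ⟨(P.size : ℝ)⁻¹, inv_nonneg.2 (Nat.cast_nonneg _), Nat.cast_inv_le_one _⟩

/-- The embedding `P ↦ ((t(Q,P))_Q, |P|⁻¹)` of the unlabelled finite posets into a countable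
power of `[0,1]`. -/
def tauPlus (P : FinPoset) : (FinPoset → unitInterval) × unitInterval :=
  (fun Q => t Q P, invSize P)

end FinPoset

/-! ### Poset limits -/

/-- The compact metric space of poset limits: the closure of the set of finite posets. -/
abbrev PosetLimit : Type := closure (Set.range FinPoset.tauPlus)

/-- A finite poset as a point of the space of poset limits. -/
def FinPoset.toLimit (P : FinPoset) : PosetLimit :=
  ⟨FinPoset.tauPlus P, subset_closure (Set.mem_range_self P)⟩

/-- The proper poset limits: the poset limits that are not finite posets. -/
abbrev ProperPosetLimit : Type := {Γ : PosetLimit // Γ ∉ Set.range FinPoset.toLimit}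

/-- `t(Q,Γ)` for a poset limit `Γ`: the extension of `t(Q,·)` by continuity, a coordinate. -/
def PosetLimit.t (Q : FinPoset) (Γ : PosetLimit) : ℝ := (Γ.1.1 Q : ℝ)

/-- `t_ind(Q,Γ)` for a poset limit `Γ`: the extension of `t_ind(Q,·)` by continuity, i.e. the
limit of `t_ind(Q,P)` as the finite poset `P` tends to `Γ`. -/
def PosetLimit.tInd (Q : FinPoset) (Γ : PosetLimit) : ℝ :=
  limUnder (comap FinPoset.toLimit (𝓝 Γ)) (FinPoset.tInd Q)

/-! ### Kernels on ordered probability spaces -/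

/-- A probability space with a (strict) partial order that is measurable as a subset of the
product. -/
structure OrderedProbabilitySpace where
  carrier : Type u
  [measurableSpace : MeasurableSpace carrier]
  μ : Measure carrier
  [isProbabilityMeasure : IsProbabilityMeasure μ]
  lt : carrier → carrier → Prop
  lt_irrefl : ∀ x, ¬ lt x x
  lt_trans : ∀ x y z, lt x y → lt y z → lt x z
  measurableSet_lt : MeasurableSet {p : carrier × carrier | lt p.1 p.2}

attribute [instance] OrderedProbabilitySpace.measurableSpace
attribute [instance] OrderedProbabilitySpace.isProbabilityMeasure

/-- A kernel on an ordered probability space. -/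
structure PosetKernel (S : OrderedProbabilitySpace.{u}) where
  W : S.carrier → S.carrier → unitInterval
  measurable_W : Measurable fun p : S.carrier × S.carrier => W p.1 p.2
  lt_of_pos : ∀ x y, 0 < W x y → S.lt x y
  eq_one_of_pos : ∀ x y z, 0 < W x y → 0 < W y z → W x z = 1

/-- The uniform distribution on `(0,1)`. -/
def uniform01 : Measure (Set.Ioo (0 : ℝ) 1) := Measure.comap Subtype.val volume

instance : IsProbabilityMeasure uniform01 := by
  constructor
  rw [uniform01, comap_subtype_coe_apply measurableSet_Ioo, Set.image_univ, Subtype.range_coe]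
  simp

namespace PosetKernel

variable {S : OrderedProbabilitySpace.{u}}

/-- The infinite poset made from points `X i` and thresholds `ξ (i, j)`:
`i < j` if and only if `ξ (i, j) < W (X i) (X j)`. -/
def sample (K : PosetKernel S) (ω : (ℕ → S.carrier) × (ℕ × ℕ → Set.Ioo (0 : ℝ) 1)) :
    PosetOn ℕ := by
  classical
  have pos : ∀ i j, (ω.2 (i, j) : ℝ) < K.W (ω.1 i) (ω.1 j) → 0 < K.W (ω.1 i) (ω.1 j) :=
    fun i j h => by exact_mod_cast (ω.2 (i, j)).2.1.trans h
  exact ⟨fun i j => decide ((ω.2 (i, j) : ℝ) < K.W (ω.1 i) (ω.1 j)),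
    fun i => decide_eq_false fun h => S.lt_irrefl _ (K.lt_of_pos _ _ (pos i i h)),
    fun i j k hij hjk => by
      have h := K.eq_one_of_pos _ _ _ (pos i j (of_decide_eq_true hij))
        (pos j k (of_decide_eq_true hjk))
      refine decide_eq_true ?_
      rw [h]
      exact (ω.2 (i, k)).2.2⟩

/-- The distribution of the random infinite poset `P(∞,W)`: the points `X i` are i.i.d. with
distribution `μ` and the thresholds `ξ (i, j)` are i.i.d. uniform and independent of them. -/
def law (K : PosetKernel S) : Measure (PosetOn ℕ) :=
  ((Measure.infinitePi fun _ : ℕ => S.μ).prod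
    (Measure.infinitePi fun _ : ℕ × ℕ => uniform01)).map K.sample

open Classical in
/-- `Γ = Γ_W`, i.e. the kernel `W` represents the proper poset limit `Γ`:
`t(Q,Γ) = ∫ ∏_{i <_Q j} W(x_i,x_j) dμ(x_1) ⋯ dμ(x_|Q|)` for every finite poset `Q`. -/
def Represents (K : PosetKernel S) (Γ : ProperPosetLimit) : Prop :=
  ∀ (n : ℕ) (Q : PosetOn (Fin (n + 1))),
    PosetLimit.t Q.unlabelled Γ.1 =
      ∫ x : Fin (n + 1) → S.carrier,
        ∏ i, ∏ j, (if Q.lt i j then (K.W (x i) (x j) : ℝ) else 1)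
        ∂(Measure.pi fun _ => S.μ)

end PosetKernel

open Classical in
/-- The distribution of the random infinite poset `P(∞,Γ)`, for a non-random proper poset limit
`Γ`: the distribution of `P(∞,W)` for any kernel `W` that represents `Γ`. -/
def pInftyLaw (Γ : ProperPosetLimit) : Measure (PosetOn ℕ) :=
  if h : ∃ (S : OrderedProbabilitySpace.{0}) (K : PosetKernel S), K.Represents Γ then
    h.choose_spec.choose.law
  else 0

/-- The distribution of `P(∞,Γ)` for a random proper poset limit `Γ` with distribution `m`
(independent of the other variables of the construction): the mixture over `m`. -/
def pInftyMixture (m : Measure ProperPosetLimit) : Measure (PosetOn ℕ) := m.bind pInftyLaw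

/-! ### Exchangeable random infinite posets -/

/-- Invariance of the distribution of a random infinite poset under all permutations. -/
def Exchangeable (ν : Measure (PosetOn ℕ)) : Prop :=
  ∀ σ : Equiv.Perm ℕ, ν.map (fun R => R.comap σ) = ν

/-- The convex set of the distributions of exchangeable random infinite posets. -/
def exchangeableLaws : Set (Measure (PosetOn ℕ)) :=
  {ν | IsProbabilityMeasure ν ∧ Exchangeable ν}

/-- The event `R ⊃ Q`, for a labelled poset `Q` with ground set `A`. -/
def containsEvent {A : Finset ℕ} (Q : PosetOn A) : Set (PosetOn ℕ) :=
  {R | ∀ x y : A, Q.lt x y → R.lt x y}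

/-- The event `R|_A = Q`, for a labelled poset `Q` with ground set `A`. -/
def restrictEvent {A : Finset ℕ} (Q : PosetOn A) : Set (PosetOn ℕ) :=
  {R | R.comap (fun x : A => (x : ℕ)) = Q}

/-- The restriction of an infinite poset to its first `n + 1` points, regarded as an unlabelled
finite poset and thus as a point of the space of poset limits. -/
def initialSegment (n : ℕ) (R : PosetOn ℕ) : PosetLimit :=
  (R.comap (fun i : Fin (n + 1) => (i : ℕ))).unlabelled.toLimit

end PosetLimits

end

open PosetLimits

noncomputable section

namespace PosetLimits

open ProbabilityTheory
open scoped ENNReal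

/-! ### Events in the space of infinite posets -/

/-- The event that a random infinite poset contains all pairs of `D`. -/
def pairsEvent (D : Finset (ℕ × ℕ)) : Set (PosetOn ℕ) := {R | ∀ p ∈ D, R.lt p.1 p.2}

/-- The event that a random infinite poset contains the image of `Q` under `ι`. -/
def embEvent {V : Type*} (Q : PosetOn V) (ι : V → ℕ) : Set (PosetOn ℕ) :=
  {R | ∀ x y, Q.lt x y → R.lt (ι x) (ι y)}

theorem continuous_bit (i j : ℕ) : Continuous fun R : PosetOn ℕ => R.1 i j :=
  (continuous_apply j).comp ((continuous_apply i).comp continuous_subtype_val)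

theorem measurable_bit (i j : ℕ) : Measurable fun R : PosetOn ℕ => R.1 i j :=
  (measurable_pi_apply j).comp ((measurable_pi_apply i).comp measurable_subtype_coe)

theorem measurable_posetOn_comap {U : Type*} (f : U → ℕ) :
    Measurable fun R : PosetOn ℕ => R.comap f := by
  refine Measurable.subtype_mk ?_
  exact measurable_pi_lambda _ fun i => measurable_pi_lambda _ fun j => measurable_bit _ _

theorem isClopen_lt (i j : ℕ) : IsClopen {R : PosetOn ℕ | R.lt i j} :=
  (isClopen_discrete {true}).preimage (continuous_bit i j)

theorem isClopen_pairsEvent (D : Finset (ℕ × ℕ)) : IsClopen (pairsEvent D) := by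
  have : pairsEvent D = ⋂ p ∈ D, {R : PosetOn ℕ | R.lt p.1 p.2} := by
    ext R
    simp [pairsEvent]
  rw [this]
  exact D.finite_toSet.isClopen_biInter fun p _ => isClopen_lt _ _

theorem isClopen_embEvent {V : Type*} [Finite V] (Q : PosetOn V) (ι : V → ℕ) :
    IsClopen (embEvent Q ι) := by
  have : embEvent Q ι =
      ⋂ p ∈ {p : V × V | Q.lt p.1 p.2}, {R : PosetOn ℕ | R.lt (ι p.1) (ι p.2)} := by
    ext R
    simp [embEvent]
  rw [this]
  exact (Set.toFinite _).isClopen_biInter fun p _ => isClopen_lt _ _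

instance : CompactSpace (PosetOn ℕ) := by
  suffices hc : IsClosed {r : ℕ → ℕ → Bool |
      (∀ x, r x x = false) ∧ ∀ x y z, r x y = true → r y z = true → r x z = true} from
    isCompact_iff_compactSpace.1 hc.isCompact
  have h : ∀ i j, Continuous fun r : ℕ → ℕ → Bool => r i j := fun i j => by fun_prop
  have h1 : ∀ i j b, IsClopen {r : ℕ → ℕ → Bool | r i j = b} := fun i j b =>
    (isClopen_discrete {b}).preimage (h i j)
  simp only [Set.ofPred_and, Set.ofPred_forall]
  refine IsClosed.inter (isClosed_iInter fun x => (h1 _ _ _).1) ?_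
  refine isClosed_iInter fun x => isClosed_iInter fun y => isClosed_iInter fun z => ?_
  exact isClosed_imp (h1 _ _ _).2 (isClosed_imp (h1 _ _ _).2 (h1 _ _ _).1)

theorem containsEvent_eq_embEvent {A : Finset ℕ} (Q : PosetOn A) :
    containsEvent Q = embEvent Q fun x : A => (x : ℕ) := rfl

theorem measurableSet_pairsEvent (D : Finset (ℕ × ℕ)) : MeasurableSet (pairsEvent D) :=
  (isClopen_pairsEvent D).2.measurableSet

theorem measurableSet_embEvent {V : Type*} [Finite V] (Q : PosetOn V) (ι : V → ℕ) :
    MeasurableSet (embEvent Q ι) :=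
  (isClopen_embEvent Q ι).2.measurableSet

theorem isPiSystem_pairsEvent : IsPiSystem (Set.range pairsEvent) := by
  rintro _ ⟨D, rfl⟩ _ ⟨D', rfl⟩ -
  refine ⟨D ∪ D', ?_⟩
  ext R
  simp only [pairsEvent, Finset.mem_union, Set.mem_ofPred_eq, Set.mem_inter_iff]
  exact ⟨fun h => ⟨fun p hp => h p (.inl hp), fun p hp => h p (.inr hp)⟩,
    fun h p hp => hp.elim (h.1 p) (h.2 p)⟩

theorem generateFrom_pairsEvent :
    (inferInstance : MeasurableSpace (PosetOn ℕ)) =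
      MeasurableSpace.generateFrom (Set.range pairsEvent) := by
  refine le_antisymm ?_ ?_
  · have : @Measurable (PosetOn ℕ) (ℕ → ℕ → Bool)
        (MeasurableSpace.generateFrom (Set.range pairsEvent)) _ Subtype.val := by
      refine @measurable_pi_lambda _ _ _ (_) _ _ fun i =>
        @measurable_pi_lambda _ _ _ (_) _ _ fun j => ?_
      refine @measurable_to_bool _ (_) _ ?_
      refine MeasurableSpace.measurableSet_generateFrom ⟨{(i, j)}, ?_⟩
      ext R
      simp [pairsEvent, PosetOn.lt]
    exact this.comap_le
  · refine MeasurableSpace.generateFrom_le ?_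
    rintro _ ⟨D, rfl⟩
    exact measurableSet_pairsEvent D

theorem pairsEvent_eq_empty_or_containsEvent (D : Finset (ℕ × ℕ)) :
    pairsEvent D = ∅ ∨ ∃ (A : Finset ℕ) (_ : Nonempty A) (Q : PosetOn A),
      (A : Set ℕ) = insert 0 {i | ∃ p ∈ D, i = p.1 ∨ i = p.2} ∧
      pairsEvent D = containsEvent Q := by
  classical
  rcases (pairsEvent D).eq_empty_or_nonempty with h | ⟨R₀, h₀⟩
  · exact .inl h
  refine .inr ⟨insert 0 (D.image Prod.fst ∪ D.image Prod.snd), ⟨0, by simp⟩, ⟨fun x y =>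
    decide (∀ R ∈ pairsEvent D, R.lt x y), ?_, ?_⟩, ?_, ?_⟩
  · intro x
    refine decide_eq_false fun h => ?_
    have h1 := h R₀ h₀
    have h2 := R₀.2.1 x
    simp [PosetOn.lt, h2] at h1
  · intro x y z hxy hyz
    refine decide_eq_true fun R hR => ?_
    exact R.2.2 _ _ _ (of_decide_eq_true hxy R hR) (of_decide_eq_true hyz R hR)
  · ext i
    simp only [Finset.coe_insert, Finset.coe_union, Finset.coe_image, Set.mem_insert_iff,
      Set.mem_union, Set.mem_image, SetLike.mem_coe, Set.mem_ofPred_eq]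
    grind
  · ext R
    constructor
    · intro hR x y hxy
      exact of_decide_eq_true hxy R hR
    · intro hR p hp
      refine hR ⟨p.1, ?_⟩ ⟨p.2, ?_⟩ (decide_eq_true fun R' hR' => hR' p hp)
      · simp only [Finset.mem_insert, Finset.mem_union, Finset.mem_image]
        exact .inr (.inl ⟨p, hp, rfl⟩)
      · simp only [Finset.mem_insert, Finset.mem_union, Finset.mem_image]
        exact .inr (.inr ⟨p, hp, rfl⟩)

/-- The distribution of a random infinite poset is determined by the probabilities of the
events `R ⊃ Q`. -/
theorem measure_ext_of_containsEvent {ν ν' : Measure (PosetOn ℕ)} [IsProbabilityMeasure ν]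
    [IsProbabilityMeasure ν']
    (h : ∀ (A : Finset ℕ) [Nonempty A] (Q : PosetOn A),
      ν.real (containsEvent Q) = ν'.real (containsEvent Q)) : ν = ν' := by
  refine ext_of_generate_finite _ generateFrom_pairsEvent isPiSystem_pairsEvent ?_ (by simp)
  rintro _ ⟨D, rfl⟩
  rcases pairsEvent_eq_empty_or_containsEvent D with h0 | ⟨A, hA, Q, -, hQ⟩
  · simp [h0]
  · rw [hQ]
    have := h A Q
    simpa [measureReal_def, ENNReal.toReal_eq_toReal_iff'] using this

/-! ### Isomorphism classes and homomorphism densities -/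

section densities

variable {V V' U U' : Type*}

theorem PosetOn.iso_comap (Q : PosetOn V) (e : V' ≃ V) : (Q.comap e).Iso Q :=
  ⟨e, fun _ _ => Iff.rfl⟩

theorem PosetOn.Iso.symm {Q : PosetOn V} {P : PosetOn U} (h : Q.Iso P) : P.Iso Q := by
  obtain ⟨e, he⟩ := h
  exact ⟨e.symm, fun x y => by simp [he]⟩

theorem PosetOn.Iso.trans {Q : PosetOn V} {P : PosetOn U} {P' : PosetOn U'}
    (h : Q.Iso P) (h' : P.Iso P') : Q.Iso P' := by
  obtain ⟨e, he⟩ := h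
  obtain ⟨g, hg⟩ := h'
  exact ⟨e.trans g, fun x y => by simp [he, hg]⟩

theorem PosetOn.unlabelled_eq_of_iso [Fintype V] [Nonempty V] [Fintype U] [Nonempty U]
    {Q : PosetOn V} {P : PosetOn U} (h : Q.Iso P) : Q.unlabelled = P.unlabelled :=
  Quotient.sound (s := finPosetSetoid)
    (((Q.iso_comap _).trans h).trans (P.iso_comap _).symm)

theorem FinPoset.exists_rep (P : FinPoset) :
    ∃ (n : ℕ) (p : PosetOn (Fin (n + 1))), p.unlabelled = P := by
  induction P using Quotient.inductionOn with
  | h P => exact ⟨P.1, P.2, Quotient.sound (s := finPosetSetoid) (P.2.iso_comap _)⟩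

variable [Fintype V] [Nonempty V] [Fintype V'] [Nonempty V'] [Fintype U] [Nonempty U]

theorem FinPoset.t_unlabelled (Q : PosetOn V) (P : PosetOn U) :
    (FinPoset.t Q.unlabelled P.unlabelled : ℝ) = Q.homDensity P :=
  PosetOn.homDensity_congr (Q.iso_comap _) (P.iso_comap _)

theorem FinPoset.tInd_unlabelled (Q : PosetOn V) (P : PosetOn U) :
    FinPoset.tInd Q.unlabelled P.unlabelled = Q.indDensity P :=
  PosetOn.indDensity_congr (Q.iso_comap _) (P.iso_comap _)

theorem FinPoset.size_unlabelled (P : PosetOn U) : P.unlabelled.size = Fintype.card U :=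
  Nat.sub_add_cancel (Fintype.card_pos (α := U))

theorem PosetLimit.t_toLimit (Q P : FinPoset) : PosetLimit.t Q P.toLimit = FinPoset.t Q P := rfl

theorem PosetLimit.continuous_t (Q : FinPoset) : Continuous (PosetLimit.t Q) := by
  unfold PosetLimit.t
  fun_prop

theorem PosetLimit.t_mem (Q : FinPoset) (Γ : PosetLimit) : PosetLimit.t Q Γ ∈ Set.Icc (0 : ℝ) 1 :=
  (Γ.1.1 Q).2

theorem denseRange_toLimit : DenseRange FinPoset.toLimit := by
  intro Γ
  rw [closure_subtype]
  convert Γ.2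
  ext x
  constructor
  · rintro ⟨_, ⟨P, rfl⟩, rfl⟩
    exact ⟨P, rfl⟩
  · rintro ⟨P, rfl⟩
    exact ⟨P.toLimit, ⟨P, rfl⟩, rfl⟩

/-- The disjoint union of two posets. -/
def PosetOn.sum {V V' : Type*} (Q : PosetOn V) (Q' : PosetOn V') : PosetOn (V ⊕ V') :=
  ⟨fun a b => match a, b with
    | .inl x, .inl y => Q.1 x y
    | .inr x, .inr y => Q'.1 x y
    | _, _ => false,
    by rintro (x | x); exacts [Q.2.1 x, Q'.2.1 x],
    by
      rintro (x | x) (y | y) (z | z) h h' <;> simp_all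
      exacts [Q.2.2 x y z h h', Q'.2.2 x y z h h']⟩

theorem PosetOn.homDensity_sum {V V' U : Type*} [Fintype V] [Fintype V'] [Fintype U]
    (Q : PosetOn V) (Q' : PosetOn V') (P : PosetOn U) :
    (Q.sum Q').homDensity P = Q.homDensity P * Q'.homDensity P := by
  unfold homDensity
  rw [div_mul_div_comm]
  congr 1
  · rw [← Nat.cast_mul, ← Nat.card_prod]
    congr 1
    refine Nat.card_congr
      ⟨fun f => (⟨fun x => f.1 (.inl x), fun x y h => f.2 (.inl x) (.inl y) h⟩,
          ⟨fun x => f.1 (.inr x), fun x y h => f.2 (.inr x) (.inr y) h⟩),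
        fun f => ⟨Sum.elim f.1.1 f.2.1, ?_⟩, fun f => ?_, fun f => rfl⟩
    · rintro (x | x) (y | y) h
      · exact f.1.2 x y h
      · simp [PosetOn.lt, PosetOn.sum] at h
      · simp [PosetOn.lt, PosetOn.sum] at h
      · exact f.2.2 x y h
    · ext (x | x) <;> rfl
  · rw [← Nat.cast_mul, ← Nat.card_prod]
    congr 1
    exact Nat.card_congr (Equiv.sumArrowEquivProdArrow V V' U)

theorem PosetLimit.t_sum (Q : PosetOn V) (Q' : PosetOn V') (Γ : PosetLimit) :
    PosetLimit.t (Q.sum Q').unlabelled Γ =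
      PosetLimit.t Q.unlabelled Γ * PosetLimit.t Q'.unlabelled Γ := by
  induction Γ using denseRange_toLimit.induction_on with
  | hp =>
    exact isClosed_eq (continuous_t _) ((continuous_t _).mul (continuous_t _))
  | ih P =>
    obtain ⟨n, p, rfl⟩ := P.exists_rep
    simp only [PosetLimit.t_toLimit, FinPoset.t_unlabelled, PosetOn.homDensity_sum]

end densities

/-! ### The distribution of the infinite poset of a poset limit -/

/-- The events `R ⊃ Q` have the probabilities prescribed by the poset limit `Γ`. -/
def HasDensities (ν : Measure (PosetOn ℕ)) (Γ : PosetLimit) : Prop :=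
  ∀ (A : Finset ℕ) [Nonempty A] (Q : PosetOn A),
    ν.real (containsEvent Q) = PosetLimit.t Q.unlabelled Γ

theorem HasDensities.embEvent {ν : Measure (PosetOn ℕ)} {Γ : PosetLimit} (h : HasDensities ν Γ)
    {V : Type*} [Fintype V] [Nonempty V] (Q : PosetOn V) {ι : V → ℕ}
    (hι : Function.Injective ι) : ν.real (embEvent Q ι) = PosetLimit.t Q.unlabelled Γ := by
  classical
  let A : Finset ℕ := Finset.univ.map ⟨ι, hι⟩
  let e : V ≃ A := Equiv.ofBijective (fun x => ⟨ι x, by simp [A]⟩)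
    ⟨fun x y hxy => hι (by simpa using hxy), fun ⟨y, hy⟩ => by
      obtain ⟨x, -, rfl⟩ := Finset.mem_map.1 hy
      exact ⟨x, rfl⟩⟩
  have : Nonempty A := e.nonempty_congr.1 inferInstance
  rw [← PosetOn.unlabelled_eq_of_iso (Q.iso_comap e.symm), ← h A (Q.comap e.symm)]
  congr 1
  ext R
  constructor
  · intro hR x y hxy
    have h1 := hR _ _ hxy
    rwa [show ι (e.symm x) = x from congrArg Subtype.val (e.apply_symm_apply x),
      show ι (e.symm y) = y from congrArg Subtype.val (e.apply_symm_apply y)] at h1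
  · intro hR x y hxy
    exact hR (e x) (e y) (by simpa [PosetOn.lt, PosetOn.comap] using hxy)

/-- The distribution of the infinite poset sampled (with replacement) from a finite poset. -/
def sampleLaw {n : ℕ} (p : PosetOn (Fin (n + 1))) : Measure (PosetOn ℕ) :=
  (Measure.infinitePi fun _ : ℕ => (PMF.uniformOfFintype (Fin (n + 1))).toMeasure).map p.comap

theorem measurable_comap_left {n : ℕ} (p : PosetOn (Fin (n + 1))) :
    Measurable fun f : ℕ → Fin (n + 1) => p.comap f := by
  refine Measurable.subtype_mk ?_
  refine measurable_pi_lambda _ fun i => measurable_pi_lambda _ fun j => ?_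
  have : Measurable fun q : Fin (n + 1) × Fin (n + 1) => p.1 q.1 q.2 := measurable_of_countable _
  exact this.comp (f := fun f : ℕ → Fin (n + 1) => (f i, f j))
    ((measurable_pi_apply i).prodMk (measurable_pi_apply j))

instance {n : ℕ} (p : PosetOn (Fin (n + 1))) : IsProbabilityMeasure (sampleLaw p) :=
  Measure.isProbabilityMeasure_map (measurable_comap_left p).aemeasurable

theorem pi_uniform_real {ι : Type*} [Fintype ι] {n : ℕ} (s : Set (ι → Fin (n + 1))) :
    (Measure.pi fun _ : ι => (PMF.uniformOfFintype (Fin (n + 1))).toMeasure).real s =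
      (Nat.card s : ℝ) / Nat.card (ι → Fin (n + 1)) := by
  classical
  have h1 : ∀ f : ι → Fin (n + 1),
      (Measure.pi fun _ : ι => (PMF.uniformOfFintype (Fin (n + 1))).toMeasure).real {f} =
        ((Nat.card (ι → Fin (n + 1)) : ℝ))⁻¹ := by
    intro f
    rw [measureReal_def, Measure.pi_singleton]
    have h : ((n : ENNReal) + 1).toReal = n + 1 := by
      exact_mod_cast ENNReal.toReal_natCast (n + 1)
    simp [ENNReal.toReal_inv, ENNReal.toReal_pow, h]
  have h2 := sum_measureReal_singleton
    (μ := Measure.pi fun _ : ι => (PMF.uniformOfFintype (Fin (n + 1))).toMeasure) s.toFinset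
  rw [Set.coe_toFinset] at h2
  rw [← h2, Finset.sum_congr rfl fun f _ => h1 f]
  simp [div_eq_mul_inv]

theorem sampleLaw_real_restrict {n : ℕ} (p : PosetOn (Fin (n + 1))) (A : Finset ℕ)
    (s : Set (PosetOn A)) (hs : MeasurableSet {R : PosetOn ℕ | R.comap (fun x : A => (x : ℕ)) ∈ s}) :
    (sampleLaw p).real {R | R.comap (fun x : A => (x : ℕ)) ∈ s} =
      (Nat.card {f : A → Fin (n + 1) // p.comap f ∈ s} : ℝ) / Nat.card (A → Fin (n + 1)) := by
  have h1 := pi_uniform_real {f : A → Fin (n + 1) | p.comap f ∈ s}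
  rw [← Measure.infinitePi_map_restrict
    (μ := fun _ : ℕ => (PMF.uniformOfFintype (Fin (n + 1))).toMeasure), map_measureReal_apply (Finset.measurable_restrict A)
    (Set.toFinite _).measurableSet] at h1
  rw [sampleLaw, map_measureReal_apply (measurable_comap_left p) hs]
  exact h1

theorem hasDensities_sampleLaw {n : ℕ} (p : PosetOn (Fin (n + 1))) :
    HasDensities (sampleLaw p) p.unlabelled.toLimit := by
  intro A _ Q
  rw [PosetLimit.t_toLimit, FinPoset.t_unlabelled]
  exact sampleLaw_real_restrict p A {P | ∀ x y, Q.lt x y → P.lt x y}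
    (measurableSet_embEvent Q fun x : A => (x : ℕ))

theorem continuous_probabilityMeasure_real {s : Set (PosetOn ℕ)} (hs : IsClopen s) :
    Continuous fun ν : ProbabilityMeasure (PosetOn ℕ) => (ν : Measure (PosetOn ℕ)).real s := by
  let f : C(PosetOn ℕ, ℝ) := ⟨s.indicator 1, hs.continuous_indicator continuous_one⟩
  have h := ProbabilityMeasure.continuous_integral_continuousMap (X := PosetOn ℕ) f
  refine h.congr fun ν => ?_
  exact integral_indicator_one hs.2.measurableSet

theorem isClosed_hasDensities :
    IsClosed {q : PosetLimit × ProbabilityMeasure (PosetOn ℕ) | HasDensities q.2 q.1} := by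
  simp only [HasDensities, Set.ofPred_forall]
  refine isClosed_iInter fun A => isClosed_iInter fun _ => isClosed_iInter fun Q => ?_
  exact isClosed_eq ((continuous_probabilityMeasure_real (isClopen_embEvent Q _)).comp
    continuous_snd) ((PosetLimit.continuous_t _).comp continuous_fst)

theorem exists_hasDensities (Γ : PosetLimit) :
    ∃ ν : ProbabilityMeasure (PosetOn ℕ), HasDensities ν Γ := by
  have h := isClosedMap_fst_of_compactSpace (X := PosetLimit)
    (Y := ProbabilityMeasure (PosetOn ℕ)) _ isClosed_hasDensities
  have h2 : closure (Set.range FinPoset.toLimit) ⊆ Prod.fst ''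
      {q : PosetLimit × ProbabilityMeasure (PosetOn ℕ) | HasDensities q.2 q.1} := by
    refine closure_minimal ?_ h
    rintro _ ⟨P, rfl⟩
    obtain ⟨n, p, rfl⟩ := P.exists_rep
    exact ⟨(_, ⟨sampleLaw p, inferInstance⟩), hasDensities_sampleLaw p, rfl⟩
  obtain ⟨⟨Γ', ν⟩, hν, rfl⟩ := h2 (denseRange_toLimit Γ)
  exact ⟨ν, hν⟩

/-- The distribution of the infinite random poset with the densities of `Γ`. -/
def limitLaw (Γ : PosetLimit) : ProbabilityMeasure (PosetOn ℕ) := (exists_hasDensities Γ).choose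

theorem hasDensities_limitLaw (Γ : PosetLimit) : HasDensities (limitLaw Γ) Γ :=
  (exists_hasDensities Γ).choose_spec

theorem HasDensities.eq_limitLaw {ν : Measure (PosetOn ℕ)} [IsProbabilityMeasure ν]
    {Γ : PosetLimit} (h : HasDensities ν Γ) : ν = limitLaw Γ :=
  measure_ext_of_containsEvent fun A _ Q => by rw [h A Q, hasDensities_limitLaw Γ A Q]

theorem continuous_limitLaw : Continuous limitLaw := by
  refine continuous_iff_isClosed.2 fun s hs => ?_
  have h := isClosedMap_fst_of_compactSpace (X := PosetLimit)
    (Y := ProbabilityMeasure (PosetOn ℕ)) _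
    (isClosed_hasDensities.inter (hs.preimage continuous_snd))
  convert h using 1
  ext Γ
  constructor
  · exact fun hΓ => ⟨(Γ, limitLaw Γ), ⟨hasDensities_limitLaw Γ, hΓ⟩, rfl⟩
  · rintro ⟨⟨Γ', ν⟩, ⟨h1, h2⟩, rfl⟩
    have : ν = limitLaw Γ' := Subtype.ext (HasDensities.eq_limitLaw (ν := (ν : Measure (PosetOn ℕ))) h1)
    exact this ▸ h2

theorem measurable_limitLaw :
    Measurable fun Γ : PosetLimit => (limitLaw Γ : Measure (PosetOn ℕ)) := by
  refine Measurable.measure_of_isPiSystem_of_isProbabilityMeasure generateFrom_pairsEvent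
    isPiSystem_pairsEvent ?_
  rintro _ ⟨D, rfl⟩
  rcases pairsEvent_eq_empty_or_containsEvent D with h0 | ⟨A, hA, Q, -, hQ⟩
  · simp [h0]
  · simp_rw [hQ]
    have : (fun Γ : PosetLimit => (limitLaw Γ : Measure (PosetOn ℕ)) (containsEvent Q)) =
        fun Γ => ENNReal.ofReal (PosetLimit.t Q.unlabelled Γ) := by
      ext Γ
      rw [← hasDensities_limitLaw Γ A Q, ofReal_measureReal]
    rw [this]
    exact ENNReal.measurable_ofReal.comp (PosetLimit.continuous_t _).measurable

theorem HasDensities.map_comap {ν : Measure (PosetOn ℕ)} [IsProbabilityMeasure ν] {Γ : PosetLimit}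
    (h : HasDensities ν Γ) {τ : ℕ → ℕ} (hτ : Function.Injective τ) :
    ν.map (fun R => R.comap τ) = ν := by
  have := Measure.isProbabilityMeasure_map (μ := ν) (measurable_posetOn_comap τ).aemeasurable
  refine measure_ext_of_containsEvent fun A _ Q => ?_
  rw [h A Q, containsEvent_eq_embEvent,
    map_measureReal_apply (measurable_posetOn_comap τ) (measurableSet_embEvent Q _)]
  exact h.embEvent Q (hτ.comp Subtype.val_injective)

theorem HasDensities.exchangeable {ν : Measure (PosetOn ℕ)} [IsProbabilityMeasure ν]
    {Γ : PosetLimit} (h : HasDensities ν Γ) : Exchangeable ν :=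
  fun σ => h.map_comap σ.injective

/-! ### Conditional probabilities and measure-preserving maps -/

/-- Let `θ` preserve `P` and the event `A`. If `Z ∘ θ` is a function of `Y`, which itself is a
function of `Z`, then the conditional probability of `A` given `Z` is a function of `Y`. -/
theorem exists_condProb_of_measurePreserving {Ω Y Z : Type*} [MeasurableSpace Ω]
    [MeasurableSpace Y] [MeasurableSpace Z] {P : Measure Ω} [IsProbabilityMeasure P]
    {θ : Ω → Ω} (hθ : MeasurePreserving θ P P) {A : Set Ω} (hA : MeasurableSet A)
    (hθA : θ ⁻¹' A = A) {z : Ω → Z} (hz : Measurable z) {y : Ω → Y}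
    {φ : Z → Y} (hφ : Measurable φ) (hyz : ∀ ω, φ (z ω) = y ω)
    {g : Y → Z} (hg : Measurable g) (hzθ : ∀ ω, z (θ ω) = g (y ω)) :
    ∃ w : Y → ℝ≥0∞, Measurable w ∧ (∀ y, w y ≤ 1) ∧ ∀ h : Z → ℝ≥0∞, Measurable h →
      ∫⁻ ω in A, h (z ω) ∂P = ∫⁻ ω, w (y ω) * h (z ω) ∂P := by
  have hle : (P.restrict A).map z ≤ P.map z := Measure.map_mono Measure.restrict_le_self hz
  set v₀ := ((P.restrict A).map z).rnDeriv (P.map z) with hv₀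
  have hv₀m : Measurable v₀ := Measure.measurable_rnDeriv _ _
  set v : Z → ℝ≥0∞ := fun x => min (v₀ x) 1 with hv
  have hvm : Measurable v := hv₀m.min measurable_const
  have hv1 : ∀ x, v x ≤ 1 := fun x => min_le_right _ _
  have hae : v =ᵐ[P.map z] v₀ := by
    filter_upwards [Measure.rnDeriv_le_one_of_le hle] with x hx
    exact min_eq_left hx
  have key : ∀ h : Z → ℝ≥0∞, Measurable h →
      ∫⁻ ω in A, h (z ω) ∂P = ∫⁻ ω, v (z ω) * h (z ω) ∂P := by
    intro h hh
    calc ∫⁻ ω in A, h (z ω) ∂P = ∫⁻ x, h x ∂((P.restrict A).map z) := (lintegral_map hh hz).symm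
      _ = ∫⁻ x, v₀ x * h x ∂(P.map z) :=
        (lintegral_rnDeriv_mul hle.absolutelyContinuous hh.aemeasurable).symm
      _ = ∫⁻ x, v x * h x ∂(P.map z) := by
        refine lintegral_congr_ae ?_
        filter_upwards [hae] with x hx
        rw [hx]
      _ = ∫⁻ ω, v (z ω) * h (z ω) ∂P := lintegral_map (hvm.mul hh) hz
  have hy : Measurable y := by
    have : y = φ ∘ z := funext fun ω => (hyz ω).symm
    rw [this]
    exact hφ.comp hz
  set a : Ω → ℝ≥0∞ := fun ω => v (z ω) with ha
  set b : Ω → ℝ≥0∞ := fun ω => v (g (y ω)) with hb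
  have ham : Measurable a := hvm.comp hz
  have hbm : Measurable b := hvm.comp (hg.comp hy)
  have hab : ∀ ω, a (θ ω) = b ω := fun ω => by simp only [ha, hb, hzθ]
  have e1 : ∫⁻ ω, a ω * b ω ∂P = ∫⁻ ω, a ω * a ω ∂P := by
    have h1 := key (fun x => v (g (φ x))) (hvm.comp (hg.comp hφ))
    simp only [hyz] at h1
    rw [← key v hvm]
    change ∫⁻ ω, v (z ω) * v (g (y ω)) ∂P = _
    rw [← h1]
    calc ∫⁻ ω in A, v (g (y ω)) ∂P = ∫⁻ ω in θ ⁻¹' A, a (θ ω) ∂P := by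
          rw [hθA]
          simp only [hab, hb]
      _ = ∫⁻ ω in A, a ω ∂P := hθ.setLIntegral_comp_preimage hA ham
  have e2 : ∫⁻ ω, b ω * b ω ∂P = ∫⁻ ω, a ω * a ω ∂P := by
    simp only [← hab]
    exact hθ.lintegral_comp (ham.mul ham)
  have ha1 : ∀ ω, a ω ≤ 1 := fun ω => hv1 _
  have hb1 : ∀ ω, b ω ≤ 1 := fun ω => hv1 _
  have hreal : ∀ f f' : Ω → ℝ≥0∞, Measurable f → Measurable f' → (∀ ω, f ω ≤ 1) →
      (∀ ω, f' ω ≤ 1) → ∫ ω, (f ω).toReal * (f' ω).toReal ∂P = (∫⁻ ω, f ω * f' ω ∂P).toReal := by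
    intro f f' hf hf' h1 h1'
    simp only [← ENNReal.toReal_mul]
    refine integral_toReal (hf.mul hf').aemeasurable (ae_of_all _ fun ω => ?_)
    exact (mul_le_one' (h1 ω) (h1' ω)).trans_lt ENNReal.one_lt_top
  have hint : ∀ f f' : Ω → ℝ≥0∞, Measurable f → Measurable f' → (∀ ω, f ω ≤ 1) →
      (∀ ω, f' ω ≤ 1) → Integrable (fun ω => (f ω).toReal * (f' ω).toReal) P := by
    intro f f' hf hf' h1 h1'
    refine Integrable.of_bound (hf.ennreal_toReal.mul hf'.ennreal_toReal).aestronglyMeasurable 1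
      (ae_of_all _ fun ω => ?_)
    rw [← ENNReal.toReal_mul, Real.norm_of_nonneg ENNReal.toReal_nonneg]
    exact ENNReal.toReal_le_of_le_ofReal zero_le_one
      (by simpa using mul_le_one' (h1 ω) (h1' ω))
  have hzero : ∫ ω, ((a ω).toReal - (b ω).toReal) ^ 2 ∂P = 0 := by
    have : ∀ ω, ((a ω).toReal - (b ω).toReal) ^ 2 = (a ω).toReal * (a ω).toReal -
        2 * ((a ω).toReal * (b ω).toReal) + (b ω).toReal * (b ω).toReal := fun ω => by ring
    simp only [this]
    have hi : Integrable (fun ω => (a ω).toReal * (a ω).toReal -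
        2 * ((a ω).toReal * (b ω).toReal)) P :=
      (hint a a ham ham ha1 ha1).sub ((hint a b ham hbm ha1 hb1).const_mul 2)
    rw [integral_add hi
      (hint b b hbm hbm hb1 hb1), integral_sub (hint a a ham ham ha1 ha1)
      ((hint a b ham hbm ha1 hb1).const_mul 2), integral_const_mul,
      hreal a a ham ham ha1 ha1, hreal a b ham hbm ha1 hb1, hreal b b hbm hbm hb1 hb1, e1, e2]
    ring
  have hsq : Integrable (fun ω => ((a ω).toReal - (b ω).toReal) ^ 2) P := by
    refine Integrable.of_bound
      ((ham.ennreal_toReal.sub hbm.ennreal_toReal).pow_const 2).aestronglyMeasurable 1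
      (ae_of_all _ fun ω => ?_)
    have h1 : (a ω).toReal ≤ 1 := ENNReal.toReal_le_of_le_ofReal zero_le_one (by simpa using ha1 ω)
    have h2 : (b ω).toReal ≤ 1 := ENNReal.toReal_le_of_le_ofReal zero_le_one (by simpa using hb1 ω)
    have h3 : 0 ≤ (a ω).toReal := ENNReal.toReal_nonneg
    have h4 : 0 ≤ (b ω).toReal := ENNReal.toReal_nonneg
    rw [Real.norm_of_nonneg (sq_nonneg _)]
    nlinarith
  have haeq : a =ᵐ[P] b := by
    have := (integral_eq_zero_iff_of_nonneg (fun ω => sq_nonneg _) hsq).1 hzero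
    filter_upwards [this] with ω hω
    have h1 : (a ω).toReal = (b ω).toReal := by
      have h2 : ((a ω).toReal - (b ω).toReal) ^ 2 = 0 := hω
      exact sub_eq_zero.1 (pow_eq_zero_iff two_ne_zero |>.1 h2)
    exact (ENNReal.toReal_eq_toReal_iff' ((ha1 ω).trans_lt ENNReal.one_lt_top).ne
      ((hb1 ω).trans_lt ENNReal.one_lt_top).ne).1 h1
  refine ⟨fun x => v (g x), hvm.comp hg, fun x => hv1 _, fun h hh => ?_⟩
  rw [key h hh]
  refine lintegral_congr_ae ?_
  filter_upwards [haeq] with ω hω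
  exact congrArg (· * h (z ω)) hω

/-! ### Exchangeable arrays -/

/-- Zero-one arrays indexed by two copies of `ℕ`; the first copy is used as a reference set. -/
abbrev BoolArray : Type := ℕ ⊕ ℕ → ℕ ⊕ ℕ → Bool

namespace BoolArray

/-- The array pulled back along a map of the index set. -/
def reindex (τ : ℕ ⊕ ℕ → ℕ ⊕ ℕ) (R : BoolArray) : BoolArray := fun a b => R (τ a) (τ b)

/-- The entries between reference points. -/
def base (R : BoolArray) : ℕ → ℕ → Bool := fun k l => R (.inl k) (.inl l)

/-- The entries between the point `i` and the reference points. -/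
def type (i : ℕ) (R : BoolArray) : ℕ → Bool × Bool :=
  fun k => (R (.inl k) (.inr i), R (.inr i) (.inl k))

/-- Delete the entries between points of `I`. -/
def erasePairs (I : Finset ℕ) (R : BoolArray) : BoolArray := fun a b =>
  match a, b with
  | .inr i, .inr j => if i ∈ I ∧ j ∈ I then false else R (.inr i) (.inr j)
  | a, b => R a b

/-- Delete all entries that involve the point `i`. -/
def erasePoint (i : ℕ) (R : BoolArray) : BoolArray := fun a b =>
  if a = .inr i ∨ b = .inr i then false else R a b

theorem measurable_entry (a b : ℕ ⊕ ℕ) : Measurable fun R : BoolArray => R a b :=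
  (measurable_pi_apply b).comp (measurable_pi_apply a)

theorem measurable_of_entries {Ω : Type*} [MeasurableSpace Ω] {f : Ω → BoolArray}
    (h : ∀ a b, Measurable fun ω => f ω a b) : Measurable f :=
  measurable_pi_lambda _ fun a => measurable_pi_lambda _ fun b => h a b

theorem measurable_reindex (τ : ℕ ⊕ ℕ → ℕ ⊕ ℕ) : Measurable (reindex τ) :=
  measurable_of_entries fun _ _ => measurable_entry _ _

theorem measurable_base : Measurable base :=
  measurable_pi_lambda _ fun _ => measurable_pi_lambda _ fun _ => measurable_entry _ _

theorem measurable_type (i : ℕ) : Measurable (type i) :=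
  measurable_pi_lambda _ fun _ => (measurable_entry _ _).prodMk (measurable_entry _ _)

theorem measurable_erasePairs (I : Finset ℕ) : Measurable (erasePairs I) := by
  refine measurable_of_entries fun a b => ?_
  rcases a with a | a <;> rcases b with b | b <;> simp only [erasePairs]
  · exact measurable_entry _ _
  · exact measurable_entry _ _
  · exact measurable_entry _ _
  · split_ifs
    · exact measurable_const
    · exact measurable_entry _ _

theorem measurable_erasePoint (i : ℕ) : Measurable (erasePoint i) := by
  refine measurable_of_entries fun a b => ?_
  simp only [erasePoint]
  split_ifs
  · exact measurable_const
  · exact measurable_entry _ _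

theorem base_erasePairs (I : Finset ℕ) (R : BoolArray) : base (erasePairs I R) = base R := rfl

theorem type_erasePairs (I : Finset ℕ) (i : ℕ) (R : BoolArray) :
    type i (erasePairs I R) = type i R := rfl

theorem base_erasePoint (i : ℕ) (R : BoolArray) : base (erasePoint i R) = base R := by
  ext k l
  simp [base, erasePoint]

theorem type_erasePoint {i j : ℕ} (h : j ≠ i) (R : BoolArray) :
    type j (erasePoint i R) = type j R := by
  ext k <;> simp [type, erasePoint, h]

/-- Move the points outside `I` into the reference set, without moving the first `N` reference
points. -/
def intoBase (N : ℕ) (I : Finset ℕ) : ℕ ⊕ ℕ → ℕ ⊕ ℕ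
  | .inl k => if k < N then .inl k else .inl (N + 2 * k)
  | .inr j => if j ∈ I then .inr j else .inl (N + (2 * j + 1))

theorem intoBase_injective (N : ℕ) (I : Finset ℕ) : Function.Injective (intoBase N I) := by
  rintro (k | k) (l | l) h <;> simp only [intoBase] at h <;> split_ifs at h <;>
    simp only [Sum.inl.injEq, Sum.inr.injEq, reduceCtorEq] at h ⊢ <;> omega

theorem measurableSet_entry (a b : ℕ ⊕ ℕ) : MeasurableSet {R : BoolArray | R a b = true} :=
  measurable_entry a b (measurableSet_singleton true)

section invariant

variable {P : Measure BoolArray} [IsProbabilityMeasure P]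

theorem exists_pairProb_zero_one
    (hP : ∀ τ, Function.Injective τ → MeasurePreserving (reindex τ) P P) :
    ∃ w : (ℕ → ℕ → Bool) × (ℕ → Bool × Bool) × (ℕ → Bool × Bool) → ℝ≥0∞,
      Measurable w ∧ (∀ y, w y ≤ 1) ∧ ∀ h : BoolArray → ℝ≥0∞, Measurable h →
        (∀ R, h (erasePairs {0, 1} R) = h R) →
        ∫⁻ R in {R | R (.inr 0) (.inr 1) = true}, h R ∂P =
          ∫⁻ R, w (base R, type 0 R, type 1 R) * h R ∂P := by
  let fill : (ℕ → ℕ → Bool) × (ℕ → Bool × Bool) × (ℕ → Bool × Bool) → BoolArray := fun y a b =>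
    match a, b with
    | .inl k, .inl l => y.1 k l
    | .inl k, .inr j => if j = 0 then (y.2.1 k).1 else (y.2.2 k).1
    | .inr j, .inl k => if j = 0 then (y.2.1 k).2 else (y.2.2 k).2
    | .inr _, .inr _ => false
  have hfill : Measurable fill := by
    refine measurable_of_entries fun a b => ?_
    rcases a with a | a <;> rcases b with b | b <;> simp only [fill]
    · exact (measurable_pi_apply b).comp ((measurable_pi_apply a).comp measurable_fst)
    · split_ifs
      · exact measurable_fst.comp ((measurable_pi_apply a).comp
          (measurable_fst.comp measurable_snd))
      · exact measurable_fst.comp ((measurable_pi_apply a).comp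
          (measurable_snd.comp measurable_snd))
    · split_ifs
      · exact measurable_snd.comp ((measurable_pi_apply b).comp
          (measurable_fst.comp measurable_snd))
      · exact measurable_snd.comp ((measurable_pi_apply b).comp
          (measurable_snd.comp measurable_snd))
    · exact measurable_const
  obtain ⟨w, hw, hw1, h⟩ := exists_condProb_of_measurePreserving
    (hP (intoBase 0 {0, 1}) (intoBase_injective _ _))
    (measurableSet_entry (.inr 0) (.inr 1)) (by ext R; simp [reindex, intoBase])
    (measurable_erasePairs {0, 1}) (y := fun R => (base R, type 0 R, type 1 R))
    (φ := fun R => (base R, type 0 R, type 1 R))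
    (measurable_base.prodMk ((measurable_type 0).prodMk (measurable_type 1)))
    (fun R => rfl) (g := fun y => erasePairs {0, 1} (reindex (intoBase 0 {0, 1}) (fill y)))
    ((measurable_erasePairs _).comp ((measurable_reindex _).comp hfill)) (by
      intro R
      ext a b
      rcases a with a | a <;> rcases b with b | b <;>
        simp only [erasePairs, reindex, intoBase, fill, base, type, Finset.mem_insert,
          Finset.mem_singleton, not_lt_zero, if_false] <;> grind)
  refine ⟨w, hw, hw1, fun k hk hk1 => ?_⟩
  have := h k hk
  simpa only [hk1] using this

theorem reindex_erasePairs (s : Equiv.Perm ℕ) (I : Finset ℕ) (R : BoolArray) :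
    reindex (Sum.map id s.symm) (erasePairs I R) =
      erasePairs (I.map s.toEmbedding) (reindex (Sum.map id s.symm) R) := by
  ext a b
  rcases a with a | a <;> rcases b with b | b <;>
    simp [reindex, erasePairs, Finset.mem_map_equiv]

/-- The conditional probability of an entry given all other entries depends only on the types
of the two points and on the reference entries. -/
theorem exists_pairProb
    (hP : ∀ τ, Function.Injective τ → MeasurePreserving (reindex τ) P P) :
    ∃ w : (ℕ → ℕ → Bool) × (ℕ → Bool × Bool) × (ℕ → Bool × Bool) → ℝ≥0∞,
      Measurable w ∧ (∀ y, w y ≤ 1) ∧ ∀ i j : ℕ, i ≠ j → ∀ h : BoolArray → ℝ≥0∞, Measurable h →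
        (∀ R, h (erasePairs {i, j} R) = h R) →
        ∫⁻ R in {R | R (.inr i) (.inr j) = true}, h R ∂P =
          ∫⁻ R, w (base R, type i R, type j R) * h R ∂P := by
  obtain ⟨w, hw, hw1, hh⟩ := exists_pairProb_zero_one hP
  refine ⟨w, hw, hw1, fun i j hij h hm hi => ?_⟩
  obtain ⟨s, hs0, hs1⟩ : ∃ s : Equiv.Perm ℕ, s 0 = i ∧ s 1 = j := by
    refine ⟨Equiv.swap (Equiv.swap 0 i 1) j * Equiv.swap 0 i, ?_, ?_⟩
    · rw [Equiv.Perm.mul_apply, Equiv.swap_apply_left]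
      refine Equiv.swap_apply_of_ne_of_ne (fun h0 => ?_) hij
      have h1 : Equiv.swap 0 i 0 = Equiv.swap 0 i 1 := by rw [Equiv.swap_apply_left, ← h0]
      exact absurd ((Equiv.swap 0 i).injective h1) (by norm_num)
    · rw [Equiv.Perm.mul_apply, Equiv.swap_apply_left]
  have hinj : Function.Injective (Sum.map id s : ℕ ⊕ ℕ → ℕ ⊕ ℕ) :=
    Sum.map_injective.2 ⟨Function.injective_id, s.injective⟩
  have hcancel : ∀ R : BoolArray,
      reindex (Sum.map id s.symm) (reindex (Sum.map id s) R) = R := by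
    intro R
    ext a b
    rcases a with a | a <;> rcases b with b | b <;> simp [reindex]
  have h1 := hh (fun R => h (reindex (Sum.map id s.symm) R)) (hm.comp (measurable_reindex _))
    (fun R => by
      rw [reindex_erasePairs]
      have : Finset.map s.toEmbedding {0, 1} = {i, j} := by
        ext x
        simp [← hs0, ← hs1]
      rw [this, hi])
  rw [← (hP _ hinj).setLIntegral_comp_preimage
    (f := fun R => h (reindex (Sum.map id s.symm) R)) (measurableSet_entry _ _)
    (hm.comp (measurable_reindex _)), ← (hP _ hinj).lintegral_comp
      (f := fun R => w (base R, type 0 R, type 1 R) * h (reindex (Sum.map id s.symm) R))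
      ((hw.comp (measurable_base.prodMk ((measurable_type 0).prodMk (measurable_type 1)))).mul
    (hm.comp (measurable_reindex _)))] at h1
  simp only [hcancel] at h1
  have e0 : ∀ R, type 0 (reindex (Sum.map id s) R) = type i R := fun R => by
    ext k <;> simp [type, reindex, hs0]
  have e1 : ∀ R, type 1 (reindex (Sum.map id s) R) = type j R := fun R => by
    ext k <;> simp [type, reindex, hs1]
  have e2 : ∀ R, base (reindex (Sum.map id s) R) = base R := fun R => rfl
  simp only [e0, e1, e2] at h1
  rw [← h1]
  congr 2
  ext R
  simp [reindex, hs0, hs1]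

/-- The conditional law of the type of a point given the reference entries. -/
def typeKernel (P : Measure BoolArray) [IsFiniteMeasure P] :
    Kernel (ℕ → ℕ → Bool) (ℕ → Bool × Bool) :=
  condDistrib (type 0) base P

instance : IsMarkovKernel (typeKernel P) := by
  unfold typeKernel
  infer_instance

theorem lintegral_type_eq
    (hP : ∀ τ, Function.Injective τ → MeasurePreserving (reindex τ) P P) (i : ℕ)
    {B : Set (ℕ → Bool × Bool)} (hB : MeasurableSet B) {h : (ℕ → ℕ → Bool) → ℝ≥0∞}
    (hh : Measurable h) :
    ∫⁻ R in type i ⁻¹' B, h (base R) ∂P = ∫⁻ R, typeKernel P (base R) B * h (base R) ∂P := by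
  have h0 : ∫⁻ R in type 0 ⁻¹' B, h (base R) ∂P =
      ∫⁻ R, typeKernel P (base R) B * h (base R) ∂P := by
    have hc : (P.map base).compProd (condDistrib (type 0) base P) =
        P.map (fun R => (base R, type 0 R)) :=
      compProd_map_condDistrib (measurable_type 0).aemeasurable
    have hm2 : Measurable fun q : (ℕ → ℕ → Bool) × (ℕ → Bool × Bool) =>
        B.indicator (1 : (ℕ → Bool × Bool) → ℝ≥0∞) q.2 * h q.1 :=
      ((measurable_one.indicator hB).comp measurable_snd).mul (hh.comp measurable_fst)
    have h2 := Measure.lintegral_compProd (μ := P.map base) (κ := typeKernel P) hm2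
    rw [typeKernel, hc, lintegral_map hm2 (measurable_base.prodMk (measurable_type 0))] at h2
    have h3 : ∫⁻ R in type 0 ⁻¹' B, h (base R) ∂P =
        ∫⁻ R, B.indicator 1 (type 0 R) * h (base R) ∂P := by
      rw [← lintegral_indicator (measurable_type 0 hB)]
      refine lintegral_congr fun R => ?_
      by_cases hR : type 0 R ∈ B <;> simp [hR]
    rw [h3, h2, lintegral_map _ measurable_base]
    · refine lintegral_congr fun R => ?_
      dsimp only
      rw [lintegral_mul_const _ (measurable_one.indicator hB), lintegral_indicator_one hB]
      rfl
    · exact Measurable.lintegral_kernel_prod_right' (κ := condDistrib (type 0) base P) hm2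
  rw [← h0]
  have hinj : Function.Injective (Sum.map id (Equiv.swap 0 i) : ℕ ⊕ ℕ → ℕ ⊕ ℕ) :=
    Sum.map_injective.2 ⟨Function.injective_id, (Equiv.swap 0 i).injective⟩
  rw [← (hP _ hinj).setLIntegral_comp_preimage (f := fun R => h (base R)) (measurable_type 0 hB)
    (hh.comp measurable_base)]
  have e0 : ∀ R, type 0 (reindex (Sum.map id (Equiv.swap 0 i)) R) = type i R := fun R => by
    ext k <;> simp [type, reindex]
  have e : reindex (Sum.map id (Equiv.swap 0 i)) ⁻¹' (type 0 ⁻¹' B) = type i ⁻¹' B := by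
    ext R
    simp [e0]
  rw [e]
  rfl

theorem lintegral_type_cylinder
    (hP : ∀ τ, Function.Injective τ → MeasurePreserving (reindex τ) P P) (i N : ℕ)
    {B : Set (ℕ → Bool × Bool)} (hB : MeasurableSet B)
    (hBN : ∀ x x' : ℕ → Bool × Bool, (∀ k < N, x k = x' k) → (x ∈ B ↔ x' ∈ B))
    {h : BoolArray → ℝ≥0∞} (hm : Measurable h) (hi : ∀ R, h (erasePoint i R) = h R) :
    ∫⁻ R in type i ⁻¹' B, h R ∂P = ∫⁻ R, typeKernel P (base R) B * h R ∂P := by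
  let fill : (ℕ → ℕ → Bool) → BoolArray := fun y a b =>
    match a, b with
    | .inl k, .inl l => y k l
    | _, _ => false
  have hfill : Measurable fill := by
    refine measurable_of_entries fun a b => ?_
    rcases a with a | a <;> rcases b with b | b <;> simp only [fill]
    · exact (measurable_pi_apply b).comp (measurable_pi_apply a)
    all_goals exact measurable_const
  obtain ⟨w, hw, hw1, hh⟩ := exists_condProb_of_measurePreserving
    (hP (intoBase N {i}) (intoBase_injective _ _))
    (measurable_type i hB) (by
      ext R
      refine hBN _ _ fun k hk => ?_
      simp [type, reindex, intoBase, hk])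
    (measurable_erasePoint i) (y := base) (φ := base) measurable_base
    (base_erasePoint i) (g := fun y => erasePoint i (reindex (intoBase N {i}) (fill y)))
    ((measurable_erasePoint _).comp ((measurable_reindex _).comp hfill)) (by
      intro R
      ext a b
      rcases a with a | a <;> rcases b with b | b <;>
        simp only [erasePoint, reindex, intoBase, fill, base,
          Finset.mem_singleton, reduceCtorEq, Sum.inr.injEq, false_or, or_false, if_false] <;>
        split_ifs <;> simp_all)
  have hae : ∀ᵐ R ∂P, w (base R) = typeKernel P (base R) B := by
    have hkm : Measurable fun y => typeKernel P y B := Kernel.measurable_coe _ hB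
    refine ae_of_ae_map (p := fun y => w y = typeKernel P y B) measurable_base.aemeasurable ?_
    refine ae_eq_of_forall_setLIntegral_eq_of_sigmaFinite hw hkm fun C hC _ => ?_
    have h1 := hh (fun R => C.indicator 1 (base R))
      ((measurable_one.indicator hC).comp measurable_base)
    simp only [base_erasePoint] at h1
    rw [lintegral_type_eq hP i hB (measurable_one.indicator hC)] at h1
    have hset : ∀ f : (ℕ → ℕ → Bool) → ℝ≥0∞, Measurable f → ∫⁻ y in C, f y ∂(P.map base) =
        ∫⁻ R, f (base R) * C.indicator 1 (base R) ∂P := by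
      intro f hf
      rw [setLIntegral_map hC hf measurable_base, ← lintegral_indicator (measurable_base hC)]
      refine lintegral_congr fun R => ?_
      by_cases hR : base R ∈ C <;> simp [hR]
    rw [hset _ hw, hset _ hkm, h1]
  have h2 := hh h hm
  simp only [hi] at h2
  rw [h2]
  refine lintegral_congr_ae ?_
  filter_upwards [hae] with R hR
  rw [hR]

/-- The type of the point `i` is independent of all entries that do not involve `i`, given the
reference entries. -/
theorem lintegral_type
    (hP : ∀ τ, Function.Injective τ → MeasurePreserving (reindex τ) P P) (i : ℕ)
    {B : Set (ℕ → Bool × Bool)} (hB : MeasurableSet B)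
    {h : BoolArray → ℝ≥0∞} (hm : Measurable h) (hh1 : ∀ R, h R ≤ 1)
    (hi : ∀ R, h (erasePoint i R) = h R) :
    ∫⁻ R in type i ⁻¹' B, h R ∂P = ∫⁻ R, typeKernel P (base R) B * h R ∂P := by
  have hkm : Measurable fun R => typeKernel P (base R) :=
    (typeKernel P).measurable.comp measurable_base
  have hfin : IsFiniteMeasure (P.withDensity h) := isFiniteMeasure_withDensity
    ((lintegral_mono hh1).trans_lt (by simp)).ne
  have e1 : ∀ B, MeasurableSet B →
      ((P.withDensity h).map (type i)) B = ∫⁻ R in type i ⁻¹' B, h R ∂P := fun B hB => by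
    rw [Measure.map_apply (measurable_type i) hB, withDensity_apply _ (measurable_type i hB)]
  have e2 : ∀ B, MeasurableSet B →
      ((P.withDensity h).bind fun R => typeKernel P (base R)) B =
        ∫⁻ R, typeKernel P (base R) B * h R ∂P := fun B hB => by
    rw [Measure.bind_apply hB hkm.aemeasurable, lintegral_withDensity_eq_lintegral_mul _ hm
      (g := fun R => typeKernel P (base R) B) ((Measure.measurable_coe hB).comp hkm)]
    simp only [Pi.mul_apply, mul_comm]
  rw [← e1 B hB, ← e2 B hB]
  congr 1
  refine ext_of_generate_finite _ (generateFrom_measurableCylinders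
    (α := fun _ : ℕ => Bool × Bool)).symm isPiSystem_measurableCylinders (fun C hC => ?_) ?_
  · have hCm : MeasurableSet C := MeasurableSet.of_mem_measurableCylinders hC
    obtain ⟨s, S, hS, rfl⟩ := (mem_measurableCylinders _).1 hC
    rw [e1 _ hCm, e2 _ hCm]
    refine lintegral_type_cylinder hP i (s.sup id + 1) hCm (fun x x' hx => ?_) hm hi
    simp only [mem_cylinder]
    have : s.restrict x = s.restrict x' := by
      ext1 k
      exact hx k (Nat.lt_succ_of_le (Finset.le_sup (f := id) k.2))
    rw [this]
  · rw [e1 _ MeasurableSet.univ, e2 _ MeasurableSet.univ]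
    simp

theorem lintegral_prod_type
    (hP : ∀ τ, Function.Injective τ → MeasurePreserving (reindex τ) P P) (s : Finset ℕ)
    {B : ℕ → Set (ℕ → Bool × Bool)} (hB : ∀ i, MeasurableSet (B i))
    {h : (ℕ → ℕ → Bool) → ℝ≥0∞} (hm : Measurable h) (hh1 : ∀ y, h y ≤ 1) :
    ∫⁻ R, (∏ i ∈ s, (B i).indicator 1 (type i R)) * h (base R) ∂P =
      ∫⁻ R, (∏ i ∈ s, typeKernel P (base R) (B i)) * h (base R) ∂P := by
  induction s using Finset.induction_on generalizing h with
  | empty => simp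
  | insert i s hi ih =>
    have hkm : Measurable fun y => typeKernel P y (B i) := Kernel.measurable_coe _ (hB i)
    have h1 := lintegral_type hP i (hB i)
      (h := fun R => (∏ i ∈ s, (B i).indicator 1 (type i R)) * h (base R))
      ((Finset.measurable_prod _ fun j _ =>
        (measurable_one.indicator (hB j)).comp (measurable_type j)).mul (hm.comp measurable_base))
      (fun R => mul_le_one' (Finset.prod_le_one' fun j _ =>
        Set.indicator_le (fun _ _ => le_rfl) _) (hh1 _))
      (fun R => by
        rw [base_erasePoint]
        congr 1
        refine Finset.prod_congr rfl fun j hj => ?_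
        rw [type_erasePoint (ne_of_mem_of_not_mem hj hi)])
    have h2 := ih (h := fun y => typeKernel P y (B i) * h y) (hkm.mul hm)
      (fun y => mul_le_one' prob_le_one (hh1 y))
    calc ∫⁻ R, (∏ i ∈ insert i s, (B i).indicator 1 (type i R)) * h (base R) ∂P
        = ∫⁻ R in type i ⁻¹' B i, (∏ i ∈ s, (B i).indicator 1 (type i R)) * h (base R) ∂P := by
          rw [← lintegral_indicator (measurable_type i (hB i))]
          refine lintegral_congr fun R => ?_
          rw [Finset.prod_insert hi]
          by_cases hR : type i R ∈ B i <;> simp [hR]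
      _ = ∫⁻ R, (∏ i ∈ s, (B i).indicator 1 (type i R)) *
            (typeKernel P (base R) (B i) * h (base R)) ∂P := by
          rw [h1]
          refine lintegral_congr fun R => ?_
          ring
      _ = _ := by
          rw [h2]
          refine lintegral_congr fun R => ?_
          rw [Finset.prod_insert hi]
          ring

/-- The law of `n` independent types with the conditional law of one type. -/
def typesKernel (P : Measure BoolArray) [IsProbabilityMeasure P] (n : ℕ) :
    Kernel (ℕ → ℕ → Bool) (Fin n → ℕ → Bool × Bool) where
  toFun y := Measure.pi fun _ => typeKernel P y
  measurable' := by
    refine Measurable.measure_of_isPiSystem_of_isProbabilityMeasure generateFrom_pi.symm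
      isPiSystem_pi ?_
    rintro _ ⟨B, hB, rfl⟩
    simp only [Measure.pi_pi]
    exact Finset.measurable_prod _ fun i _ => Kernel.measurable_coe _ (hB i (Set.mem_univ i))

instance (n : ℕ) : IsMarkovKernel (typesKernel P n) :=
  ⟨fun y => by
    change IsProbabilityMeasure (Measure.pi fun _ => typeKernel P y)
    infer_instance⟩

/-- The types are conditionally i.i.d. given the reference entries. -/
theorem map_types (hP : ∀ τ, Function.Injective τ → MeasurePreserving (reindex τ) P P) (n : ℕ) :
    P.map (fun R => (base R, fun i : Fin n => type i R)) = (P.map base).compProd (typesKernel P n) := by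
  have hX : Measurable fun R => fun i : Fin n => type i R :=
    measurable_pi_lambda _ fun i => measurable_type i
  have hbX : Measurable fun R => (base R, fun i : Fin n => type i R) := measurable_base.prodMk hX
  have : IsProbabilityMeasure (P.map base) :=
    Measure.isProbabilityMeasure_map measurable_base.aemeasurable
  have : IsProbabilityMeasure (P.map fun R => (base R, fun i : Fin n => type i R)) :=
    Measure.isProbabilityMeasure_map hbX.aemeasurable
  refine Measure.ext_prod fun {C S} hC hS => ?_
  rw [Measure.map_apply hbX (hC.prod hS), Measure.compProd_apply_prod hC hS]
  have e1 : (fun R => (base R, fun i : Fin n => type i R)) ⁻¹' C ×ˢ S =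
      (fun R => fun i : Fin n => type i R) ⁻¹' S ∩ base ⁻¹' C := by
    ext R
    simp [and_comm]
  rw [e1, ← Measure.restrict_apply (hX hS), ← Measure.map_apply hX hS,
    ← Measure.bind_apply hS (typesKernel P n).measurable.aemeasurable]
  have : IsFiniteMeasure (((P.map base).restrict C).bind (typesKernel P n)) := by
    refine ⟨?_⟩
    rw [Measure.bind_apply MeasurableSet.univ (typesKernel P n).measurable.aemeasurable]
    simp
  congr 1
  refine ext_of_generate_finite _ generateFrom_pi.symm isPiSystem_pi (fun T hT => ?_) ?_
  · obtain ⟨B, hB, rfl⟩ := hT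
    have hB' : ∀ i, MeasurableSet (B i) := fun i => hB i (Set.mem_univ i)
    have hU : MeasurableSet (Set.univ.pi B) := MeasurableSet.univ_pi hB'
    rw [Measure.map_apply hX hU, Measure.restrict_apply (hX hU),
      Measure.bind_apply hU (typesKernel P n).measurable.aemeasurable]
    let B' : ℕ → Set (ℕ → Bool × Bool) := fun i => if h : i < n then B ⟨i, h⟩ else Set.univ
    have hB'm : ∀ i, MeasurableSet (B' i) := fun i => by
      simp only [B']
      split_ifs
      · exact hB' _
      · exact MeasurableSet.univ
    have hB'i : ∀ i : Fin n, B' i = B i := fun i => by simp [B']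
    have h1 := lintegral_prod_type hP (Finset.range n) hB'm (h := C.indicator 1)
      (measurable_one.indicator hC) (fun y => Set.indicator_le (fun _ _ => le_rfl) _)
    simp only [Finset.prod_range, hB'i] at h1
    have e2 : ∀ R, (∏ i : Fin n, (B i).indicator 1 (type i R)) * C.indicator 1 (base R) =
        ((fun R => fun i : Fin n => type i R) ⁻¹' Set.univ.pi B ∩ base ⁻¹' C).indicator
          (1 : BoolArray → ℝ≥0∞) R := by
      intro R
      by_cases hR : ∀ i : Fin n, type i R ∈ B i
      · by_cases hRC : base R ∈ C <;> simp [hR, hRC, Set.indicator, Set.mem_pi]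
      · obtain ⟨i, hi⟩ := not_forall.1 hR
        rw [Finset.prod_eq_zero (Finset.mem_univ i) (by simp [hi]), zero_mul,
          Set.indicator_of_notMem]
        simp only [Set.mem_inter_iff, Set.mem_preimage, Set.mem_pi, Set.mem_univ, true_imp_iff]
        exact fun h => hi (h.1 i)
    simp only [e2] at h1
    rw [lintegral_indicator_one ((hX hU).inter (measurable_base hC))] at h1
    rw [h1, setLIntegral_map hC (Kernel.measurable_coe _ hU) measurable_base,
      ← lintegral_indicator (measurable_base hC)]
    refine lintegral_congr fun R => ?_
    have : typesKernel P n (base R) (Set.univ.pi B) = ∏ i, typeKernel P (base R) (B i) :=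
      Measure.pi_pi _ _
    by_cases hRC : base R ∈ C <;> simp [hRC, this]
  · rw [Measure.map_apply hX MeasurableSet.univ,
      Measure.bind_apply MeasurableSet.univ (typesKernel P n).measurable.aemeasurable]
    simp [Measure.map_apply measurable_base hC]

end invariant

variable {P : Measure BoolArray}

/-- A set of pairs that contains no loop and no pair in both directions. -/
def IsOriented {V : Type*} (D : Finset (V × V)) : Prop :=
  ∀ p ∈ D, p.1 ≠ p.2 ∧ p.swap ∉ D

theorem IsOriented.mono {V : Type*} {D D' : Finset (V × V)} (h : IsOriented D) (hD : D' ⊆ D) :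
    IsOriented D' := fun p hp => ⟨(h p (hD hp)).1, fun hs => (h p (hD hp)).2 (hD hs)⟩

theorem entry_erasePairs {p q : ℕ × ℕ} (h : q.1 ≠ q.2) (h1 : q ≠ p) (h2 : q ≠ p.swap)
    (R : BoolArray) :
    erasePairs {p.1, p.2} R (.inr q.1) (.inr q.2) = R (.inr q.1) (.inr q.2) := by
  obtain ⟨a, b⟩ := p
  obtain ⟨c, d⟩ := q
  simp only [erasePairs, Finset.mem_insert, Finset.mem_singleton]
  refine if_neg fun hh => ?_
  simp only [ne_eq, Prod.mk.injEq, Prod.swap_prod_mk] at h h1 h2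
  omega

theorem lintegral_prod_entry
    {w : (ℕ → ℕ → Bool) × (ℕ → Bool × Bool) × (ℕ → Bool × Bool) → ℝ≥0∞} (hw : Measurable w)
    (hwP : ∀ i j : ℕ, i ≠ j → ∀ h : BoolArray → ℝ≥0∞, Measurable h →
        (∀ R, h (erasePairs {i, j} R) = h R) →
        ∫⁻ R in {R | R (.inr i) (.inr j) = true}, h R ∂P =
          ∫⁻ R, w (base R, type i R, type j R) * h R ∂P)
    (D : Finset (ℕ × ℕ)) (hD : IsOriented D) {h : BoolArray → ℝ≥0∞} (hm : Measurable h)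
    (hh : ∀ p ∈ D, ∀ R, h (erasePairs {p.1, p.2} R) = h R) :
    ∫⁻ R, (∏ p ∈ D, if R (.inr p.1) (.inr p.2) = true then 1 else 0) * h R ∂P =
      ∫⁻ R, (∏ p ∈ D, w (base R, type p.1 R, type p.2 R)) * h R ∂P := by
  induction D using Finset.induction_on generalizing h with
  | empty => simp
  | insert p D hp ih =>
    have hp1 := hD p (Finset.mem_insert_self p D)
    have hDo : IsOriented D := hD.mono (Finset.subset_insert p D)
    have hwm : Measurable fun R => w (base R, type p.1 R, type p.2 R) :=
      hw.comp (measurable_base.prodMk ((measurable_type _).prodMk (measurable_type _)))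
    have h1 := hwP p.1 p.2 hp1.1
      (fun R => (∏ p ∈ D, if R (.inr p.1) (.inr p.2) = true then 1 else 0) * h R)
      ((Finset.measurable_prod _ fun q _ => Measurable.ite (measurableSet_entry _ _)
        measurable_const measurable_const).mul hm)
      (fun R => by
        rw [hh p (Finset.mem_insert_self p D)]
        congr 1
        refine Finset.prod_congr rfl fun q hq => ?_
        rw [entry_erasePairs (hDo q hq).1 (ne_of_mem_of_not_mem hq hp)]
        rintro rfl
        exact hp1.2 (Finset.mem_insert_of_mem hq))
    have h2 := ih hDo (h := fun R => w (base R, type p.1 R, type p.2 R) * h R) (hwm.mul hm)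
      (fun q hq R => by
        rw [base_erasePairs, type_erasePairs, type_erasePairs,
          hh q (Finset.mem_insert_of_mem hq)])
    calc _ = ∫⁻ R in {R | R (.inr p.1) (.inr p.2) = true},
          (∏ p ∈ D, if R (.inr p.1) (.inr p.2) = true then 1 else 0) * h R ∂P := by
          rw [← lintegral_indicator (measurableSet_entry _ _)]
          refine lintegral_congr fun R => ?_
          rw [Finset.prod_insert hp]
          by_cases hR : R (.inr p.1) (.inr p.2) = true <;> simp [hR]
      _ = ∫⁻ R, (∏ p ∈ D, if R (.inr p.1) (.inr p.2) = true then 1 else 0) *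
            (w (base R, type p.1 R, type p.2 R) * h R) ∂P := by
          rw [h1]
          refine lintegral_congr fun R => ?_
          ring
      _ = _ := by
          rw [h2]
          refine lintegral_congr fun R => ?_
          rw [Finset.prod_insert hp]
          ring

/-- The event that all pairs of `D` have entry one. -/
def pairsOne {n : ℕ} (D : Finset (Fin n × Fin n)) : Set BoolArray :=
  {R | ∀ p ∈ D, R (.inr p.1) (.inr p.2) = true}

theorem measurableSet_pairsOne {n : ℕ} (D : Finset (Fin n × Fin n)) :
    MeasurableSet (pairsOne D) := by
  have : pairsOne D = ⋂ p ∈ D, {R : BoolArray | R (.inr p.1) (.inr p.2) = true} := by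
    ext R
    simp [pairsOne]
  rw [this]
  exact Finset.measurableSet_biInter _ fun p _ => measurableSet_entry _ _

variable [IsProbabilityMeasure P]

theorem exists_kernel_ae (hP : ∀ τ, Function.Injective τ → MeasurePreserving (reindex τ) P P) :
    ∃ w : (ℕ → ℕ → Bool) × (ℕ → Bool × Bool) × (ℕ → Bool × Bool) → ℝ≥0∞,
      Measurable w ∧ (∀ y, w y ≤ 1) ∧ ∀ (n : ℕ) (D : Finset (Fin n × Fin n)), IsOriented D →
        ∀ C, MeasurableSet C →
        P (base ⁻¹' C ∩ pairsOne D) =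
          ∫⁻ y in C, ∫⁻ x, ∏ p ∈ D, w (y, x p.1, x p.2) ∂(Measure.pi fun _ => typeKernel P y)
            ∂(P.map base) := by
  obtain ⟨w, hw, hw1, hwP⟩ := exists_pairProb hP
  refine ⟨w, hw, hw1, fun n D hD C hC => ?_⟩
  let ι : Fin n × Fin n ↪ ℕ × ℕ := Fin.valEmbedding.prodMap Fin.valEmbedding
  have hD' : IsOriented (D.map ι) := by
    intro q hq
    obtain ⟨p, hp, rfl⟩ := Finset.mem_map.1 hq
    refine ⟨fun h => (hD p hp).1 (Fin.ext h), fun h => ?_⟩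
    obtain ⟨p', hp', h'⟩ := Finset.mem_map.1 h
    have : p' = p.swap := ι.injective h'
    exact (hD p hp).2 (this ▸ hp')
  have hind : Measurable fun R => C.indicator (1 : (ℕ → ℕ → Bool) → ℝ≥0∞) (base R) :=
    (measurable_one.indicator hC).comp measurable_base
  have h1 := lintegral_prod_entry hw hwP (D.map ι) hD' hind (fun p _ R => by
    rw [base_erasePairs])
  have hι1 : ∀ p, (ι p).1 = p.1 := fun _ => rfl
  have hι2 : ∀ p, (ι p).2 = p.2 := fun _ => rfl
  simp only [Finset.prod_map, hι1, hι2] at h1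
  have e1 : ∀ R : BoolArray, (∏ p ∈ D, if R (.inr p.1) (.inr p.2) = true
      then (1 : ℝ≥0∞) else 0) * C.indicator 1 (base R) =
        (base ⁻¹' C ∩ pairsOne D).indicator 1 R := by
    intro R
    by_cases hR : R ∈ pairsOne D
    · rw [Finset.prod_eq_one fun p hp => if_pos (hR p hp), one_mul]
      by_cases hRC : base R ∈ C <;> simp [hR, hRC]
    · have hR' := hR
      simp only [pairsOne, Set.mem_ofPred_eq, not_forall] at hR'
      obtain ⟨p, hp, hp0⟩ := hR'
      rw [Finset.prod_eq_zero hp (if_neg hp0), zero_mul, Set.indicator_of_notMem]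
      exact fun h => hR h.2
  simp only [e1] at h1
  rw [lintegral_indicator_one ((measurable_base hC).inter (measurableSet_pairsOne D))] at h1
  have hF : Measurable fun q : (ℕ → ℕ → Bool) × (Fin n → ℕ → Bool × Bool) =>
      (∏ p ∈ D, w (q.1, q.2 p.1, q.2 p.2)) * C.indicator 1 q.1 := by
    refine (Finset.measurable_prod _ fun p _ => hw.comp ?_).mul
      ((measurable_one.indicator hC).comp measurable_fst)
    exact measurable_fst.prodMk (((measurable_pi_apply _).comp measurable_snd).prodMk
      ((measurable_pi_apply _).comp measurable_snd))
  have hbX : Measurable fun R => (base R, fun i : Fin n => type i R) :=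
    measurable_base.prodMk (measurable_pi_lambda _ fun i => measurable_type i)
  have : IsProbabilityMeasure (P.map base) :=
    Measure.isProbabilityMeasure_map measurable_base.aemeasurable
  have h2 := lintegral_map hF hbX (μ := P)
  rw [map_types hP n, Measure.lintegral_compProd hF] at h2
  rw [h1, ← lintegral_indicator hC]
  refine Eq.trans ?_ (h2.symm.trans ?_)
  · rfl
  · refine lintegral_congr fun y => ?_
    by_cases hy : y ∈ C
    · simp only [hy, Set.indicator_of_mem, Pi.one_apply, mul_one]
      rfl
    · simp [hy]

/-- The representation of a dissociated exchangeable array, restricted to one direction for each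
pair of points. -/
theorem exists_kernel (hP : ∀ τ, Function.Injective τ → MeasurePreserving (reindex τ) P P)
    (hdis : ∀ (n : ℕ) (D : Finset (Fin n × Fin n)) (C : Set (ℕ → ℕ → Bool)), MeasurableSet C →
      P (base ⁻¹' C ∩ pairsOne D) = P (base ⁻¹' C) * P (pairsOne D)) :
    ∃ (μ : Measure (ℕ → Bool × Bool)) (_ : IsProbabilityMeasure μ)
      (w : (ℕ → Bool × Bool) × (ℕ → Bool × Bool) → ℝ≥0∞), Measurable w ∧ (∀ y, w y ≤ 1) ∧
      ∀ (n : ℕ) (D : Finset (Fin n × Fin n)), IsOriented D →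
        ∫⁻ x, ∏ p ∈ D, w (x p.1, x p.2) ∂(Measure.pi fun _ => μ) = P (pairsOne D) := by
  obtain ⟨w, hw, hw1, hwP⟩ := exists_kernel_ae hP
  have : IsProbabilityMeasure (P.map base) :=
    Measure.isProbabilityMeasure_map measurable_base.aemeasurable
  have hae : ∀ᵐ y ∂(P.map base), ∀ (n : ℕ) (D : Finset (Fin n × Fin n)), IsOriented D →
      ∫⁻ x, ∏ p ∈ D, w (y, x p.1, x p.2) ∂(Measure.pi fun _ => typeKernel P y) =
        P (pairsOne D) := by
    refine ae_all_iff.2 fun n => ae_all_iff.2 fun D => ?_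
    by_cases hD : IsOriented D
    · have hF : Measurable fun q : (ℕ → ℕ → Bool) × (Fin n → ℕ → Bool × Bool) =>
          (∏ p ∈ D, w (q.1, q.2 p.1, q.2 p.2)) := by
        refine (Finset.measurable_prod _ fun p _ => hw.comp ?_)
        exact measurable_fst.prodMk (((measurable_pi_apply _).comp measurable_snd).prodMk
          ((measurable_pi_apply _).comp measurable_snd))
      have hFm : Measurable fun y => ∫⁻ x, ∏ p ∈ D, w (y, x p.1, x p.2)
          ∂(Measure.pi fun _ => typeKernel P y) :=
        Measurable.lintegral_kernel_prod_right' (κ := typesKernel P n) hF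
      have h1 := ae_eq_of_forall_setLIntegral_eq_of_sigmaFinite (μ := P.map base) hFm
        (measurable_const (a := P (pairsOne D))) fun C hC _ => by
          rw [← hwP n D hD C hC, hdis n D C hC, setLIntegral_const,
            Measure.map_apply measurable_base hC, mul_comm]
      filter_upwards [h1] with y hy _ using hy
    · exact ae_of_all _ fun y h => absurd h hD
  obtain ⟨y, hy⟩ := hae.exists
  exact ⟨typeKernel P y, inferInstance, fun q => w (y, q.1, q.2),
    hw.comp (measurable_const.prodMk measurable_id), fun q => hw1 _, hy⟩

end BoolArray

/-! ### Density points and regularization of kernels -/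

section density

variable {μ : Measure ℝ} [IsProbabilityMeasure μ]

/-- The relative measure of `A` in a small square around `p`. -/
def squareRatio (μ : Measure ℝ) (A : Set (ℝ × ℝ)) (n : ℕ) (p : ℝ × ℝ) : ℝ :=
  (μ.prod μ).real (A ∩ Metric.closedBall p (1 / ((n : ℝ) + 1))) /
    (μ.prod μ).real (Metric.closedBall p (1 / ((n : ℝ) + 1)))

/-- The density points of `A`. -/
def densityPoints (μ : Measure ℝ) (A : Set (ℝ × ℝ)) : Set (ℝ × ℝ) :=
  {p | Tendsto (fun n => squareRatio μ A n p) atTop (𝓝 1)}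

theorem squareRatio_le_one (A : Set (ℝ × ℝ)) (n : ℕ) (p : ℝ × ℝ) : squareRatio μ A n p ≤ 1 :=
  div_le_one_of_le₀ (measureReal_mono Set.inter_subset_right) measureReal_nonneg

theorem measurable_squareRatio {A : Set (ℝ × ℝ)} (hA : MeasurableSet A) (n : ℕ) :
    Measurable (squareRatio μ A n) := by
  have h : ∀ B : Set (ℝ × ℝ), MeasurableSet B → Measurable fun p : ℝ × ℝ =>
      (μ.prod μ) (B ∩ Metric.closedBall p (1 / ((n : ℝ) + 1))) := by
    intro B hB
    have hm : MeasurableSet {q : (ℝ × ℝ) × (ℝ × ℝ) |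
        q.2 ∈ B ∧ dist q.2 q.1 ≤ 1 / ((n : ℝ) + 1)} :=
      (measurable_snd hB).inter (measurableSet_le (measurable_snd.dist measurable_fst)
        measurable_const)
    exact measurable_measure_prodMk_left hm
  have h1 := h Set.univ MeasurableSet.univ
  simp only [Set.univ_inter] at h1
  exact (h A hA).ennreal_toReal.div h1.ennreal_toReal

theorem measurableSet_densityPoints {A : Set (ℝ × ℝ)} (hA : MeasurableSet A) :
    MeasurableSet (densityPoints μ A) :=
  measurableSet_tendsto _ fun n => measurable_squareRatio hA n

theorem ae_mem_densityPoints_iff {A : Set (ℝ × ℝ)} (hA : MeasurableSet A) :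
    ∀ᵐ p ∂(μ.prod μ), p ∈ densityPoints μ A ↔ p ∈ A := by
  filter_upwards [Besicovitch.ae_tendsto_measure_inter_div_of_measurableSet (μ.prod μ) hA]
    with p hp
  have hr : Tendsto (fun n : ℕ => 1 / ((n : ℝ) + 1)) atTop (𝓝[>] 0) :=
    tendsto_nhdsWithin_iff.2 ⟨tendsto_one_div_add_atTop_nhds_zero_nat,
      Eventually.of_forall fun n => Set.mem_Ioi.2 (by positivity)⟩
  have hne : A.indicator (1 : ℝ × ℝ → ℝ≥0∞) p ≠ ∞ := by
    by_cases h : p ∈ A <;> simp [h]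
  have h1 : Tendsto (fun n => squareRatio μ A n p) atTop
      (𝓝 (A.indicator (1 : ℝ × ℝ → ℝ≥0∞) p).toReal) := by
    refine ((ENNReal.tendsto_toReal hne).comp (hp.comp hr)).congr fun n => ?_
    simp [squareRatio, measureReal_def, ENNReal.toReal_div]
  constructor
  · intro h
    by_contra hn
    have := tendsto_nhds_unique h h1
    simp [hn] at this
  · intro h
    simp only [h, Set.indicator_of_mem, Pi.one_apply, ENNReal.toReal_one] at h1
    exact h1

theorem densityPoints_mono {A B : Set (ℝ × ℝ)} (hAB : A ⊆ B) :
    densityPoints μ A ⊆ densityPoints μ B := fun p hp =>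
  tendsto_of_tendsto_of_tendsto_of_le_of_le hp tendsto_const_nhds
    (fun _ => div_le_div_of_nonneg_right (measureReal_mono (Set.inter_subset_inter_left _ hAB))
      measureReal_nonneg) (fun n => squareRatio_le_one B n p)

theorem measureReal_box_inequality {A A' B : Set (ℝ × ℝ)} (hA : MeasurableSet A)
    (hA' : MeasurableSet A') (hB : MeasurableSet B)
    (h : ∀ᵐ t ∂((μ.prod μ).prod μ), t.1 ∈ A → (t.1.2, t.2) ∈ A' → (t.1.1, t.2) ∈ B)
    {I J K : Set ℝ} (hI : MeasurableSet I) (hJ : MeasurableSet J) (hK : MeasurableSet K) :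
    (μ.prod μ).real (A ∩ I ×ˢ J) * μ.real K + μ.real I * (μ.prod μ).real (A' ∩ J ×ˢ K) ≤
      μ.real J * (μ.prod μ).real (B ∩ I ×ˢ K) + μ.real I * μ.real J * μ.real K := by
  set M := (μ.prod μ).prod μ
  let T₁ : Set ((ℝ × ℝ) × ℝ) := (A ∩ I ×ˢ J) ×ˢ K
  let T₂ : Set ((ℝ × ℝ) × ℝ) := MeasurableEquiv.prodAssoc ⁻¹' (I ×ˢ (A' ∩ J ×ˢ K))
  let f : (ℝ × ℝ) × ℝ → ℝ × (ℝ × ℝ) := MeasurableEquiv.prodAssoc ∘ Prod.map Prod.swap id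
  let T₃ : Set ((ℝ × ℝ) × ℝ) := f ⁻¹' (J ×ˢ (B ∩ I ×ˢ K))
  have hT₁m : MeasurableSet T₁ := (hA.inter (hI.prod hJ)).prod hK
  have hT₂m : MeasurableSet T₂ :=
    MeasurableEquiv.prodAssoc.measurable (hI.prod (hA'.inter (hJ.prod hK)))
  have h1 : M.real T₁ = (μ.prod μ).real (A ∩ I ×ˢ J) * μ.real K := measureReal_prod_prod _ _
  have h2 : M.real T₂ = μ.real I * (μ.prod μ).real (A' ∩ J ×ˢ K) := by
    rw [← measureReal_prod_prod, measureReal_def, measureReal_def,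
      (measurePreserving_prodAssoc μ μ μ).measure_preimage
        (hI.prod (hA'.inter (hJ.prod hK))).nullMeasurableSet]
  have hf : MeasurePreserving f M (μ.prod (μ.prod μ)) :=
    (measurePreserving_prodAssoc μ μ μ).comp
      (Measure.measurePreserving_swap.prod (MeasurePreserving.id μ))
  have h3 : M.real T₃ = μ.real J * (μ.prod μ).real (B ∩ I ×ˢ K) := by
    rw [← measureReal_prod_prod, measureReal_def, measureReal_def,
      hf.measure_preimage (hJ.prod (hB.inter (hI.prod hK))).nullMeasurableSet]
  have h4 : M.real (T₁ ∩ T₂) ≤ M.real T₃ := by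
    refine ENNReal.toReal_mono (measure_ne_top _ _) (measure_mono_ae ?_)
    filter_upwards [h] with t ht htT
    exact ⟨htT.1.1.2.2, ht htT.1.1.1 htT.2.2.1, htT.1.1.2.1, htT.1.2⟩
  have h5 : M.real (T₁ ∪ T₂) ≤ μ.real I * μ.real J * μ.real K := by
    rw [← measureReal_prod_prod, ← measureReal_prod_prod]
    refine measureReal_mono ?_
    rintro t (ht | ht)
    · exact ⟨ht.1.2, ht.2⟩
    · exact ⟨⟨ht.1, ht.2.2.1⟩, ht.2.2.2⟩
  have h6 := measureReal_union_add_inter (μ := M) (s := T₁) hT₂m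
  rw [← h1, ← h2, ← h3]
  linarith

theorem measureReal_closedBall_pos_of_squareRatio_pos {A : Set (ℝ × ℝ)} {n : ℕ} {x y : ℝ}
    (h : 0 < squareRatio μ A n (x, y)) :
    0 < μ.real (Metric.closedBall x (1 / ((n : ℝ) + 1))) ∧
      0 < μ.real (Metric.closedBall y (1 / ((n : ℝ) + 1))) := by
  rw [squareRatio, ← closedBall_prod_same, measureReal_prod_prod] at h
  constructor <;> refine lt_of_le_of_ne measureReal_nonneg fun h0 => ?_ <;>
    simp only [← h0, zero_mul, mul_zero, div_zero, lt_self_iff_false] at h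

theorem mem_densityPoints_trans {A A' B : Set (ℝ × ℝ)} (hA : MeasurableSet A)
    (hA' : MeasurableSet A') (hB : MeasurableSet B)
    (h : ∀ᵐ t ∂((μ.prod μ).prod μ), t.1 ∈ A → (t.1.2, t.2) ∈ A' → (t.1.1, t.2) ∈ B)
    {x y z : ℝ} (hxy : (x, y) ∈ densityPoints μ A) (hyz : (y, z) ∈ densityPoints μ A') :
    (x, z) ∈ densityPoints μ B := by
  have hlim : Tendsto (fun n => squareRatio μ A n (x, y) + squareRatio μ A' n (y, z) - 1) atTop
      (𝓝 1) := by
    have := (Tendsto.add hxy hyz).sub_const 1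
    simpa using this
  refine tendsto_of_tendsto_of_tendsto_of_le_of_le' hlim tendsto_const_nhds ?_
    (Eventually.of_forall fun n => squareRatio_le_one B n _)
  have hpos : ∀ᶠ n in atTop, 0 < squareRatio μ A n (x, y) :=
    Tendsto.eventually_const_lt zero_lt_one hxy
  have hpos' : ∀ᶠ n in atTop, 0 < squareRatio μ A' n (y, z) :=
    Tendsto.eventually_const_lt zero_lt_one hyz
  filter_upwards [hpos, hpos'] with n h1 h2
  obtain ⟨ha, hb⟩ := measureReal_closedBall_pos_of_squareRatio_pos h1
  obtain ⟨-, hc⟩ := measureReal_closedBall_pos_of_squareRatio_pos h2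
  have key := measureReal_box_inequality hA hA' hB h
    (I := Metric.closedBall x (1 / ((n : ℝ) + 1))) (J := Metric.closedBall y (1 / ((n : ℝ) + 1)))
    (K := Metric.closedBall z (1 / ((n : ℝ) + 1)))
    Metric.isClosed_closedBall.measurableSet Metric.isClosed_closedBall.measurableSet
    Metric.isClosed_closedBall.measurableSet
  simp only [squareRatio, ← closedBall_prod_same, measureReal_prod_prod]
  generalize μ.real (Metric.closedBall x (1 / ((n : ℝ) + 1))) = a at *
  generalize μ.real (Metric.closedBall y (1 / ((n : ℝ) + 1))) = b at *
  generalize μ.real (Metric.closedBall z (1 / ((n : ℝ) + 1))) = c at *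
  rw [div_add_div _ _ (by positivity) (by positivity), sub_le_iff_le_add,
    ← sub_le_iff_le_add, div_sub_one (by positivity), div_le_div_iff₀ (by positivity)
    (by positivity)]
  have hb2 : 0 ≤ a * b * c := by positivity
  nlinarith [mul_le_mul_of_nonneg_left key hb2]

/-- A kernel that is transitive and acyclic almost everywhere has a version that is transitive
and irreflexive everywhere. -/
theorem exists_regular_version {w : ℝ × ℝ → unitInterval} (hw : Measurable w)
    (htr : ∀ᵐ t ∂((μ.prod μ).prod μ), 0 < w t.1 → 0 < w (t.1.2, t.2) → w (t.1.1, t.2) = 1)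
    (hcy : ∀ᵐ t ∂((μ.prod μ).prod μ), 0 < w t.1 → 0 < w (t.1.2, t.2) → w (t.2, t.1.1) = 0) :
    ∃ w' : ℝ × ℝ → unitInterval, Measurable w' ∧ (∀ x, w' (x, x) = 0) ∧
      (∀ x y z, 0 < w' (x, y) → 0 < w' (y, z) → w' (x, z) = 1) ∧ w' =ᵐ[μ.prod μ] w := by
  classical
  set A : Set (ℝ × ℝ) := {p | 0 < w p}
  set B : Set (ℝ × ℝ) := {p | w p = 1}
  have hA : MeasurableSet A := measurableSet_lt measurable_const hw
  have hB : MeasurableSet B := hw (measurableSet_singleton 1)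
  have hBA : B ⊆ A := fun p hp => by
    change 0 < w p
    rw [show w p = 1 from hp]
    exact zero_lt_one
  let w' : ℝ × ℝ → unitInterval := fun p =>
    if p ∈ densityPoints μ B then 1 else if p ∈ densityPoints μ A then w p else 0
  have hpos : ∀ p, 0 < w' p → p ∈ densityPoints μ A := by
    intro p hp
    by_cases h1 : p ∈ densityPoints μ B
    · exact densityPoints_mono hBA h1
    · by_contra h2
      simp [w', h1, h2] at hp
  refine ⟨w', ?_, fun x => ?_, fun x y z hxy hyz => ?_, ?_⟩
  · exact Measurable.ite (measurableSet_densityPoints hB) measurable_const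
      (Measurable.ite (measurableSet_densityPoints hA) hw measurable_const)
  · by_contra hne
    have hx : (x, x) ∈ densityPoints μ A := hpos _ (unitInterval.pos_iff_ne_zero.2 hne)
    set C : Set (ℝ × ℝ) := {p | w p.swap = 0}
    have hC : MeasurableSet C := (hw.comp measurable_swap) (measurableSet_singleton 0)
    have hxC : (x, x) ∈ densityPoints μ C := mem_densityPoints_trans hA hA hC hcy hx hx
    have h2 := Tendsto.add hx hxC
    refine absurd (le_of_tendsto h2 (Eventually.of_forall fun n => ?_))
      (by norm_num : ¬ (1 : ℝ) + 1 ≤ 1)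
    simp only [squareRatio]
    rw [← add_div]
    refine div_le_one_of_le₀ ?_ measureReal_nonneg
    set b := Metric.closedBall (x, x) (1 / ((n : ℝ) + 1)) with hb
    have hbm : MeasurableSet b := Metric.isClosed_closedBall.measurableSet
    have hbs : Prod.swap ⁻¹' b = b := by
      rw [hb, ← closedBall_prod_same, Set.preimage_swap_prod]
    have h3 : (μ.prod μ).real (A ∩ b) = (μ.prod μ).real ((Prod.swap ⁻¹' A) ∩ b) := by
      rw [measureReal_def, measureReal_def, ← (Measure.measurePreserving_swap
        (μ := μ) (ν := μ)).measure_preimage (hA.inter hbm).nullMeasurableSet, Set.preimage_inter, hbs]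
    rw [h3, ← measureReal_union _ (hC.inter hbm)]
    · exact measureReal_mono (by grind)
    · refine Set.disjoint_left.2 fun p hp hp' => ?_
      have h4 : 0 < w p.swap := hp.1
      have h5 : w p.swap = 0 := hp'.1
      rw [h5] at h4
      exact lt_irrefl _ h4
  · have : (x, z) ∈ densityPoints μ B :=
      mem_densityPoints_trans hA hA hB htr (hpos _ hxy) (hpos _ hyz)
    simp [w', this]
  · filter_upwards [ae_mem_densityPoints_iff (μ := μ) hA, ae_mem_densityPoints_iff (μ := μ) hB]
      with p h1 h2
    by_cases hpB : p ∈ B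
    · have : w p = 1 := hpB
      simp [w', h2, hpB, this]
    · by_cases hpA : p ∈ A
      · simp [w', h1, h2, hpB, hpA]
      · have : w p = 0 := by
          by_contra hne
          exact hpA (unitInterval.pos_iff_ne_zero.2 hne)
        simp [w', h1, h2, hpB, hpA, this]

end density

/-! ### The distribution of the random poset of a kernel -/

namespace PosetKernel

variable {S : OrderedProbabilitySpace.{u}}

theorem measurable_sample (K : PosetKernel S) : Measurable K.sample := by
  refine Measurable.subtype_mk ?_
  refine measurable_pi_lambda _ fun i => measurable_pi_lambda _ fun j => ?_
  refine measurable_to_bool ?_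
  have hm : MeasurableSet {ω : (ℕ → S.carrier) × (ℕ × ℕ → Set.Ioo (0 : ℝ) 1) |
      (ω.2 (i, j) : ℝ) < K.W (ω.1 i) (ω.1 j)} := by
    refine measurableSet_lt ?_ ?_
    · exact measurable_subtype_coe.comp ((measurable_pi_apply _).comp measurable_snd)
    · exact measurable_subtype_coe.comp (K.measurable_W.comp
        (f := fun ω : (ℕ → S.carrier) × (ℕ × ℕ → Set.Ioo (0 : ℝ) 1) => (ω.1 i, ω.1 j))
        (((measurable_pi_apply _).comp measurable_fst).prodMk
          ((measurable_pi_apply _).comp measurable_fst)))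
  convert hm using 1
  ext ω
  simp

theorem sample_lt (K : PosetKernel S) (ω : (ℕ → S.carrier) × (ℕ × ℕ → Set.Ioo (0 : ℝ) 1))
    (i j : ℕ) : (K.sample ω).lt i j ↔ (ω.2 (i, j) : ℝ) < K.W (ω.1 i) (ω.1 j) := by
  simp [PosetOn.lt, sample]

instance (K : PosetKernel S) : IsProbabilityMeasure K.law :=
  Measure.isProbabilityMeasure_map K.measurable_sample.aemeasurable

end PosetKernel

theorem uniform01_lt {a : ℝ} (ha : a ≤ 1) :
    uniform01 {x | (x : ℝ) < a} = ENNReal.ofReal a := by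
  rw [uniform01, comap_subtype_coe_apply measurableSet_Ioo]
  have : (Subtype.val '' {x : Set.Ioo (0 : ℝ) 1 | (x : ℝ) < a}) = Set.Ioo 0 a := by
    ext x
    simp only [Set.mem_image, Set.mem_ofPred_eq, Subtype.exists, exists_and_left, exists_prop,
      exists_eq_right_right, Set.mem_Ioo]
    constructor
    · exact fun h => ⟨h.2.1, h.1⟩
    · exact fun h => ⟨h.2, h.1, h.2.trans_le ha⟩
  rw [this, Real.volume_Ioo, sub_zero]

theorem infinitePi_map_comp {S V : Type*} [MeasurableSpace S] [Fintype V] (μ : Measure S)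
    [IsProbabilityMeasure μ] {ι : V → ℕ} (hι : Function.Injective ι) :
    (Measure.infinitePi fun _ : ℕ => μ).map (fun x v => x (ι v)) = Measure.pi fun _ => μ := by
  classical
  have hm : Measurable fun (x : ℕ → S) (v : V) => x (ι v) :=
    measurable_pi_lambda _ fun v => measurable_pi_apply _
  refine (Measure.pi_eq fun B hB => ?_).symm
  rw [Measure.map_apply hm (MeasurableSet.univ_pi hB)]
  have h1 := Measure.infinitePi_pi (fun _ : ℕ => μ) (s := Finset.univ.map ⟨ι, hι⟩)
    (t := Function.extend ι B fun _ => Set.univ) (fun i hi => by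
      obtain ⟨v, -, rfl⟩ := Finset.mem_map.1 hi
      simp only [Function.Embedding.coeFn_mk, hι.extend_apply]
      exact hB v)
  simp only [Finset.prod_map, Function.Embedding.coeFn_mk, hι.extend_apply] at h1
  rw [← h1]
  congr 1
  ext x
  simp [Set.mem_pi, hι.extend_apply]

open Classical in
theorem PosetKernel.law_real_embEvent {S : OrderedProbabilitySpace.{u}} (K : PosetKernel S)
    {V : Type*} [Fintype V] (Q : PosetOn V) {ι : V → ℕ} (hι : Function.Injective ι) :
    K.law.real (embEvent Q ι) = ∫ x : V → S.carrier,
        ∏ i, ∏ j, (if Q.lt i j then (K.W (x i) (x j) : ℝ) else 1)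
        ∂(Measure.pi fun _ => S.μ) := by
  let D : Finset (V × V) := Finset.univ.filter fun p => Q.lt p.1 p.2
  let ιι : V × V ↪ ℕ × ℕ := (⟨ι, hι⟩ : V ↪ ℕ).prodMap ⟨ι, hι⟩
  have hWm : ∀ i j, Measurable fun x : V → S.carrier => (K.W (x i) (x j) : ℝ) := fun i j =>
    measurable_subtype_coe.comp (K.measurable_W.comp
      (f := fun x : V → S.carrier => (x i, x j))
      ((measurable_pi_apply _).prodMk (measurable_pi_apply _)))
  have hprod : ∀ x : V → S.carrier,
      ENNReal.ofReal (∏ i, ∏ j, (if Q.lt i j then (K.W (x i) (x j) : ℝ) else 1)) =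
        ∏ p ∈ D, ENNReal.ofReal (K.W (x p.1) (x p.2)) := by
    intro x
    rw [← Fintype.prod_prod_type' (f := fun i j => if Q.lt i j then (K.W (x i) (x j) : ℝ) else 1),
      ← Finset.prod_filter (fun p : V × V => Q.lt p.1 p.2), ENNReal.ofReal_prod_of_nonneg]
    exact fun p _ => (K.W (x p.1) (x p.2)).2.1
  have hnn : ∀ x : V → S.carrier,
      0 ≤ ∏ i, ∏ j, (if Q.lt i j then (K.W (x i) (x j) : ℝ) else 1) := fun x =>
    Finset.prod_nonneg fun i _ => Finset.prod_nonneg fun j _ => by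
      split_ifs
      · exact (K.W (x i) (x j)).2.1
      · exact zero_le_one
  have hFm : Measurable fun x : V → S.carrier =>
      ∏ i, ∏ j, (if Q.lt i j then (K.W (x i) (x j) : ℝ) else 1) := by
    refine Finset.measurable_prod _ fun i _ => Finset.measurable_prod _ fun j _ => ?_
    split_ifs
    · exact hWm i j
    · exact measurable_const
  rw [integral_eq_lintegral_of_nonneg_ae (ae_of_all _ hnn) hFm.aestronglyMeasurable,
    measureReal_def]
  congr 1
  have hE := measurableSet_embEvent Q ι
  have hcomp : Measurable fun (x : ℕ → S.carrier) (v : V) => x (ι v) :=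
    measurable_pi_lambda _ fun v => measurable_pi_apply _
  rw [PosetKernel.law, Measure.map_apply K.measurable_sample hE,
    Measure.prod_apply (K.measurable_sample hE), ← infinitePi_map_comp S.μ hι,
    lintegral_map hFm.ennreal_ofReal hcomp]
  refine lintegral_congr fun x => ?_
  rw [hprod]
  have h1 := Measure.infinitePi_pi (fun _ : ℕ × ℕ => uniform01) (s := D.map ιι)
    (t := fun p => {ξ | (ξ : ℝ) < K.W (x p.1) (x p.2)})
    (fun p _ => measurableSet_lt measurable_subtype_coe measurable_const)
  rw [Finset.prod_map] at h1
  rw [Finset.prod_congr rfl fun p _ =>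
    (uniform01_lt (K.W (x (ι p.1)) (x (ι p.2))).2.2).symm]
  refine Eq.trans ?_ h1
  congr 1
  ext ξ
  simp only [Set.mem_preimage, embEvent, Set.mem_ofPred_eq, PosetKernel.sample_lt, Set.mem_pi,
    Finset.coe_map, Set.mem_image, SetLike.mem_coe]
  constructor
  · rintro h _ ⟨p, hp, rfl⟩
    exact h _ _ (Finset.mem_filter.1 hp).2
  · intro h i j hij
    exact h (ι i, ι j) ⟨(i, j), Finset.mem_filter.2 ⟨Finset.mem_univ _, hij⟩, rfl⟩

theorem PosetKernel.Represents.hasDensities {S : OrderedProbabilitySpace.{u}} {K : PosetKernel S}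
    {Γ : ProperPosetLimit} (h : K.Represents Γ) : HasDensities K.law Γ.1 := by
  intro A _ Q
  obtain ⟨n, hn⟩ : ∃ n, Fintype.card A = n + 1 :=
    ⟨Fintype.card A - 1, (Nat.sub_add_cancel Fintype.card_pos).symm⟩
  let e : Fin (n + 1) ≃ A := (Fintype.equivFinOfCardEq hn).symm
  rw [← PosetOn.unlabelled_eq_of_iso (Q.iso_comap e), h n (Q.comap e),
    ← K.law_real_embEvent (Q.comap e) (ι := fun i => (e i : ℕ))
      (Subtype.val_injective.comp e.injective)]
  congr 1
  ext R
  constructor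
  · exact fun hR x y hxy => hR (e x) (e y) hxy
  · intro hR x y hxy
    have := hR (e.symm x) (e.symm y) (by simpa [PosetOn.lt, PosetOn.comap] using hxy)
    simpa using this

/-! ### Independence of disjoint parts -/

theorem HasDensities.indepFun {ν : Measure (PosetOn ℕ)} [IsProbabilityMeasure ν]
    {Γ : PosetLimit} (h : HasDensities ν Γ) {ι₁ ι₂ : ℕ → ℕ} (h₁ : Function.Injective ι₁)
    (h₂ : Function.Injective ι₂) (hd : ∀ i j, ι₁ i ≠ ι₂ j) :
    IndepFun (fun R : PosetOn ℕ => R.comap ι₁) (fun R => R.comap ι₂) ν := by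
  have hgen : ∀ ι : ℕ → ℕ, MeasurableSpace.comap (fun R : PosetOn ℕ => R.comap ι) inferInstance =
      MeasurableSpace.generateFrom
        (Set.preimage (fun R : PosetOn ℕ => R.comap ι) '' Set.range pairsEvent) := fun ι => by
    rw [← MeasurableSpace.comap_generateFrom, ← generateFrom_pairsEvent]
  have hpi : ∀ ι : ℕ → ℕ,
      IsPiSystem (Set.preimage (fun R : PosetOn ℕ => R.comap ι) '' Set.range pairsEvent) := by
    intro ι
    have := isPiSystem_pairsEvent.comap fun R : PosetOn ℕ => R.comap ι
    convert this using 1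
    ext s
    simp
  refine IndepSets.indep (measurable_posetOn_comap ι₁).comap_le
    (measurable_posetOn_comap ι₂).comap_le (hpi ι₁) (hpi ι₂) (hgen ι₁) (hgen ι₂) ?_
  rw [IndepSets_iff]
  rintro _ _ ⟨_, ⟨D, rfl⟩, rfl⟩ ⟨_, ⟨D', rfl⟩, rfl⟩
  rcases pairsEvent_eq_empty_or_containsEvent D with h0 | ⟨A, hA, Q, -, hQ⟩
  · simp [h0]
  rcases pairsEvent_eq_empty_or_containsEvent D' with h0 | ⟨A', hA', Q', -, hQ'⟩
  · simp [h0]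
  have e₁ := h.embEvent Q (h₁.comp (Subtype.val_injective (p := fun x => x ∈ A)))
  have e₂ := h.embEvent Q' (h₂.comp (Subtype.val_injective (p := fun x => x ∈ A')))
  have e₃ := h.embEvent (Q.sum Q')
    (ι := Sum.elim (fun x : A => ι₁ x) (fun x : A' => ι₂ x)) (by
      rintro (x | x) (y | y) hxy
      · exact congrArg _ (Subtype.ext (h₁ hxy))
      · exact absurd hxy (hd _ _)
      · exact absurd hxy.symm (hd _ _)
      · exact congrArg _ (Subtype.ext (h₂ hxy)))
  rw [PosetLimit.t_sum, ← e₁, ← e₂] at e₃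
  have e₄ : PosetLimits.embEvent (Q.sum Q') (Sum.elim (fun x : A => ι₁ x) (fun x : A' => ι₂ x)) =
      (fun R : PosetOn ℕ => R.comap ι₁) ⁻¹' pairsEvent D ∩
        (fun R : PosetOn ℕ => R.comap ι₂) ⁻¹' pairsEvent D' := by
    rw [hQ, hQ']
    ext R
    constructor
    · exact fun hR => ⟨fun x y hxy => hR (.inl x) (.inl y) hxy,
        fun x y hxy => hR (.inr x) (.inr y) hxy⟩
    · rintro ⟨hR, hR'⟩ (x | x) (y | y) hxy
      · exact hR x y hxy
      · simp [PosetOn.lt, PosetOn.sum] at hxy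
      · simp [PosetOn.lt, PosetOn.sum] at hxy
      · exact hR' x y hxy
  rw [e₄] at e₃
  have e₅ : PosetLimits.embEvent Q (ι₁ ∘ Subtype.val) =
      (fun R : PosetOn ℕ => R.comap ι₁) ⁻¹' pairsEvent D := by
    rw [hQ]
    rfl
  have e₆ : PosetLimits.embEvent Q' (ι₂ ∘ Subtype.val) =
      (fun R : PosetOn ℕ => R.comap ι₂) ⁻¹' pairsEvent D' := by
    rw [hQ']
    rfl
  rw [e₅, e₆] at e₃
  rw [measureReal_def, measureReal_def, measureReal_def, ← ENNReal.toReal_mul,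
    ENNReal.toReal_eq_toReal_iff' (measure_ne_top _ _)
      (ENNReal.mul_ne_top (measure_ne_top _ _) (measure_ne_top _ _))] at e₃
  exact e₃

/-! ### Existence of representing kernels -/

/-- An infinite poset as an array indexed by two copies of `ℕ`. -/
def PosetOn.toArray (R : PosetOn ℕ) : BoolArray :=
  fun a b => R.1 (Equiv.natSumNatEquivNat a) (Equiv.natSumNatEquivNat b)

theorem measurable_toArray : Measurable PosetOn.toArray :=
  BoolArray.measurable_of_entries fun _ _ => measurable_bit _ _

theorem map_eval_pair {V S : Type*} [Fintype V] [MeasurableSpace S] (μ : Measure S)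
    [IsProbabilityMeasure μ] {i j : V} (hij : i ≠ j) :
    (Measure.pi fun _ : V => μ).map (fun x => (x i, x j)) = μ.prod μ := by
  have h1 : iIndepFun (fun (i : V) (x : V → S) => x i) (Measure.pi fun _ : V => μ) :=
    iIndepFun_pi (μ := fun _ : V => μ) (X := fun _ => id) fun _ => aemeasurable_id
  have h2 := (h1.indepFun hij)
  have hm : ∀ i : V, (Measure.pi fun _ : V => μ).map (fun x => x i) = μ := fun i =>
    (measurePreserving_eval (fun _ : V => μ) i).map_eq
  rw [(indepFun_iff_map_prod_eq_prod_map_map (measurable_pi_apply i).aemeasurable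
    (measurable_pi_apply j).aemeasurable).1 h2, hm, hm]

theorem map_eval_triple {S : Type*} [MeasurableSpace S] (μ : Measure S)
    [IsProbabilityMeasure μ] :
    (Measure.pi fun _ : Fin 3 => μ).map (fun x => ((x 0, x 1), x 2)) = (μ.prod μ).prod μ := by
  have hm : Measurable fun x : Fin 3 → S => ((x 0, x 1), x 2) :=
    ((measurable_pi_apply _).prodMk (measurable_pi_apply _)).prodMk (measurable_pi_apply _)
  have := Measure.isProbabilityMeasure_map (μ := Measure.pi fun _ : Fin 3 => μ) hm.aemeasurable
  refine Measure.ext_prod₃' fun {s t u} hs ht hu => ?_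
  rw [Measure.map_apply hm ((hs.prod ht).prod hu), Measure.prod_prod, Measure.prod_prod]
  have h1 : (fun x : Fin 3 → S => ((x 0, x 1), x 2)) ⁻¹' (s ×ˢ t) ×ˢ u =
      Set.univ.pi ![s, t, u] := by
    ext x
    simp [Set.mem_pi, Fin.forall_fin_succ, and_assoc]
  rw [h1, Measure.pi_pi]
  simp [Fin.prod_univ_three]

theorem exists_real_kernel {P : Measure BoolArray} [IsProbabilityMeasure P]
    (hP : ∀ τ, Function.Injective τ → MeasurePreserving (BoolArray.reindex τ) P P)
    (hdis : ∀ (n : ℕ) (D : Finset (Fin n × Fin n)) (C : Set (ℕ → ℕ → Bool)), MeasurableSet C →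
      P (BoolArray.base ⁻¹' C ∩ BoolArray.pairsOne D) =
        P (BoolArray.base ⁻¹' C) * P (BoolArray.pairsOne D)) :
    ∃ (μ : Measure ℝ) (_ : IsProbabilityMeasure μ) (w : ℝ × ℝ → unitInterval), Measurable w ∧
      ∀ (n : ℕ) (D : Finset (Fin n × Fin n)), BoolArray.IsOriented D →
        ∫ x, ∏ p ∈ D, (w (x p.1, x p.2) : ℝ) ∂(Measure.pi fun _ => μ) =
          P.real (BoolArray.pairsOne D) := by
  obtain ⟨μ, hμ, w, hw, hw1, h⟩ := BoolArray.exists_kernel hP hdis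
  let f := embeddingReal (ℕ → Bool × Bool)
  have hf : MeasurableEmbedding f := measurableEmbedding_embeddingReal _
  obtain ⟨g, hg, hgf⟩ := hf.exists_measurable_extend measurable_id fun _ => inferInstance
  have hgf' : ∀ x, g (f x) = x := fun x => congrFun hgf x
  let w' : ℝ × ℝ → unitInterval := fun p => ⟨(w (g p.1, g p.2)).toReal, ENNReal.toReal_nonneg,
    ENNReal.toReal_le_of_le_ofReal zero_le_one (by simpa using hw1 _)⟩
  have hw' : Measurable w' := by
    refine Measurable.subtype_mk (hw.comp ?_).ennreal_toReal
    exact (hg.comp measurable_fst).prodMk (hg.comp measurable_snd)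
  have hμf : IsProbabilityMeasure (μ.map f) :=
    Measure.isProbabilityMeasure_map hf.measurable.aemeasurable
  refine ⟨μ.map f, hμf, w', hw', fun n D hD => ?_⟩
  have hFm : Measurable fun x : Fin n → ℝ => ∏ p ∈ D, (w' (x p.1, x p.2) : ℝ) :=
    Finset.measurable_prod _ fun p _ => measurable_subtype_coe.comp (hw'.comp
      ((measurable_pi_apply _).prodMk (measurable_pi_apply _)))
  have hfm : Measurable fun (x : Fin n → ℕ → Bool × Bool) i => f (x i) :=
    measurable_pi_lambda _ fun i => hf.measurable.comp (measurable_pi_apply i)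
  rw [← Measure.pi_map_pi (μ := fun _ : Fin n => μ) (f := fun _ => f)
    fun _ => hf.measurable.aemeasurable, integral_map hfm.aemeasurable
    hFm.aestronglyMeasurable, measureReal_def, ← h n D hD]
  simp only [w', hgf', ← ENNReal.toReal_prod]
  refine integral_toReal (Finset.measurable_prod _ fun p _ => hw.comp
    ((measurable_pi_apply _).prodMk (measurable_pi_apply _))).aemeasurable
    (ae_of_all _ fun x => ?_)
  exact (Finset.prod_le_one' fun p _ => hw1 _).trans_lt ENNReal.one_lt_top

section

variable {Γ : PosetLimit}

theorem measurePreserving_reindex_limitLaw {τ : ℕ ⊕ ℕ → ℕ ⊕ ℕ} (hτ : Function.Injective τ) :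
    MeasurePreserving (BoolArray.reindex τ)
      ((limitLaw Γ : Measure (PosetOn ℕ)).map PosetOn.toArray)
      ((limitLaw Γ : Measure (PosetOn ℕ)).map PosetOn.toArray) := by
  refine ⟨BoolArray.measurable_reindex τ, ?_⟩
  let c := Equiv.natSumNatEquivNat
  have hinj : Function.Injective fun n => c (τ (c.symm n)) :=
    c.injective.comp (hτ.comp c.symm.injective)
  rw [Measure.map_map (BoolArray.measurable_reindex τ) measurable_toArray]
  conv_rhs => rw [← (hasDensities_limitLaw Γ).map_comap hinj]
  rw [Measure.map_map measurable_toArray (measurable_posetOn_comap _)]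
  congr 1
  ext R a b
  change R.1 (c (τ a)) (c (τ b)) = R.1 (c (τ (c.symm (c a)))) (c (τ (c.symm (c b))))
  rw [c.symm_apply_apply, c.symm_apply_apply]

theorem limitLaw_base_inter_pairsOne {n : ℕ} (D : Finset (Fin n × Fin n))
    {C : Set (ℕ → ℕ → Bool)} (hC : MeasurableSet C) :
    (limitLaw Γ : Measure (PosetOn ℕ)).map PosetOn.toArray
        (BoolArray.base ⁻¹' C ∩ BoolArray.pairsOne D) =
      (limitLaw Γ : Measure (PosetOn ℕ)).map PosetOn.toArray (BoolArray.base ⁻¹' C) *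
        (limitLaw Γ : Measure (PosetOn ℕ)).map PosetOn.toArray (BoolArray.pairsOne D) := by
  classical
  have hC' := BoolArray.measurable_base hC
  have hD := BoolArray.measurableSet_pairsOne D
  rw [Measure.map_apply measurable_toArray (hC'.inter hD), Measure.map_apply measurable_toArray hC',
    Measure.map_apply measurable_toArray hD]
  let c := Equiv.natSumNatEquivNat
  have h := (hasDensities_limitLaw Γ).indepFun (ι₁ := fun k => c (.inl k))
    (ι₂ := fun k => c (.inr k)) (c.injective.comp Sum.inl_injective)
    (c.injective.comp Sum.inr_injective) (fun i j h => by simpa using c.injective h)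
  refine h.measure_inter_preimage_eq_mul {R : PosetOn ℕ | R.1 ∈ C}
    (pairsEvent (D.image fun p => ((p.1 : ℕ), (p.2 : ℕ)))) (measurable_subtype_coe hC)
    (measurableSet_pairsEvent _) |>.trans ?_ |> Eq.trans ?_
  · congr 1
    ext R
    simp only [pairsEvent, Set.mem_preimage, Set.mem_inter_iff, Set.mem_ofPred_eq,
      Finset.forall_mem_image]
    rfl
  · congr 2
    ext R
    simp only [pairsEvent, Set.mem_preimage, Set.mem_ofPred_eq, Finset.forall_mem_image]
    rfl

theorem exists_posetKernel (Γ : ProperPosetLimit) :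
    ∃ (S : OrderedProbabilitySpace.{0}) (K : PosetKernel S), K.Represents Γ := by
  classical
  set P := (limitLaw Γ.1 : Measure (PosetOn ℕ)).map PosetOn.toArray with hPdef
  have hPprob : IsProbabilityMeasure P :=
    Measure.isProbabilityMeasure_map measurable_toArray.aemeasurable
  obtain ⟨μ, hμ, w, hw, h⟩ := exists_real_kernel (P := P)
    (fun τ hτ => measurePreserving_reindex_limitLaw hτ)
    (fun n D C hC => limitLaw_base_inter_pairsOne D hC)
  have hPr : ∀ {n : ℕ} (D : Finset (Fin n × Fin n)), P.real (BoolArray.pairsOne D) =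
      (limitLaw Γ.1 : Measure (PosetOn ℕ)).real {R | ∀ p ∈ D,
        R.lt (Equiv.natSumNatEquivNat (.inr p.1)) (Equiv.natSumNatEquivNat (.inr p.2))} :=
    fun D => map_measureReal_apply measurable_toArray (BoolArray.measurableSet_pairsOne D)
  have hwm : ∀ {n : ℕ} (i j : Fin n), Measurable fun x : Fin n → ℝ => (w (x i, x j) : ℝ) :=
    fun i j => measurable_subtype_coe.comp
      (hw.comp ((measurable_pi_apply _).prodMk (measurable_pi_apply _)))
  have hint : ∀ {n : ℕ} (D : Finset (Fin n × Fin n)),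
      Integrable (fun x : Fin n → ℝ => ∏ p ∈ D, (w (x p.1, x p.2) : ℝ))
        (Measure.pi fun _ => μ) := by
    intro n D
    refine Integrable.of_bound (Finset.measurable_prod _ fun p _ =>
      hwm p.1 p.2).aestronglyMeasurable 1 (ae_of_all _ fun x => ?_)
    rw [Real.norm_of_nonneg (Finset.prod_nonneg fun p _ => (w _).2.1)]
    exact Finset.prod_le_one (fun p _ => (w _).2.1) fun p _ => (w _).2.2
  have htriple : ∀ q : (ℝ × ℝ) × ℝ → Prop, MeasurableSet {t | q t} →
      (∀ᵐ x ∂(Measure.pi fun _ : Fin 3 => μ), q ((x 0, x 1), x 2)) →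
      ∀ᵐ t ∂((μ.prod μ).prod μ), q t := by
    intro q hq hx
    have hm : Measurable fun x : Fin 3 → ℝ => ((x 0, x 1), x 2) :=
      ((measurable_pi_apply _).prodMk (measurable_pi_apply _)).prodMk (measurable_pi_apply _)
    rw [← map_eval_triple, ae_map_iff hm.aemeasurable hq]
    exact hx
  have hm1 : Measurable fun t : (ℝ × ℝ) × ℝ => w t.1 := hw.comp measurable_fst
  have hm2 : Measurable fun t : (ℝ × ℝ) × ℝ => w (t.1.2, t.2) :=
    hw.comp ((measurable_snd.comp measurable_fst).prodMk measurable_snd)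
  have hm3 : Measurable fun t : (ℝ × ℝ) × ℝ => w (t.1.1, t.2) :=
    hw.comp ((measurable_fst.comp measurable_fst).prodMk measurable_snd)
  have hm4 : Measurable fun t : (ℝ × ℝ) × ℝ => w (t.2, t.1.1) :=
    hw.comp (measurable_snd.prodMk (measurable_fst.comp measurable_fst))
  have hqm : ∀ (v : (ℝ × ℝ) × ℝ → unitInterval) (_ : Measurable v) (a : unitInterval),
      MeasurableSet {t : (ℝ × ℝ) × ℝ | 0 < w t.1 → 0 < w (t.1.2, t.2) → v t = a} := by
    intro v hv a
    have : {t : (ℝ × ℝ) × ℝ | 0 < w t.1 → 0 < w (t.1.2, t.2) → v t = a} =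
        {t | 0 < w t.1}ᶜ ∪ ({t | 0 < w (t.1.2, t.2)}ᶜ ∪ {t | v t = a}) := by
      ext t
      simp only [Set.mem_union, Set.mem_compl_iff, Set.mem_ofPred_eq]
      tauto
    rw [this]
    exact (measurableSet_lt measurable_const hm1).compl.union
      ((measurableSet_lt measurable_const hm2).compl.union (hv (measurableSet_singleton a)))
  have htr : ∀ᵐ t ∂((μ.prod μ).prod μ),
      0 < w t.1 → 0 < w (t.1.2, t.2) → w (t.1.1, t.2) = 1 := by
    refine htriple _ (hqm _ hm3 1) ?_
    have h1 := h 3 {(0, 1), (1, 2)} (by unfold BoolArray.IsOriented; decide)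
    have h2 := h 3 {(0, 1), (1, 2), (0, 2)} (by unfold BoolArray.IsOriented; decide)
    have h3 : P.real (BoolArray.pairsOne ({(0, 1), (1, 2)} : Finset (Fin 3 × Fin 3))) =
        P.real (BoolArray.pairsOne ({(0, 1), (1, 2), (0, 2)} : Finset (Fin 3 × Fin 3))) := by
      rw [hPr, hPr]
      congr 1
      ext R
      simp only [Finset.mem_insert, Finset.mem_singleton, Set.mem_ofPred_eq, forall_eq_or_imp,
        forall_eq]
      exact ⟨fun hR => ⟨hR.1, hR.2, R.2.2 _ _ _ hR.1 hR.2⟩, fun hR => ⟨hR.1, hR.2.1⟩⟩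
    have e1 : ∀ x : Fin 3 → ℝ, ∏ p ∈ ({(0, 1), (1, 2)} : Finset (Fin 3 × Fin 3)),
        (w (x p.1, x p.2) : ℝ) = w (x 0, x 1) * w (x 1, x 2) := fun x => by
      rw [Finset.prod_insert (by decide), Finset.prod_singleton]
    have e2 : ∀ x : Fin 3 → ℝ, ∏ p ∈ ({(0, 1), (1, 2), (0, 2)} : Finset (Fin 3 × Fin 3)),
        (w (x p.1, x p.2) : ℝ) = w (x 0, x 1) * (w (x 1, x 2) * w (x 0, x 2)) := fun x => by
      rw [Finset.prod_insert (by decide), Finset.prod_insert (by decide), Finset.prod_singleton]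
    have i1 := hint ({(0, 1), (1, 2)} : Finset (Fin 3 × Fin 3))
    have i2 := hint ({(0, 1), (1, 2), (0, 2)} : Finset (Fin 3 × Fin 3))
    have h4 := integral_sub i1 i2
    rw [h1, h2, h3, sub_self] at h4
    have hnn : 0 ≤ fun x : Fin 3 → ℝ =>
        ∏ p ∈ ({(0, 1), (1, 2)} : Finset (Fin 3 × Fin 3)), (w (x p.1, x p.2) : ℝ) -
          ∏ p ∈ ({(0, 1), (1, 2), (0, 2)} : Finset (Fin 3 × Fin 3)),
            (w (x p.1, x p.2) : ℝ) := fun x => by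
      simp only [Pi.zero_apply]
      rw [e1, e2, ← mul_assoc, sub_nonneg]
      exact mul_le_of_le_one_right (mul_nonneg (w _).2.1 (w _).2.1) (w _).2.2
    filter_upwards [(integral_eq_zero_iff_of_nonneg hnn (i1.sub i2)).1 h4] with x hx h01 h12
    simp only [Pi.zero_apply] at hx
    rw [e1, e2] at hx
    have h01' : (0 : ℝ) < w (x 0, x 1) := h01
    have h12' : (0 : ℝ) < w (x 1, x 2) := h12
    have h5 : (w (x 0, x 1) : ℝ) * w (x 1, x 2) * (1 - w (x 0, x 2)) = 0 := by linarith
    have h6 := (mul_eq_zero.1 h5).resolve_left (mul_pos h01' h12').ne'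
    exact Subtype.ext (by simpa using (sub_eq_zero.1 h6).symm)
  have hcy : ∀ᵐ t ∂((μ.prod μ).prod μ),
      0 < w t.1 → 0 < w (t.1.2, t.2) → w (t.2, t.1.1) = 0 := by
    refine htriple _ (hqm _ hm4 0) ?_
    have h1 := h 3 {(0, 1), (1, 2), (2, 0)} (by unfold BoolArray.IsOriented; decide)
    have h3 : P.real (BoolArray.pairsOne ({(0, 1), (1, 2), (2, 0)} : Finset (Fin 3 × Fin 3))) =
        0 := by
      rw [hPr, ← measureReal_empty (μ := (limitLaw Γ.1 : Measure (PosetOn ℕ)))]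
      congr 1
      ext R
      simp only [Finset.mem_insert, Finset.mem_singleton, Set.mem_ofPred_eq, forall_eq_or_imp,
        forall_eq, Set.mem_empty_iff_false, iff_false]
      rintro ⟨h01, h12, h20⟩
      have h00 := R.2.2 _ _ _ (R.2.2 _ _ _ h01 h12) h20
      rw [R.2.1] at h00
      exact absurd h00 (by decide)
    rw [h3, integral_eq_zero_iff_of_nonneg
      (fun x => Finset.prod_nonneg fun p _ => (w (x p.1, x p.2)).2.1) (hint _)] at h1
    filter_upwards [h1] with x hx h01 h12
    have hx' : ∏ p ∈ ({(0, 1), (1, 2), (2, 0)} : Finset (Fin 3 × Fin 3)),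
      (w (x p.1, x p.2) : ℝ) = 0 := hx
    rw [Finset.prod_insert (by decide), Finset.prod_insert (by decide), Finset.prod_singleton,
      ← mul_assoc] at hx'
    have h01' : (0 : ℝ) < w (x 0, x 1) := h01
    have h12' : (0 : ℝ) < w (x 1, x 2) := h12
    exact Subtype.ext ((mul_eq_zero.1 hx').resolve_left (mul_pos h01' h12').ne')
  obtain ⟨w', hw', hirr, htrans, hae⟩ := exists_regular_version hw htr hcy
  let S : OrderedProbabilitySpace.{0} :=
    { carrier := ℝ
      μ := μ
      lt := fun x y => 0 < w' (x, y)
      lt_irrefl := fun x hx => by simp [hirr] at hx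
      lt_trans := fun x y z hxy hyz => by simp [htrans x y z hxy hyz]
      measurableSet_lt := measurableSet_lt measurable_const hw' }
  refine ⟨S, ⟨fun x y => w' (x, y), hw', fun x y hxy => hxy, htrans⟩, fun n Q => ?_⟩
  let D : Finset (Fin (n + 1) × Fin (n + 1)) := Finset.univ.filter fun p => Q.lt p.1 p.2
  have hne : ∀ i j, Q.lt i j → i ≠ j := by
    rintro i _ hij rfl
    exact absurd ((Q.2.1 i).symm.trans hij) (by decide)
  have hD : BoolArray.IsOriented D := by
    intro p hp
    have hp' := (Finset.mem_filter.1 hp).2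
    refine ⟨hne _ _ hp', fun hs => ?_⟩
    exact hne _ _ (Q.2.2 _ _ _ hp' (Finset.mem_filter.1 hs).2) rfl
  have h1 := h (n + 1) D hD
  rw [hPr] at h1
  rw [← (hasDensities_limitLaw Γ.1).embEvent Q
    (ι := fun i => Equiv.natSumNatEquivNat (.inr (i : ℕ)))
    (Equiv.natSumNatEquivNat.injective.comp (Sum.inr_injective.comp Fin.val_injective))]
  have e1 : embEvent Q (fun i : Fin (n + 1) => Equiv.natSumNatEquivNat (.inr (i : ℕ))) =
      {R | ∀ p ∈ D, R.lt (Equiv.natSumNatEquivNat (.inr p.1))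
        (Equiv.natSumNatEquivNat (.inr p.2))} := by
    ext R
    simp [embEvent, D]
  rw [e1, ← h1]
  refine integral_congr_ae ?_
  have hall : ∀ᵐ x ∂(Measure.pi fun _ : Fin (n + 1) => μ), ∀ i j : Fin (n + 1), i ≠ j →
      w' (x i, x j) = w (x i, x j) := by
    refine ae_all_iff.2 fun i => ae_all_iff.2 fun j => ?_
    by_cases hij : i = j
    · exact ae_of_all _ fun x h => absurd hij h
    · have h2 := hae
      rw [← map_eval_pair μ hij] at h2
      have hm : Measurable fun x : Fin (n + 1) → ℝ => (x i, x j) :=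
        (measurable_pi_apply _).prodMk (measurable_pi_apply _)
      filter_upwards [ae_of_ae_map hm.aemeasurable h2] with x hx _ using hx
  filter_upwards [hall] with x hx
  rw [← Fintype.prod_prod_type' (f := fun i j => if Q.lt i j then (w' (x i, x j) : ℝ) else 1),
    ← Finset.prod_filter (fun p : Fin (n + 1) × Fin (n + 1) => Q.lt p.1 p.2)]
  refine Finset.prod_congr rfl fun p hp => ?_
  rw [hx _ _ (hD p hp).1]

end

theorem pInftyLaw_eq_limitLaw (Γ : ProperPosetLimit) : pInftyLaw Γ = limitLaw Γ.1 := by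
  have h := exists_posetKernel Γ
  rw [pInftyLaw, dif_pos h]
  exact h.choose_spec.choose_spec.hasDensities.eq_limitLaw

/-! ### Proper poset limits -/

theorem FinPoset.size_pos (P : FinPoset) : 0 < P.size := by
  obtain ⟨n, p, rfl⟩ := P.exists_rep
  rw [FinPoset.size_unlabelled]
  exact Fintype.card_pos

theorem FinPoset.toLimit_snd (P : FinPoset) : (P.toLimit.1.2 : ℝ) = (P.size : ℝ)⁻¹ := rfl

theorem FinPoset.finite_size_le (N : ℕ) : {P : FinPoset | P.size ≤ N}.Finite := by
  refine Set.Finite.subset (Set.finite_iUnion fun n : Fin (N + 1) =>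
    Set.finite_range fun p : PosetOn (Fin ((n : ℕ) + 1)) => p.unlabelled) fun P hP => ?_
  obtain ⟨n, p, rfl⟩ := P.exists_rep
  have hP' : p.unlabelled.size ≤ N := hP
  rw [FinPoset.size_unlabelled, Fintype.card_fin] at hP'
  exact Set.mem_iUnion.2 ⟨⟨n, by omega⟩, p, rfl⟩

theorem finite_range_toLimit_inter {a : ℝ} (ha : 0 < a) :
    (Set.range FinPoset.toLimit ∩ {Γ | a < (Γ.1.2 : ℝ)}).Finite := by
  refine ((FinPoset.finite_size_le ⌊a⁻¹⌋₊).image FinPoset.toLimit).subset ?_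
  rintro _ ⟨⟨P, rfl⟩, hP⟩
  refine ⟨P, Nat.le_floor ?_, rfl⟩
  have hP' : a < (P.size : ℝ)⁻¹ := hP
  exact (le_inv_comm₀ ha (Nat.cast_pos.2 P.size_pos)).1 hP'.le

theorem isOpen_lt_snd (a : ℝ) : IsOpen {Γ : PosetLimit | a < (Γ.1.2 : ℝ)} :=
  isOpen_lt continuous_const
    (continuous_subtype_val.comp (continuous_snd.comp continuous_subtype_val))

theorem mem_range_toLimit_iff (Γ : PosetLimit) :
    Γ ∈ Set.range FinPoset.toLimit ↔ (Γ.1.2 : ℝ) ≠ 0 := by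
  constructor
  · rintro ⟨P, rfl⟩
    rw [FinPoset.toLimit_snd]
    exact inv_ne_zero (Nat.cast_ne_zero.2 P.size_pos.ne')
  · intro h
    have hpos : 0 < (Γ.1.2 : ℝ) := lt_of_le_of_ne Γ.1.2.2.1 h.symm
    have h1 : Γ ∈ closure (Set.range FinPoset.toLimit ∩ {Γ' | (Γ.1.2 : ℝ) / 2 < (Γ'.1.2 : ℝ)}) := by
      rw [Set.inter_comm]
      exact (isOpen_lt_snd _).inter_closure ⟨by simpa using hpos, denseRange_toLimit Γ⟩
    rw [(finite_range_toLimit_inter (half_pos hpos)).isClosed.closure_eq] at h1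
    exact h1.1

theorem notMem_range_toLimit_iff (Γ : PosetLimit) :
    Γ ∉ Set.range FinPoset.toLimit ↔ (Γ.1.2 : ℝ) = 0 := by
  rw [mem_range_toLimit_iff, not_not]

/-! ### Injective maps -/

theorem card_eq_apply_mul_le {V U : Type*} [Finite V] [Finite U] {i j : V} (hij : i ≠ j) :
    Nat.card {f : V → U // f i = f j} * Nat.card U ≤ Nat.card (V → U) := by
  classical
  rw [← Nat.card_prod]
  refine Nat.card_le_card_of_injective (fun q => Function.update q.1.1 j q.2) ?_
  rintro ⟨⟨f, hf⟩, u⟩ ⟨⟨g, hg⟩, v⟩ h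
  have hu : u = v := by simpa using congrFun h j
  have hfg : ∀ x, x ≠ j → f x = g x := fun x hx => by simpa [hx] using congrFun h x
  have : f = g := by
    ext x
    by_cases hx : x = j
    · rw [hx, ← hf, ← hg, hfg i hij]
    · exact hfg x hx
  subst this hu
  rfl

/-- The proportion of maps that are not injective is small. -/
theorem card_not_injective_div_le (V U : Type*) [Finite V] [Finite U] [Nonempty U] :
    (Nat.card {f : V → U // ¬ Function.Injective f} : ℝ) / Nat.card (V → U) ≤
      (Nat.card V : ℝ) ^ 2 / Nat.card U := by
  classical
  have := Fintype.ofFinite V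
  have := Fintype.ofFinite U
  have hU : (0 : ℝ) < Nat.card U := Nat.cast_pos.2 Nat.card_pos
  have hVU : (0 : ℝ) < Nat.card (V → U) := Nat.cast_pos.2 Nat.card_pos
  rw [div_le_div_iff₀ hVU hU]
  norm_cast
  have h1 : Nat.card {f : V → U // ¬ Function.Injective f} ≤
      ∑ p ∈ (Finset.univ : Finset (V × V)).filter (fun p => p.1 ≠ p.2),
        Nat.card {f : V → U // f p.1 = f p.2} := by
    simp only [Nat.card_eq_fintype_card, Fintype.card_subtype]
    refine (Finset.card_le_card fun f hf => ?_).trans Finset.card_biUnion_le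
    have hf' := (Finset.mem_filter.1 hf).2
    simp only [Function.Injective, not_forall] at hf'
    obtain ⟨i, j, hij, hne⟩ := hf'
    exact Finset.mem_biUnion.2 ⟨(i, j), by simp [hne], by simp [hij]⟩
  calc _ ≤ (∑ p ∈ (Finset.univ : Finset (V × V)).filter (fun p => p.1 ≠ p.2),
        Nat.card {f : V → U // f p.1 = f p.2}) * Nat.card U := Nat.mul_le_mul_right _ h1
    _ ≤ ∑ p ∈ (Finset.univ : Finset (V × V)).filter (fun p => p.1 ≠ p.2), Nat.card (V → U) := by
      rw [Finset.sum_mul]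
      exact Finset.sum_le_sum fun p hp => card_eq_apply_mul_le (Finset.mem_filter.1 hp).2
    _ ≤ _ := by
      rw [Finset.sum_const, smul_eq_mul]
      refine Nat.mul_le_mul_right _ ((Finset.card_filter_le _ _).trans ?_)
      rw [Finset.card_univ, Fintype.card_prod, sq, Nat.card_eq_fintype_card]

theorem card_injective_add_card_not (V U : Type*) [Finite V] [Finite U] :
    Nat.card (V ↪ U) + Nat.card {f : V → U // ¬ Function.Injective f} = Nat.card (V → U) := by
  classical
  have h1 : Nat.card (V ↪ U) = Nat.card {f : V → U // Function.Injective f} :=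
    Nat.card_congr (Equiv.subtypeInjectiveEquivEmbedding V U).symm
  rw [h1, ← Nat.card_sum]
  exact Nat.card_congr (Equiv.sumCompl _)

theorem abs_indDensity_sub_le {V U : Type*} [Finite V] [Finite U] [Nonempty U]
    (q : PosetOn V) (p : PosetOn U) :
    |q.indDensity p - (Nat.card {f : V → U // p.comap f = q} : ℝ) / Nat.card (V → U)| ≤
      (Nat.card V : ℝ) ^ 2 / Nat.card U := by
  refine le_trans ?_ (card_not_injective_div_le V U)
  unfold PosetOn.indDensity
  have hiff : ∀ f : V → U, p.comap f = q ↔ ∀ x y, q.lt x y ↔ p.lt (f x) (f y) := by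
    intro f
    constructor
    · rintro rfl x y
      rfl
    · intro h
      refine Subtype.ext (funext fun x => funext fun y => ?_)
      have := h x y
      simp only [PosetOn.lt] at this
      exact Bool.eq_iff_iff.2 this.symm
  have hT := card_injective_add_card_not V U
  have hIE : Nat.card {f : V ↪ U // ∀ x y, q.lt x y ↔ p.lt (f x) (f y)} ≤ Nat.card (V ↪ U) :=
    Nat.card_le_card_of_injective _ Subtype.val_injective
  have hIM : Nat.card {f : V ↪ U // ∀ x y, q.lt x y ↔ p.lt (f x) (f y)} ≤
      Nat.card {f : V → U // p.comap f = q} := by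
    refine Nat.card_le_card_of_injective (fun f => ⟨f.1, (hiff _).2 f.2⟩) fun f g h => ?_
    exact Subtype.ext (DFunLike.coe_injective (congrArg Subtype.val h))
  have hMI : Nat.card {f : V → U // p.comap f = q} ≤
      Nat.card {f : V ↪ U // ∀ x y, q.lt x y ↔ p.lt (f x) (f y)} +
        Nat.card {f : V → U // ¬ Function.Injective f} := by
    classical
    rw [← Nat.card_sum]
    refine Nat.card_le_card_of_injective (fun f => if h : Function.Injective f.1
      then .inl ⟨⟨f.1, h⟩, (hiff _).1 f.2⟩ else .inr ⟨f.1, h⟩) fun f g h => ?_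
    by_cases hf : Function.Injective f.1 <;> by_cases hg : Function.Injective g.1 <;>
      simp [hf, hg] at h
    · exact Subtype.ext h
    · exact Subtype.ext h
  have hTpos : 0 < Nat.card (V → U) := Nat.card_pos
  generalize Nat.card {f : V → U // p.comap f = q} = M at *
  generalize Nat.card {f : V ↪ U // ∀ x y, q.lt x y ↔ p.lt (f x) (f y)} = I at *
  generalize Nat.card (V ↪ U) = E at *
  generalize Nat.card {f : V → U // ¬ Function.Injective f} = B at *
  generalize Nat.card (V → U) = T at *
  have hTpos' : (0 : ℝ) < T := Nat.cast_pos.2 hTpos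
  have hT' : (E : ℝ) + B = T := by exact_mod_cast hT
  have hIE' : (I : ℝ) ≤ E := by exact_mod_cast hIE
  have hIM' : (I : ℝ) ≤ M := by exact_mod_cast hIM
  have hMI' : (M : ℝ) ≤ I + B := by exact_mod_cast hMI
  have h1 : (I : ℝ) / T ≤ M / T := by gcongr
  have h2 : (M : ℝ) / T ≤ I / T + B / T := by
    rw [← add_div]
    gcongr
  rcases Nat.eq_zero_or_pos E with rfl | hE
  · have : I = 0 := by omega
    subst this
    rw [abs_le]
    simp only [Nat.cast_zero, zero_div, zero_sub, zero_add] at *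
    constructor
    · linarith
    · have : (0 : ℝ) ≤ B / T := by positivity
      linarith
  · have hE' : (0 : ℝ) < E := Nat.cast_pos.2 hE
    have h3 : (I : ℝ) / T ≤ I / E := by
      gcongr
      have : (0 : ℝ) ≤ B := Nat.cast_nonneg _
      linarith
    have h4 : (I : ℝ) / E ≤ I / T + B / T := by
      rw [← add_div, div_le_div_iff₀ hE' hTpos', ← hT']
      have : (0 : ℝ) ≤ B := Nat.cast_nonneg _
      nlinarith
    rw [abs_le]
    constructor <;> linarith

/-! ### The extension of the induced densities -/

theorem FinPoset.exists_rep_finset (P : FinPoset) :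
    ∃ (A : Finset ℕ) (_ : Nonempty A) (p : PosetOn A), p.unlabelled = P := by
  obtain ⟨n, p, rfl⟩ := P.exists_rep
  let A : Finset ℕ := Finset.range (n + 1)
  let e : A ≃ Fin (n + 1) := Fintype.equivFinOfCardEq (by simp [A])
  have : Nonempty A := e.nonempty_congr.2 inferInstance
  exact ⟨A, this, p.comap e, PosetOn.unlabelled_eq_of_iso (p.iso_comap e)⟩

theorem isClopen_restrictEvent {A : Finset ℕ} (Q : PosetOn A) : IsClopen (restrictEvent Q) := by
  have : restrictEvent Q = ⋂ p ∈ (Set.univ : Set (A × A)),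
      {R : PosetOn ℕ | R.1 p.1 p.2 = Q.1 p.1 p.2} := by
    ext R
    simp only [restrictEvent, Set.mem_univ, Set.iInter_true, Set.mem_iInter, Prod.forall,
      Set.mem_ofPred_eq, Subtype.ext_iff, funext_iff]
    rfl
  rw [this]
  exact Set.finite_univ.isClopen_biInter fun p _ =>
    (isClopen_discrete {Q.1 p.1 p.2}).preimage (continuous_bit p.1 p.2)

theorem sampleLaw_real_restrictEvent {n : ℕ} (p : PosetOn (Fin (n + 1))) {A : Finset ℕ}
    (q : PosetOn A) : (sampleLaw p).real (restrictEvent q) =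
      (Nat.card {f : A → Fin (n + 1) // p.comap f = q} : ℝ) / Nat.card (A → Fin (n + 1)) :=
  sampleLaw_real_restrict p A {q} (isClopen_restrictEvent q).2.measurableSet

theorem abs_tInd_sub_le {A : Finset ℕ} [Nonempty A] (q : PosetOn A) (P : FinPoset) :
    |FinPoset.tInd q.unlabelled P -
        (limitLaw P.toLimit : Measure (PosetOn ℕ)).real (restrictEvent q)| ≤
      (Nat.card A : ℝ) ^ 2 * (P.toLimit.1.2 : ℝ) := by
  obtain ⟨n, p, rfl⟩ := P.exists_rep
  rw [FinPoset.tInd_unlabelled, ← (hasDensities_sampleLaw p).eq_limitLaw,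
    sampleLaw_real_restrictEvent, FinPoset.toLimit_snd, FinPoset.size_unlabelled]
  have := abs_indDensity_sub_le q p
  rwa [Nat.card_eq_fintype_card (α := Fin (n + 1)), div_eq_mul_inv (_ ^ 2)] at this

theorem tendsto_tInd_of_proper {A : Finset ℕ} [Nonempty A] (q : PosetOn A) {Γ : PosetLimit}
    (hΓ : Γ ∉ Set.range FinPoset.toLimit) :
    Tendsto (FinPoset.tInd q.unlabelled) (comap FinPoset.toLimit (𝓝 Γ))
      (𝓝 ((limitLaw Γ : Measure (PosetOn ℕ)).real (restrictEvent q))) := by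
  have h1 : Tendsto (fun P : FinPoset =>
      (limitLaw P.toLimit : Measure (PosetOn ℕ)).real (restrictEvent q))
      (comap FinPoset.toLimit (𝓝 Γ))
      (𝓝 ((limitLaw Γ : Measure (PosetOn ℕ)).real (restrictEvent q))) :=
    (((continuous_probabilityMeasure_real (isClopen_restrictEvent q)).comp
      continuous_limitLaw).tendsto Γ).comp tendsto_comap
  have h2 : Tendsto (fun P : FinPoset => (Nat.card A : ℝ) ^ 2 * (P.toLimit.1.2 : ℝ))
      (comap FinPoset.toLimit (𝓝 Γ)) (𝓝 0) := by
    have hc : Continuous fun Γ : PosetLimit => (Nat.card A : ℝ) ^ 2 * (Γ.1.2 : ℝ) :=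
      continuous_const.mul
        (continuous_subtype_val.comp (continuous_snd.comp continuous_subtype_val))
    have := (hc.tendsto Γ).comp (tendsto_comap (f := FinPoset.toLimit))
    rwa [(notMem_range_toLimit_iff Γ).1 hΓ, mul_zero] at this
  have h3 : Tendsto (fun P => FinPoset.tInd q.unlabelled P -
      (limitLaw P.toLimit : Measure (PosetOn ℕ)).real (restrictEvent q))
      (comap FinPoset.toLimit (𝓝 Γ)) (𝓝 0) :=
    squeeze_zero_norm (fun P => abs_tInd_sub_le q P) h2
  simpa using h3.add h1

theorem card_comap_eq_congr {n : ℕ} {p p' : PosetOn (Fin (n + 1))}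
    (h : p.unlabelled.toLimit = p'.unlabelled.toLimit) {V : Type} [Finite V] [Nonempty V]
    (q : PosetOn V) :
    Nat.card {f : V → Fin (n + 1) // p.comap f = q} =
      Nat.card {f : V → Fin (n + 1) // p'.comap f = q} := by
  have := Fintype.ofFinite V
  let A : Finset ℕ := Finset.range (Fintype.card V)
  let e : A ≃ V := Fintype.equivOfCardEq (by simp [A])
  have key : ∀ p : PosetOn (Fin (n + 1)), Nat.card {f : V → Fin (n + 1) // p.comap f = q} =
      Nat.card {f : A → Fin (n + 1) // p.comap f = q.comap e} := by
    intro p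
    refine Nat.card_congr ((e.arrowCongr (Equiv.refl _)).symm.subtypeEquiv fun f => ?_)
    constructor
    · rintro rfl
      rfl
    · intro hf
      refine Subtype.ext (funext fun x => funext fun y => ?_)
      have := congrFun (congrFun (congrArg Subtype.val hf) (e.symm x)) (e.symm y)
      simpa [PosetOn.comap] using this
  rw [key p, key p']
  have h1 : sampleLaw p = sampleLaw p' := by
    rw [(hasDensities_sampleLaw p).eq_limitLaw, (hasDensities_sampleLaw p').eq_limitLaw, h]
  have h2 := sampleLaw_real_restrictEvent p (q.comap e)
  rw [h1, sampleLaw_real_restrictEvent] at h2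
  have hT : ((Nat.card (A → Fin (n + 1)) : ℕ) : ℝ) ≠ 0 := Nat.cast_ne_zero.2 Nat.card_pos.ne'
  exact_mod_cast ((div_left_inj' hT).1 h2).symm

theorem card_ker_eq {V U : Type*} (p : PosetOn U) (θ : Setoid V) (q : PosetOn (Quotient θ)) :
    Nat.card {f : V → U // p.comap f = q.comap (Quotient.mk θ) ∧ Setoid.ker f = θ} =
      Nat.card {f : Quotient θ ↪ U // ∀ x y, q.lt x y ↔ p.lt (f x) (f y)} := by
  refine Nat.card_congr ⟨fun f => ⟨⟨Quotient.lift f.1 fun a b hab => ?_, ?_⟩, ?_⟩,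
    fun g => ⟨fun v => g.1 (Quotient.mk θ v), ?_, ?_⟩, fun f => ?_, fun g => ?_⟩
  · have h : Setoid.ker f.1 a b := by
      rw [f.2.2]
      exact hab
    exact h
  · rintro ⟨a⟩ ⟨b⟩ hab
    refine Quotient.sound ?_
    change θ a b
    rw [← f.2.2]
    exact hab
  · rintro ⟨a⟩ ⟨b⟩
    have := congrFun (congrFun (congrArg Subtype.val f.2.1) a) b
    exact (Bool.eq_iff_iff.1 this).symm
  · refine Subtype.ext (funext fun a => funext fun b => ?_)
    exact Bool.eq_iff_iff.2 (g.2 (Quotient.mk θ a) (Quotient.mk θ b)).symm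
  · ext a b
    rw [Setoid.ker_def, g.1.injective.eq_iff]
    exact Quotient.eq
  · rfl
  · refine Subtype.ext (DFunLike.ext _ _ ?_)
    rintro ⟨a⟩
    rfl

theorem card_indEmbedding_congr {n : ℕ} {p p' : PosetOn (Fin (n + 1))}
    (h : p.unlabelled.toLimit = p'.unlabelled.toLimit) (k : ℕ) :
    ∀ (V : Type) [Finite V] [Nonempty V] (q : PosetOn V), Nat.card V = k →
    Nat.card {f : V ↪ Fin (n + 1) // ∀ x y, q.lt x y ↔ p.lt (f x) (f y)} =
      Nat.card {f : V ↪ Fin (n + 1) // ∀ x y, q.lt x y ↔ p'.lt (f x) (f y)} := by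
  classical
  induction k using Nat.strong_induction_on with
  | _ k ih =>
  intro V _ _ q hk
  have : Finite (Setoid V) := Finite.of_injective (fun θ : Setoid V => θ.r) fun θ θ' h =>
    Setoid.ext fun a b => iff_of_eq (congrFun (congrFun h a) b)
  have := Fintype.ofFinite (Setoid V)
  have := Fintype.ofFinite V
  let N : PosetOn (Fin (n + 1)) → Setoid V → ℕ := fun p θ =>
    Nat.card {f : V → Fin (n + 1) // p.comap f = q ∧ Setoid.ker f = θ}
  have hsum : ∀ p : PosetOn (Fin (n + 1)),
      Nat.card {f : V → Fin (n + 1) // p.comap f = q} = ∑ θ, N p θ := by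
    intro p
    rw [← Nat.card_sigma]
    exact Nat.card_congr ⟨fun f => ⟨Setoid.ker f.1, f.1, f.2, rfl⟩, fun f => ⟨f.2.1, f.2.2.1⟩,
      fun f => rfl, fun ⟨θ, f, hf, hθ⟩ => by subst hθ; rfl⟩
  have hbot : ∀ p : PosetOn (Fin (n + 1)), N p ⊥ =
      Nat.card {f : V ↪ Fin (n + 1) // ∀ x y, q.lt x y ↔ p.lt (f x) (f y)} := by
    intro p
    refine Nat.card_congr ⟨fun f => ⟨⟨f.1, Setoid.ker_eq_bot_iff.1 f.2.2⟩, fun x y => ?_⟩,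
      fun f => ⟨f.1, ?_, Setoid.ker_eq_bot_iff.2 f.1.injective⟩, fun f => rfl, fun f => rfl⟩
    · have := congrFun (congrFun (congrArg Subtype.val f.2.1) x) y
      exact (Bool.eq_iff_iff.1 this).symm
    · exact Subtype.ext (funext fun x => funext fun y => Bool.eq_iff_iff.2 (f.2 x y).symm)
  have hne : ∀ θ : Setoid V, θ ≠ ⊥ → N p θ = N p' θ := by
    intro θ hθ
    by_cases hq : ∃ q' : PosetOn (Quotient θ), q'.comap (Quotient.mk θ) = q
    · obtain ⟨q', rfl⟩ := hq
      simp only [N]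
      rw [card_ker_eq, card_ker_eq]
      have hlt : Nat.card (Quotient θ) < k := by
        obtain ⟨a, b, hab, hne⟩ : ∃ a b, θ a b ∧ a ≠ b := by
          by_contra hcon
          push Not at hcon
          exact hθ (le_bot_iff.1 fun a b hab => hcon a b hab)
        rw [← hk, Nat.card_eq_fintype_card, Nat.card_eq_fintype_card]
        refine Fintype.card_lt_of_surjective_not_injective (Quotient.mk θ) Quotient.mk_surjective
          fun hinj => hne (hinj (Quotient.sound hab))
      have : Nonempty (Quotient θ) := (inferInstance : Nonempty V).map (Quotient.mk θ)
      exact ih _ hlt (Quotient θ) q' rfl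
    · have hzero : ∀ p : PosetOn (Fin (n + 1)), N p θ = 0 := by
        intro p
        refine Nat.card_eq_zero.2 (.inl ⟨fun f => hq ?_⟩)
        obtain ⟨f, hf, rfl⟩ := f
        refine ⟨p.comap (Quotient.lift f fun a b hab => hab), ?_⟩
        rw [← hf]
        rfl
      rw [hzero, hzero]
  have h1 := card_comap_eq_congr h q
  rw [hsum p, hsum p', ← Finset.add_sum_erase _ _ (Finset.mem_univ ⊥),
    ← Finset.add_sum_erase _ _ (Finset.mem_univ ⊥),
    Finset.sum_congr rfl fun θ hθ => hne θ (Finset.ne_of_mem_erase hθ)] at h1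
  rw [← hbot p, ← hbot p']
  exact Nat.add_right_cancel h1

theorem FinPoset.tInd_eq_of_toLimit_eq {P P' : FinPoset} (h : P.toLimit = P'.toLimit)
    (Q : FinPoset) : FinPoset.tInd Q P = FinPoset.tInd Q P' := by
  obtain ⟨n, p, rfl⟩ := P.exists_rep
  obtain ⟨n', p', rfl⟩ := P'.exists_rep
  obtain ⟨m, q, rfl⟩ := Q.exists_rep
  have hn : n = n' := by
    have h1 : (p.unlabelled.toLimit.1.2 : ℝ) = p'.unlabelled.toLimit.1.2 := by rw [h]
    rw [FinPoset.toLimit_snd, FinPoset.toLimit_snd, FinPoset.size_unlabelled,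
      FinPoset.size_unlabelled, inv_inj] at h1
    simpa using h1
  subst hn
  rw [FinPoset.tInd_unlabelled, FinPoset.tInd_unlabelled, PosetOn.indDensity, PosetOn.indDensity,
    card_indEmbedding_congr h _ (Fin (m + 1)) q rfl]

theorem tendsto_tInd_toLimit (Q P : FinPoset) :
    Tendsto (FinPoset.tInd Q) (comap FinPoset.toLimit (𝓝 P.toLimit)) (𝓝 (FinPoset.tInd Q P)) := by
  have hpos : (0 : ℝ) < P.toLimit.1.2 := by
    rw [FinPoset.toLimit_snd]
    exact inv_pos.2 (Nat.cast_pos.2 P.size_pos)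
  have hfin := (finite_range_toLimit_inter (half_pos hpos)).subset
    (Set.sdiff_subset (t := {P.toLimit}))
  have h1 : ∀ᶠ Γ in 𝓝 P.toLimit, Γ ∈ Set.range FinPoset.toLimit → Γ = P.toLimit := by
    filter_upwards [hfin.isClosed.isOpen_compl.mem_nhds (x := P.toLimit) (by simp),
      (isOpen_lt_snd _).mem_nhds (x := P.toLimit) (half_lt_self hpos)] with Γ h2 h3 h4
    by_contra hne
    exact h2 ⟨⟨h4, h3⟩, hne⟩
  refine tendsto_const_nhds.congr' ?_
  filter_upwards [h1.comap FinPoset.toLimit] with P' hP'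
  exact FinPoset.tInd_eq_of_toLimit_eq (hP' ⟨P', rfl⟩).symm Q

theorem PosetLimit.continuous_tInd (Q : FinPoset) : Continuous (PosetLimit.tInd Q) := by
  let _ : TopologicalSpace FinPoset := .induced FinPoset.toLimit inferInstance
  have di : IsDenseInducing FinPoset.toLimit := ⟨⟨rfl⟩, denseRange_toLimit⟩
  refine di.continuous_extend fun Γ => ?_
  by_cases hΓ : Γ ∈ Set.range FinPoset.toLimit
  · obtain ⟨P, rfl⟩ := hΓ
    exact ⟨_, tendsto_tInd_toLimit Q P⟩
  · obtain ⟨A, hA, q, rfl⟩ := Q.exists_rep_finset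
    exact ⟨_, tendsto_tInd_of_proper q hΓ⟩

theorem comap_toLimit_neBot (Γ : PosetLimit) : (comap FinPoset.toLimit (𝓝 Γ)).NeBot :=
  comap_neBot fun _ ht => (denseRange_toLimit.mem_nhds ht).imp fun _ h => h

theorem PosetLimit.tInd_toLimit (Q P : FinPoset) :
    PosetLimit.tInd Q P.toLimit = FinPoset.tInd Q P :=
  have := comap_toLimit_neBot P.toLimit
  (tendsto_tInd_toLimit Q P).limUnder_eq

theorem PosetLimit.tInd_eq_of_proper {A : Finset ℕ} [Nonempty A] (q : PosetOn A) {Γ : PosetLimit}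
    (hΓ : Γ ∉ Set.range FinPoset.toLimit) :
    PosetLimit.tInd q.unlabelled Γ =
      (limitLaw Γ : Measure (PosetOn ℕ)).real (restrictEvent q) :=
  have := comap_toLimit_neBot Γ
  (tendsto_tInd_of_proper q hΓ).limUnder_eq

/-! ### Densities of the initial segments -/

theorem measurable_initialSegment (n : ℕ) : Measurable (initialSegment n) := by
  have : Measurable fun p : PosetOn (Fin (n + 1)) => p.unlabelled.toLimit :=
    measurable_of_countable _
  exact this.comp (measurable_posetOn_comap _)

section

variable {V : Type*} [Fintype V] [Nonempty V]

theorem t_initialSegment (q : PosetOn V) (n : ℕ) (R : PosetOn ℕ) :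
    PosetLimit.t q.unlabelled (initialSegment n R) =
      q.homDensity (R.comap fun i : Fin (n + 1) => (i : ℕ)) :=
  FinPoset.t_unlabelled q _

theorem homDensity_comap_eq_sum {V : Type*} [Fintype V] (q : PosetOn V) (n : ℕ) (R : PosetOn ℕ) :
    q.homDensity (R.comap fun i : Fin (n + 1) => (i : ℕ)) =
      (Nat.card (V → Fin (n + 1)) : ℝ)⁻¹ *
        ∑ᶠ f : V → Fin (n + 1), (embEvent q fun x => (f x : ℕ)).indicator 1 R := by
  classical
  rw [finsum_eq_sum_of_fintype, PosetOn.homDensity, div_eq_inv_mul]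
  congr 1
  rw [Nat.card_eq_fintype_card, Fintype.card_subtype, Finset.card_filter, Nat.cast_sum]
  refine Finset.sum_congr rfl fun f _ => ?_
  by_cases h : R ∈ embEvent q fun x => (f x : ℕ)
  · have h' : ∀ x y, q.lt x y → (R.comap fun i : Fin (n + 1) => (i : ℕ)).lt (f x) (f y) := h
    rw [Set.indicator_of_mem h, if_pos h']
    simp
  · have h' : ¬ ∀ x y, q.lt x y → (R.comap fun i : Fin (n + 1) => (i : ℕ)).lt (f x) (f y) := h
    rw [Set.indicator_of_notMem h, if_neg h']
    simp

theorem integrable_t (Q : FinPoset) {Ω : Type*} [MeasurableSpace Ω] {P : Measure Ω}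
    [IsProbabilityMeasure P] {X : Ω → PosetLimit} (hX : Measurable X) :
    Integrable (fun ω => PosetLimit.t Q (X ω)) P := by
  refine Integrable.of_bound
    ((PosetLimit.continuous_t Q).measurable.comp hX).aestronglyMeasurable 1 (ae_of_all _ fun ω => ?_)
  rw [Real.norm_of_nonneg (PosetLimit.t_mem Q _).1]
  exact (PosetLimit.t_mem Q _).2

theorem integral_t_initialSegment (ν : Measure (PosetOn ℕ)) [IsProbabilityMeasure ν]
    (q : PosetOn V) (n : ℕ) :
    ∫ R, PosetLimit.t q.unlabelled (initialSegment n R) ∂ν =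
      (Nat.card (V → Fin (n + 1)) : ℝ)⁻¹ *
        ∑ᶠ f : V → Fin (n + 1), ν.real (embEvent q fun x => (f x : ℕ)) := by
  classical
  simp only [t_initialSegment, homDensity_comap_eq_sum, finsum_eq_sum_of_fintype]
  rw [integral_const_mul, integral_finsetSum]
  · congr 1
    refine Finset.sum_congr rfl fun f _ => ?_
    exact integral_indicator_one (measurableSet_embEvent q _)
  · intro f _
    exact (integrable_const (1 : ℝ)).indicator (measurableSet_embEvent q _)

/-- The expected density in an initial segment is close to the probability of `R ⊃ Q`. -/
theorem abs_integral_t_initialSegment_sub_le (ν : Measure (PosetOn ℕ)) [IsProbabilityMeasure ν]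
    (q : PosetOn V) {c : ℝ}
    (hc : ∀ ι : V → ℕ, Function.Injective ι → ν.real (embEvent q ι) = c) (n : ℕ) :
    |∫ R, PosetLimit.t q.unlabelled (initialSegment n R) ∂ν - c| ≤
      (Nat.card V : ℝ) ^ 2 / ((n : ℝ) + 1) := by
  classical
  have hc01 : 0 ≤ c ∧ c ≤ 1 := by
    have e : V ↪ ℕ := (Fintype.equivFin V).toEmbedding.trans Fin.valEmbedding
    rw [← hc e e.injective]
    exact ⟨measureReal_nonneg, measureReal_le_one⟩
  have hT : (0 : ℝ) < Nat.card (V → Fin (n + 1)) := Nat.cast_pos.2 Nat.card_pos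
  have hle := card_not_injective_div_le V (Fin (n + 1))
  rw [Nat.card_eq_fintype_card (α := Fin (n + 1)), Fintype.card_fin] at hle
  push_cast at hle
  refine le_trans ?_ hle
  have h1 : ∫ R, PosetLimit.t q.unlabelled (initialSegment n R) ∂ν - c =
      (Nat.card (V → Fin (n + 1)) : ℝ)⁻¹ *
        ∑ f : V → Fin (n + 1), (ν.real (embEvent q fun x => (f x : ℕ)) - c) := by
    rw [integral_t_initialSegment, finsum_eq_sum_of_fintype, Finset.sum_sub_distrib, mul_sub,
      Finset.sum_const, nsmul_eq_mul, Finset.card_univ, ← Nat.card_eq_fintype_card,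
      inv_mul_cancel_left₀ hT.ne']
  rw [h1, abs_mul, abs_of_pos (inv_pos.2 hT), inv_mul_eq_div]
  gcongr
  refine (Finset.abs_sum_le_sum_abs _ _).trans ?_
  rw [Nat.card_eq_fintype_card, Fintype.card_subtype, Finset.card_filter, Nat.cast_sum]
  refine Finset.sum_le_sum fun f _ => ?_
  by_cases hf : Function.Injective f
  · rw [hc (fun x => (f x : ℕ)) (Fin.val_injective.comp hf)]
    simp [hf]
  · simp only [hf, not_false_eq_true, if_true, Nat.cast_one]
    rw [abs_le]
    have h2 : 0 ≤ ν.real (embEvent q fun x => (f x : ℕ)) := measureReal_nonneg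
    have h3 : ν.real (embEvent q fun x => (f x : ℕ)) ≤ 1 := measureReal_le_one
    constructor <;> linarith

theorem HasDensities.integral_sq_le {ν : Measure (PosetOn ℕ)} [IsProbabilityMeasure ν]
    {Γ : PosetLimit} (h : HasDensities ν Γ) (q : PosetOn V) (n : ℕ) :
    ∫ R, (PosetLimit.t q.unlabelled (initialSegment n R) - PosetLimit.t q.unlabelled Γ) ^ 2 ∂ν ≤
      6 * (Nat.card V : ℝ) ^ 2 / ((n : ℝ) + 1) := by
  set t := PosetLimit.t q.unlabelled Γ
  have h1 := abs_le.1 (abs_integral_t_initialSegment_sub_le ν q (fun ι hι => h.embEvent q hι) n)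
  have h2 := abs_le.1 (abs_integral_t_initialSegment_sub_le ν (q.sum q)
    (fun ι hι => h.embEvent (q.sum q) hι) n)
  have ht := PosetLimit.t_mem q.unlabelled Γ
  rw [PosetLimit.t_sum, Nat.card_sum, Nat.cast_add] at h2
  have hexp : ∀ R, (PosetLimit.t q.unlabelled (initialSegment n R) - t) ^ 2 =
      PosetLimit.t (q.sum q).unlabelled (initialSegment n R) -
        2 * t * PosetLimit.t q.unlabelled (initialSegment n R) + t ^ 2 := fun R => by
    rw [PosetLimit.t_sum]
    ring
  simp only [hexp]
  have i1 := integrable_t (P := ν) (q.sum q).unlabelled (measurable_initialSegment n)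
  have i2 := (integrable_t (P := ν) q.unlabelled (measurable_initialSegment n)).const_mul (2 * t)
  have i3 : Integrable (fun R => PosetLimit.t (q.sum q).unlabelled (initialSegment n R) -
      2 * t * PosetLimit.t q.unlabelled (initialSegment n R)) ν := i1.sub i2
  rw [integral_add i3 (integrable_const _), integral_sub i1 i2,
    integral_const_mul, integral_const, probReal_univ, one_smul]
  set k := (Nat.card V : ℝ)
  set a := ∫ R, PosetLimit.t q.unlabelled (initialSegment n R) ∂ν
  set b := ∫ R, PosetLimit.t (q.sum q).unlabelled (initialSegment n R) ∂ν
  have hb : b ≤ t ^ 2 + 4 * (k ^ 2 / ((n : ℝ) + 1)) := by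
    have : (k + k) ^ 2 / ((n : ℝ) + 1) = 4 * (k ^ 2 / ((n : ℝ) + 1)) := by ring
    have h3 := h2.2
    rw [this] at h3
    linarith [sq t]
  have ha : t - k ^ 2 / ((n : ℝ) + 1) ≤ a := by
    have h3 := h1.1
    linarith
  have hε : 0 ≤ k ^ 2 / ((n : ℝ) + 1) := by positivity
  have h6 : 6 * k ^ 2 / ((n : ℝ) + 1) = 6 * (k ^ 2 / ((n : ℝ) + 1)) := by ring
  rw [h6]
  have ht0 : 0 ≤ t := ht.1
  have ht1 : t ≤ 1 := ht.2
  nlinarith [mul_le_mul_of_nonneg_left ha ht0]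

theorem HasDensities.ae_tendsto_sq {ν : Measure (PosetOn ℕ)} [IsProbabilityMeasure ν]
    {Γ : PosetLimit} (h : HasDensities ν Γ) (q : PosetOn V) :
    ∀ᵐ R ∂ν, Tendsto (fun m : ℕ =>
      PosetLimit.t q.unlabelled (initialSegment ((m + 1) ^ 2 - 1) R)) atTop
      (𝓝 (PosetLimit.t q.unlabelled Γ)) := by
  set t := PosetLimit.t q.unlabelled Γ
  let F : ℕ → PosetOn ℕ → ℝ := fun m R =>
    (PosetLimit.t q.unlabelled (initialSegment ((m + 1) ^ 2 - 1) R) - t) ^ 2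
  have hFm : ∀ m, Measurable (F m) := fun m =>
    (((PosetLimit.continuous_t _).measurable.comp
      (measurable_initialSegment _)).sub_const t).pow_const 2
  have hFi : ∀ m, Integrable (F m) ν := fun m => by
    refine Integrable.of_bound (hFm m).aestronglyMeasurable 1 (ae_of_all _ fun R => ?_)
    rw [Real.norm_of_nonneg (sq_nonneg _)]
    have h1 := PosetLimit.t_mem q.unlabelled Γ
    have h2 := PosetLimit.t_mem q.unlabelled (initialSegment ((m + 1) ^ 2 - 1) R)
    have h3 : |PosetLimit.t q.unlabelled (initialSegment ((m + 1) ^ 2 - 1) R) - t| ≤ 1 := by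
      rw [abs_le]
      constructor <;> linarith [h1.1, h1.2, h2.1, h2.2]
    exact (sq_le_one_iff_abs_le_one _).2 h3
  have hFle : ∀ m, ∫⁻ R, ENNReal.ofReal (F m R) ∂ν ≤
      ENNReal.ofReal (6 * (Nat.card V : ℝ) ^ 2 * (1 / ((m : ℝ) + 1) ^ 2)) := fun m => by
    rw [← ofReal_integral_eq_lintegral_ofReal (hFi m) (ae_of_all _ fun R => sq_nonneg _)]
    refine ENNReal.ofReal_le_ofReal ((h.integral_sq_le q _).trans_eq ?_)
    have : (((m + 1) ^ 2 - 1 : ℕ) : ℝ) + 1 = ((m : ℝ) + 1) ^ 2 := by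
      rw [Nat.cast_sub (Nat.one_le_pow _ _ (Nat.succ_pos m))]
      push_cast
      ring
    rw [this]
    ring
  have hsum : Summable fun m : ℕ => 6 * (Nat.card V : ℝ) ^ 2 * (1 / ((m : ℝ) + 1) ^ 2) := by
    refine Summable.mul_left _ ?_
    have := (summable_nat_add_iff 1).2 (Real.summable_one_div_nat_pow.2 (one_lt_two))
    simpa using this
  have htop : ∫⁻ R, ∑' m, ENNReal.ofReal (F m R) ∂ν ≠ ∞ := by
    rw [lintegral_tsum fun m => (hFm m).ennreal_ofReal.aemeasurable]
    refine ne_top_of_le_ne_top ?_ (ENNReal.tsum_le_tsum hFle)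
    exact hsum.tsum_ofReal_ne_top
  have hae := ae_lt_top (Measurable.tsum fun m => (hFm m).ennreal_ofReal) htop
  filter_upwards [hae] with R hR
  have h1 := ENNReal.tendsto_atTop_zero_of_tsum_ne_top hR.ne
  have h2 : Tendsto (fun m => F m R) atTop (𝓝 0) := by
    have := (ENNReal.tendsto_toReal ENNReal.zero_ne_top).comp h1
    refine this.congr fun m => ?_
    simp [F, ENNReal.toReal_ofReal (sq_nonneg _)]
  have h3 : Tendsto (fun m => |PosetLimit.t q.unlabelled (initialSegment ((m + 1) ^ 2 - 1) R) - t|)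
      atTop (𝓝 0) := by
    have := h2.sqrt
    simpa [F, Real.sqrt_sq_eq_abs] using this
  have h4 := (tendsto_zero_iff_abs_tendsto_zero _).2 h3
  simpa using h4.add_const t

end

/-- If `H` is monotone and `H n / n ^ k` converges along the squares, it converges. -/
theorem tendsto_div_pow_of_tendsto_sq {H : ℕ → ℝ} (hH : Monotone H) (h0 : ∀ n, 0 ≤ H n) (k : ℕ)
    {t : ℝ} (ht : Tendsto (fun m : ℕ => H ((m + 1) ^ 2) / (((m + 1) ^ 2 : ℕ) : ℝ) ^ k) atTop (𝓝 t)) :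
    Tendsto (fun n : ℕ => H n / (n : ℝ) ^ k) atTop (𝓝 t) := by
  have ht' : Tendsto (fun m : ℕ => H (m ^ 2) / ((m ^ 2 : ℕ) : ℝ) ^ k) atTop (𝓝 t) :=
    (tendsto_add_atTop_iff_nat 1).1 ht
  have hs : Tendsto Nat.sqrt atTop atTop :=
    tendsto_atTop.2 fun b => by
      filter_upwards [eventually_ge_atTop (b * b)] with n hn
      exact Nat.le_sqrt.2 hn
  have hratio : Tendsto (fun m : ℕ => ((m : ℝ) / ((m : ℝ) + 1)) ^ (2 * k)) atTop (𝓝 1) := by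
    have := (tendsto_natCast_div_add_atTop (𝕜 := ℝ) 1).pow (2 * k)
    simpa using this
  have hlow : Tendsto (fun m : ℕ => H (m ^ 2) / ((m ^ 2 : ℕ) : ℝ) ^ k *
      ((m : ℝ) / ((m : ℝ) + 1)) ^ (2 * k)) atTop (𝓝 t) := by
    simpa using ht'.mul hratio
  have hup : Tendsto (fun m : ℕ => H ((m + 1) ^ 2) / (((m + 1) ^ 2 : ℕ) : ℝ) ^ k /
      ((m : ℝ) / ((m : ℝ) + 1)) ^ (2 * k)) atTop (𝓝 t) := by
    have := ht.div hratio one_ne_zero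
    rw [div_one] at this
    exact this
  refine tendsto_of_tendsto_of_tendsto_of_le_of_le' (hlow.comp hs) (hup.comp hs) ?_ ?_
  · filter_upwards [eventually_ge_atTop 1] with n hn
    simp only [Function.comp_apply]
    set m := Nat.sqrt n
    have hm1 : m ^ 2 ≤ n := Nat.sqrt_le' n
    have hm2 : n < (m + 1) ^ 2 := Nat.lt_succ_sqrt' n
    have hm : 0 < m := Nat.sqrt_pos.2 hn
    have hm' : (0 : ℝ) < m := Nat.cast_pos.2 hm
    have hn' : (0 : ℝ) < n := Nat.cast_pos.2 hn
    have e : H (m ^ 2) / ((m ^ 2 : ℕ) : ℝ) ^ k * ((m : ℝ) / ((m : ℝ) + 1)) ^ (2 * k) =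
        H (m ^ 2) / (((m : ℝ) + 1) ^ 2) ^ k := by
      push_cast
      rw [div_pow, pow_mul, pow_mul]
      field_simp
    rw [e]
    have h2 : (n : ℝ) ≤ ((m : ℝ) + 1) ^ 2 := by exact_mod_cast hm2.le
    have h3 : H (m ^ 2) ≤ H n := hH hm1
    gcongr
    exact h0 n
  · filter_upwards [eventually_ge_atTop 1] with n hn
    simp only [Function.comp_apply]
    set m := Nat.sqrt n
    have hm1 : m ^ 2 ≤ n := Nat.sqrt_le' n
    have hm2 : n < (m + 1) ^ 2 := Nat.lt_succ_sqrt' n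
    have hm : 0 < m := Nat.sqrt_pos.2 hn
    have hm' : (0 : ℝ) < m := Nat.cast_pos.2 hm
    have hn' : (0 : ℝ) < n := Nat.cast_pos.2 hn
    have e : H ((m + 1) ^ 2) / (((m + 1) ^ 2 : ℕ) : ℝ) ^ k / ((m : ℝ) / ((m : ℝ) + 1)) ^ (2 * k) =
        H ((m + 1) ^ 2) / ((m : ℝ) ^ 2) ^ k := by
      push_cast
      rw [div_pow, pow_mul, pow_mul]
      field_simp
    rw [e]
    have h2 : (m : ℝ) ^ 2 ≤ n := by exact_mod_cast hm1
    have h3 : H n ≤ H ((m + 1) ^ 2) := hH hm2.le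
    gcongr
    exact h0 _

theorem tendsto_homDensity_of_tendsto_sq {V : Type*} [Fintype V] (q : PosetOn V) (R : PosetOn ℕ)
    {t : ℝ} (ht : Tendsto (fun m : ℕ =>
      q.homDensity (R.comap fun i : Fin ((m + 1) ^ 2 - 1 + 1) => (i : ℕ))) atTop (𝓝 t)) :
    Tendsto (fun n : ℕ => q.homDensity (R.comap fun i : Fin (n + 1) => (i : ℕ))) atTop (𝓝 t) := by
  let H : ℕ → ℝ := fun n => (Nat.card {f : V → Fin n // ∀ x y, q.lt x y →
    R.lt (f x) (f y)} : ℝ)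
  have hT : ∀ n : ℕ, q.homDensity (R.comap fun i : Fin n => (i : ℕ)) =
      H n / (n : ℝ) ^ Fintype.card V := by
    intro n
    rw [PosetOn.homDensity]
    congr 1
    rw [Nat.card_fun, Nat.card_fin, Nat.card_eq_fintype_card, Nat.cast_pow]
  have hmono : Monotone H := by
    intro n n' hn
    refine Nat.cast_le.2 (Nat.card_le_card_of_injective
      (fun f => ⟨fun x => Fin.castLE hn (f.1 x), fun x y hxy => f.2 x y hxy⟩) fun f g hfg => ?_)
    refine Subtype.ext (funext fun x => ?_)
    have := congrFun (congrArg Subtype.val hfg) x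
    exact Fin.castLE_injective hn this
  have h1 := tendsto_div_pow_of_tendsto_sq hmono (fun n => Nat.cast_nonneg _) (Fintype.card V)
    (t := t) (by
      refine ht.congr fun m => ?_
      rw [hT, Nat.sub_add_cancel (Nat.one_le_pow _ _ (Nat.succ_pos m))])
  refine ((tendsto_add_atTop_iff_nat 1).2 h1).congr fun n => ?_
  rw [hT]

theorem HasDensities.ae_tendsto_initialSegment {ν : Measure (PosetOn ℕ)} [IsProbabilityMeasure ν]
    {Γ : ProperPosetLimit} (h : HasDensities ν Γ.1) :
    ∀ᵐ R ∂ν, Tendsto (fun n => initialSegment n R) atTop (𝓝 Γ.1) := by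
  have hall : ∀ᵐ R ∂ν, ∀ Q : FinPoset,
      Tendsto (fun n => PosetLimit.t Q (initialSegment n R)) atTop (𝓝 (PosetLimit.t Q Γ.1)) := by
    refine ae_all_iff.2 fun Q => ?_
    obtain ⟨k, q, rfl⟩ := Q.exists_rep
    filter_upwards [h.ae_tendsto_sq q] with R hR
    simp only [t_initialSegment] at hR ⊢
    exact tendsto_homDensity_of_tendsto_sq q R hR
  filter_upwards [hall] with R hR
  rw [tendsto_subtype_rng, Prod.tendsto_iff]
  refine ⟨tendsto_pi_nhds.2 fun Q => tendsto_subtype_rng.2 (hR Q), tendsto_subtype_rng.2 ?_⟩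
  rw [(notMem_range_toLimit_iff Γ.1).1 Γ.2]
  refine tendsto_one_div_add_atTop_nhds_zero_nat.congr fun n => ?_
  rw [initialSegment, FinPoset.toLimit_snd, FinPoset.size_unlabelled, Fintype.card_fin]
  push_cast
  rw [one_div]

/-! ### Mixtures -/

theorem measurable_pInftyLaw : Measurable pInftyLaw := by
  have : pInftyLaw = fun Γ : ProperPosetLimit => (limitLaw Γ.1 : Measure (PosetOn ℕ)) :=
    funext pInftyLaw_eq_limitLaw
  rw [this]
  exact measurable_limitLaw.comp measurable_subtype_coe

instance (Γ : ProperPosetLimit) : IsProbabilityMeasure (pInftyLaw Γ) := by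
  rw [pInftyLaw_eq_limitLaw]
  infer_instance

theorem hasDensities_pInftyLaw (Γ : ProperPosetLimit) : HasDensities (pInftyLaw Γ) Γ.1 := by
  rw [pInftyLaw_eq_limitLaw]
  exact hasDensities_limitLaw Γ.1

theorem pInftyLaw_real_restrictEvent (Γ : ProperPosetLimit) {A : Finset ℕ} [Nonempty A]
    (q : PosetOn A) : (pInftyLaw Γ).real (restrictEvent q) = PosetLimit.tInd q.unlabelled Γ.1 := by
  rw [pInftyLaw_eq_limitLaw, PosetLimit.tInd_eq_of_proper q Γ.2]

instance (m : Measure ProperPosetLimit) [IsProbabilityMeasure m] :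
    IsProbabilityMeasure (pInftyMixture m) := by
  constructor
  rw [pInftyMixture, Measure.bind_apply MeasurableSet.univ measurable_pInftyLaw.aemeasurable]
  simp

theorem pInftyMixture_real (m : Measure ProperPosetLimit) [IsProbabilityMeasure m]
    {s : Set (PosetOn ℕ)} (hs : MeasurableSet s) :
    (pInftyMixture m).real s = ∫ Γ, (pInftyLaw Γ).real s ∂m := by
  rw [Measure.real, pInftyMixture, Measure.bind_apply hs measurable_pInftyLaw.aemeasurable]
  refine (integral_toReal ((Measure.measurable_coe hs).comp measurable_pInftyLaw).aemeasurable
    (ae_of_all _ fun Γ => ?_)).symm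
  exact measure_lt_top _ _

/-- The laws `pInftyLaw Γ` as a Markov kernel. -/
def pInftyKernel : Kernel ProperPosetLimit (PosetOn ℕ) := ⟨pInftyLaw, measurable_pInftyLaw⟩

instance : IsMarkovKernel pInftyKernel :=
  ⟨fun Γ => inferInstanceAs (IsProbabilityMeasure (pInftyLaw Γ))⟩

theorem integral_pInftyMixture (m : Measure ProperPosetLimit) [IsProbabilityMeasure m]
    {F : PosetOn ℕ → ℝ} (hF : Integrable F (pInftyMixture m)) :
    ∫ R, F R ∂pInftyMixture m = ∫ Γ, ∫ R, F R ∂pInftyLaw Γ ∂m :=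
  Kernel.integral_comp (η := pInftyKernel) (κ := Kernel.const Unit m) (a := ()) hF

theorem pInftyMixture_real_containsEvent (m : Measure ProperPosetLimit) [IsProbabilityMeasure m]
    {A : Finset ℕ} [Nonempty A] (Q : PosetOn A) :
    (pInftyMixture m).real (containsEvent Q) = ∫ Γ, PosetLimit.t Q.unlabelled Γ.1 ∂m := by
  rw [containsEvent_eq_embEvent, pInftyMixture_real m (measurableSet_embEvent Q _)]
  exact integral_congr_ae (ae_of_all _ fun Γ => hasDensities_pInftyLaw Γ A Q)

theorem pInftyMixture_real_restrictEvent (m : Measure ProperPosetLimit) [IsProbabilityMeasure m]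
    {A : Finset ℕ} [Nonempty A] (Q : PosetOn A) :
    (pInftyMixture m).real (restrictEvent Q) = ∫ Γ, PosetLimit.tInd Q.unlabelled Γ.1 ∂m := by
  rw [pInftyMixture_real m (isClopen_restrictEvent Q).2.measurableSet]
  exact integral_congr_ae (ae_of_all _ fun Γ => pInftyLaw_real_restrictEvent Γ Q)

theorem exchangeable_pInftyMixture (m : Measure ProperPosetLimit) :
    Exchangeable (pInftyMixture m) := by
  intro σ
  ext s hs
  have hσ := measurable_posetOn_comap σ
  rw [Measure.map_apply hσ hs, pInftyMixture,
    Measure.bind_apply (hσ hs) measurable_pInftyLaw.aemeasurable,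
    Measure.bind_apply hs measurable_pInftyLaw.aemeasurable]
  refine lintegral_congr fun Γ => ?_
  rw [← Measure.map_apply hσ hs, (hasDensities_pInftyLaw Γ).exchangeable σ]

theorem measureReal_containsEvent_eq_sum (ν : Measure (PosetOn ℕ)) [IsProbabilityMeasure ν]
    {A : Finset ℕ} (Q : PosetOn A) :
    ν.real (containsEvent Q) =
      ∑ᶠ Q' ∈ {Q' : PosetOn A | ∀ x y, Q.lt x y → Q'.lt x y}, ν.real (restrictEvent Q') := by
  classical
  have hu : containsEvent Q =
      ⋃ Q' ∈ {Q' : PosetOn A | ∀ x y, Q.lt x y → Q'.lt x y}.toFinset, restrictEvent Q' := by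
    ext R
    simp only [Set.mem_toFinset, Set.mem_iUnion, exists_prop]
    constructor
    · intro h
      exact ⟨R.comap fun x : A => (x : ℕ), h, rfl⟩
    · rintro ⟨Q', h, rfl⟩
      exact h
  rw [hu, measureReal_biUnion_finset, ← finsum_mem_coe_finset, Set.coe_toFinset]
  · intro q _ q' _ hqq'
    refine Set.disjoint_left.2 fun R hR hR' => hqq' ?_
    exact Eq.trans (Eq.symm hR) hR'
  · exact fun q _ => (isClopen_restrictEvent q).2.measurableSet

theorem measure_ext_of_restrictEvent {ν ν' : Measure (PosetOn ℕ)} [IsProbabilityMeasure ν]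
    [IsProbabilityMeasure ν']
    (h : ∀ (A : Finset ℕ) [Nonempty A] (Q : PosetOn A),
      ν.real (restrictEvent Q) = ν'.real (restrictEvent Q)) : ν = ν' :=
  measure_ext_of_containsEvent fun A _ Q => by
    rw [measureReal_containsEvent_eq_sum, measureReal_containsEvent_eq_sum]
    exact finsum_mem_congr rfl fun q _ => h A q

/-! ### Convergence of the initial segments -/

theorem tendsto_integral_initialSegment (m : Measure ProperPosetLimit) [IsProbabilityMeasure m]
    (F : BoundedContinuousFunction PosetLimit ℝ) :
    Tendsto (fun n => ∫ R, F (initialSegment n R) ∂pInftyMixture m) atTop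
      (𝓝 (∫ Γ, F Γ.1 ∂m)) := by
  have hm : ∀ n, Measurable fun R => F (initialSegment n R) := fun n =>
    F.continuous.measurable.comp (measurable_initialSegment n)
  have hb : ∀ n R, ‖F (initialSegment n R)‖ ≤ ‖F‖ := fun n R => F.norm_coe_le_norm _
  have hi : ∀ n, Integrable (fun R => F (initialSegment n R)) (pInftyMixture m) := fun n =>
    Integrable.of_bound (hm n).aestronglyMeasurable ‖F‖ (ae_of_all _ (hb n))
  simp only [integral_pInftyMixture m (hi _)]
  refine tendsto_integral_of_dominated_convergence (fun _ => ‖F‖) (fun n => ?_)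
    (integrable_const _) (fun n => ae_of_all _ fun Γ => ?_) (ae_of_all _ fun Γ => ?_)
  · have h1 : StronglyMeasurable fun p : ProperPosetLimit × PosetOn ℕ =>
        F (initialSegment n p.2) := ((hm n).comp measurable_snd).stronglyMeasurable
    exact (h1.integral_kernel_prod_right' (κ := pInftyKernel)).aestronglyMeasurable
  · refine (norm_integral_le_of_norm_le_const (ae_of_all _ (hb n))).trans ?_
    simp
  · have h1 : Tendsto (fun n => ∫ R, F (initialSegment n R) ∂pInftyLaw Γ) atTop
        (𝓝 (∫ _, F Γ.1 ∂pInftyLaw Γ)) := by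
      refine tendsto_integral_of_dominated_convergence (fun _ => ‖F‖)
        (fun n => (hm n).aestronglyMeasurable) (integrable_const _)
        (fun n => ae_of_all _ (hb n)) ?_
      filter_upwards [(hasDensities_pInftyLaw Γ).ae_tendsto_initialSegment] with R hR
      exact (F.continuous.tendsto _).comp hR
    simpa using h1

theorem tendstoInDistribution_initialSegment (m : Measure ProperPosetLimit)
    [IsProbabilityMeasure m] :
    TendstoInDistribution initialSegment atTop (fun Γ : ProperPosetLimit => Γ.1)
      (fun _ => pInftyMixture m) m where
  forall_aemeasurable n := (measurable_initialSegment n).aemeasurable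
  aemeasurable_limit := measurable_subtype_coe.aemeasurable
  tendsto := by
    refine ProbabilityMeasure.tendsto_iff_forall_integral_tendsto.2 fun F => ?_
    have hF := F.continuous.measurable.stronglyMeasurable
    have h1 : ∀ n, ∫ Γ, F Γ ∂((pInftyMixture m).map (initialSegment n)) =
        ∫ R, F (initialSegment n R) ∂pInftyMixture m := fun n =>
      integral_map (measurable_initialSegment n).aemeasurable hF.aestronglyMeasurable
    have h2 : ∫ Γ, F Γ ∂(m.map fun Γ : ProperPosetLimit => Γ.1) = ∫ Γ, F Γ.1 ∂m :=
      integral_map measurable_subtype_coe.aemeasurable hF.aestronglyMeasurable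
    simp only [ProbabilityMeasure.coe_mk, h1, h2]
    exact tendsto_integral_initialSegment m F

theorem isClosed_proper : IsClosed {Γ : PosetLimit | Γ ∉ Set.range FinPoset.toLimit} := by
  simp only [notMem_range_toLimit_iff]
  exact isClosed_eq
    (continuous_subtype_val.comp (continuous_snd.comp continuous_subtype_val)) continuous_const

theorem pInftyMixture_injective {m m' : Measure ProperPosetLimit} [IsProbabilityMeasure m]
    [IsProbabilityMeasure m'] (h : pInftyMixture m = pInftyMixture m') : m = m' := by
  have h1 := (tendstoInDistribution_initialSegment m).tendsto
  have h2 := (tendstoInDistribution_initialSegment m').tendsto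
  simp only [h] at h1
  have h3 := congrArg (fun M : ProbabilityMeasure PosetLimit => (M : Measure PosetLimit))
    (tendsto_nhds_unique h1 h2)
  have he : MeasurableEmbedding (Subtype.val : ProperPosetLimit → PosetLimit) :=
    .subtype_coe isClosed_proper.measurableSet
  have h4 : m.map Subtype.val = m'.map Subtype.val := h3
  rw [← he.comap_map m, h4, he.comap_map]

/-! ### Exchangeable laws are mixtures -/

theorem Exchangeable.real_embEvent {ν : Measure (PosetOn ℕ)} (h : Exchangeable ν) {V : Type*}
    [Finite V] (q : PosetOn V) {ι ι' : V → ℕ} (hι : Function.Injective ι)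
    (hι' : Function.Injective ι') : ν.real (embEvent q ι) = ν.real (embEvent q ι') := by
  obtain ⟨σ, hσ⟩ : ∃ σ : Equiv.Perm ℕ, ∀ x, σ (ι x) = ι' x :=
    Equiv.Perm.exists_extending_pair ι ι' hι hι'
  rw [← h σ, map_measureReal_apply (measurable_posetOn_comap σ) (measurableSet_embEvent q ι), h σ]
  congr 1
  ext R
  refine forall₂_congr fun x y => ?_
  rw [← hσ, ← hσ]
  rfl

instance : CompactSpace PosetLimit :=
  isCompact_iff_compactSpace.1 isClosed_closure.isCompact

theorem Exchangeable.exists_mixture {ν : Measure (PosetOn ℕ)} [IsProbabilityMeasure ν]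
    (h : Exchangeable ν) :
    ∃ m : Measure ProperPosetLimit, IsProbabilityMeasure m ∧ pInftyMixture m = ν := by
  let L : ℕ → ProbabilityMeasure PosetLimit := fun n =>
    ⟨ν.map (initialSegment n),
      Measure.isProbabilityMeasure_map (measurable_initialSegment n).aemeasurable⟩
  have hL : ∀ n (f : C(PosetLimit, ℝ)), ∫ Γ, f Γ ∂(L n : Measure PosetLimit) =
      ∫ R, f (initialSegment n R) ∂ν := fun n f =>
    integral_map (measurable_initialSegment n).aemeasurable
      f.continuous.measurable.stronglyMeasurable.aestronglyMeasurable
  obtain ⟨M, -, hM⟩ := isCompact_univ (X := ProbabilityMeasure PosetLimit)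
    (f := map L atTop) (by simp)
  have hlim : ∀ (f : C(PosetLimit, ℝ)) (c : ℝ),
      Tendsto (fun n => ∫ R, f (initialSegment n R) ∂ν) atTop (𝓝 c) →
      ∫ Γ, f Γ ∂(M : Measure PosetLimit) = c := by
    intro f c hc
    have h1 : MapClusterPt (∫ Γ, f Γ ∂(M : Measure PosetLimit)) atTop
        (fun n => ∫ Γ, f Γ ∂(L n : Measure PosetLimit)) :=
      MapClusterPt.continuousAt_comp
        (ProbabilityMeasure.continuous_integral_continuousMap f).continuousAt hM
    simp only [hL] at h1
    exact eq_of_nhds_neBot (h1.neBot.mono (inf_le_inf_left _ hc))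
  have hsize : ∫ Γ : PosetLimit, (Γ.1.2 : ℝ) ∂(M : Measure PosetLimit) = 0 := by
    refine hlim ⟨fun Γ => (Γ.1.2 : ℝ), continuous_subtype_val.comp
      (continuous_snd.comp continuous_subtype_val)⟩ 0 ?_
    refine tendsto_one_div_add_atTop_nhds_zero_nat.congr fun n => ?_
    have : ∀ R, ((initialSegment n R).1.2 : ℝ) = 1 / ((n : ℝ) + 1) := fun R => by
      rw [initialSegment, FinPoset.toLimit_snd, FinPoset.size_unlabelled, Fintype.card_fin]
      push_cast
      rw [one_div]
    simp [this]
  have hae : ∀ᵐ Γ ∂(M : Measure PosetLimit), Γ ∉ Set.range FinPoset.toLimit := by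
    have hc : Continuous fun Γ : PosetLimit => (Γ.1.2 : ℝ) :=
      continuous_subtype_val.comp (continuous_snd.comp continuous_subtype_val)
    have h0 : 0 ≤ fun Γ : PosetLimit => (Γ.1.2 : ℝ) := fun Γ => Γ.1.2.2.1
    have hi : Integrable (fun Γ : PosetLimit => (Γ.1.2 : ℝ)) (M : Measure PosetLimit) := by
      refine Integrable.of_bound hc.measurable.aestronglyMeasurable 1 (ae_of_all _ fun Γ => ?_)
      rw [Real.norm_of_nonneg Γ.1.2.2.1]
      exact Γ.1.2.2.2
    filter_upwards [(integral_eq_zero_iff_of_nonneg h0 hi).1 hsize] with Γ hΓ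
    exact (notMem_range_toLimit_iff Γ).2 hΓ
  have he : MeasurableEmbedding (Subtype.val : ProperPosetLimit → PosetLimit) :=
    .subtype_coe isClosed_proper.measurableSet
  let m : Measure ProperPosetLimit := (M : Measure PosetLimit).comap Subtype.val
  have hmap : m.map Subtype.val = (M : Measure PosetLimit) := by
    rw [he.map_comap]
    refine Measure.restrict_eq_self_of_ae_mem (hae.mono fun Γ hΓ => ?_)
    exact ⟨⟨Γ, hΓ⟩, rfl⟩
  have hm : IsProbabilityMeasure m := by
    constructor
    rw [← Set.preimage_univ (f := (Subtype.val : ProperPosetLimit → PosetLimit)),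
      ← Measure.map_apply measurable_subtype_coe MeasurableSet.univ, hmap]
    simp
  refine ⟨m, hm, measure_ext_of_containsEvent fun A _ Q => ?_⟩
  rw [pInftyMixture_real_containsEvent]
  have h1 : ∫ Γ, PosetLimit.t Q.unlabelled Γ.1 ∂m =
      ∫ Γ, PosetLimit.t Q.unlabelled Γ ∂(M : Measure PosetLimit) := by
    rw [← hmap]
    exact (he.integral_map _).symm
  rw [h1]
  refine hlim ⟨PosetLimit.t Q.unlabelled, PosetLimit.continuous_t _⟩ _ ?_
  rw [tendsto_iff_norm_sub_tendsto_zero]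
  refine squeeze_zero (fun n => norm_nonneg _) (fun n =>
    abs_integral_t_initialSegment_sub_le ν Q
      (fun ι hι => h.real_embEvent Q hι Subtype.val_injective) n) ?_
  have h2 := tendsto_one_div_add_atTop_nhds_zero_nat (𝕜 := ℝ) |>.const_mul ((Nat.card A : ℝ) ^ 2)
  simpa [div_eq_mul_inv] using h2

/-! ### Extreme points -/

theorem pInftyMixture_dirac (Γ : ProperPosetLimit) :
    pInftyMixture (Measure.dirac Γ) = pInftyLaw Γ :=
  Measure.dirac_bind measurable_pInftyLaw Γ

theorem pInftyMixture_combo (a b : NNReal) (m m' : Measure ProperPosetLimit) :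
    pInftyMixture (a • m + b • m') = a • pInftyMixture m + b • pInftyMixture m' := by
  ext s hs
  have hf : ∀ m : Measure ProperPosetLimit, AEMeasurable pInftyLaw m := fun m =>
    measurable_pInftyLaw.aemeasurable
  simp only [pInftyMixture, Measure.bind_apply hs (hf _), Measure.add_apply, Measure.smul_apply,
    lintegral_add_measure, lintegral_smul_measure]

theorem isProbabilityMeasure_combo {Ω : Type*} [MeasurableSpace Ω] (m m' : Measure Ω)
    [IsProbabilityMeasure m] [IsProbabilityMeasure m'] {a b : NNReal} (hab : a + b = 1) :
    IsProbabilityMeasure (a • m + b • m') := by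
  constructor
  simp only [Measure.add_apply, Measure.smul_apply, measure_univ]
  rw [← ENNReal.coe_one]
  simp only [ENNReal.smul_def, smul_eq_mul, ← ENNReal.coe_mul, ← ENNReal.coe_add, mul_one, hab]

theorem eq_dirac_of_ae_eq {Ω : Type*} [MeasurableSpace Ω] {m : Measure Ω} [IsProbabilityMeasure m]
    {a : Ω} (h : ∀ᵐ x ∂m, x = a) : m = Measure.dirac a := by
  have h1 : m.map id = m.map fun _ => a := Measure.map_congr h
  rwa [Measure.map_id, Measure.map_const, measure_univ, one_smul] at h1

theorem pInftyLaw_mem_exchangeableLaws (Γ : ProperPosetLimit) : pInftyLaw Γ ∈ exchangeableLaws :=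
  ⟨inferInstance, (hasDensities_pInftyLaw Γ).exchangeable⟩

theorem pInftyLaw_mem_extremePoints (Γ : ProperPosetLimit) :
    pInftyLaw Γ ∈ Set.extremePoints NNReal exchangeableLaws := by
  refine ⟨pInftyLaw_mem_exchangeableLaws Γ, ?_⟩
  rintro ν₁ ⟨hν₁, hex₁⟩ ν₂ ⟨hν₂, hex₂⟩ ⟨a, b, ha, hb, hab, h⟩
  obtain ⟨m₁, hm₁, rfl⟩ := hex₁.exists_mixture
  obtain ⟨m₂, hm₂, rfl⟩ := hex₂.exists_mixture
  have hp := isProbabilityMeasure_combo m₁ m₂ hab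
  rw [← pInftyMixture_combo, ← pInftyMixture_dirac] at h
  have hd := pInftyMixture_injective h
  have h1 : m₁ = Measure.dirac Γ := by
    have h0 : m₁ {Γ}ᶜ = 0 := by
      have h2 : (a • m₁ + b • m₂) {Γ}ᶜ = 0 := by
        rw [hd]
        simp
      simp only [Measure.add_apply, Measure.smul_apply, add_eq_zero] at h2
      have h3 := h2.1
      rw [ENNReal.smul_def, smul_eq_mul, mul_eq_zero] at h3
      exact h3.resolve_left (by simpa using ha.ne')
    exact eq_dirac_of_ae_eq h0
  rw [h1, pInftyMixture_dirac]

theorem exists_eq_dirac_of_zero_one {m : Measure ProperPosetLimit} [IsProbabilityMeasure m]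
    (h : ∀ s, MeasurableSet s → m s = 0 ∨ m sᶜ = 0) : ∃ Γ, m = Measure.dirac Γ := by
  have : Nonempty ProperPosetLimit := m.nonempty_of_neZero
  obtain ⟨Γ, hΓ⟩ := Filter.exists_eventuallyEq_const_of_forall_separating (l := ae m)
    (f := (id : ProperPosetLimit → ProperPosetLimit)) MeasurableSet fun U hU =>
      (h U hU).symm.imp (fun h0 => h0) (fun h0 => by
        rw [ae_iff]
        simpa using h0)
  exact ⟨Γ, eq_dirac_of_ae_eq hΓ⟩

theorem exists_pInftyLaw_of_mem_extremePoints {ν : Measure (PosetOn ℕ)}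
    (hν : ν ∈ Set.extremePoints NNReal exchangeableLaws) : ∃ Γ, pInftyLaw Γ = ν := by
  obtain ⟨⟨hp, hex⟩, hext⟩ := hν
  obtain ⟨m, hm, rfl⟩ := hex.exists_mixture
  obtain ⟨Γ, hΓ⟩ := exists_eq_dirac_of_zero_one (m := m) fun s hs => by
    by_contra! hcon
    obtain ⟨h1, h2⟩ := hcon
    have p1 : IsProbabilityMeasure (cond m s) := cond_isProbabilityMeasure h1
    have p2 : IsProbabilityMeasure (cond m sᶜ) := cond_isProbabilityMeasure h2
    have hab : (m s).toNNReal + (m sᶜ).toNNReal = 1 := by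
      rw [← ENNReal.toNNReal_add (measure_ne_top _ _) (measure_ne_top _ _),
        measure_add_measure_compl hs, measure_univ, ENNReal.toNNReal_one]
    have hdec : (m s).toNNReal • cond m s + (m sᶜ).toNNReal • cond m sᶜ = m := by
      ext u hu
      simp only [Measure.add_apply, Measure.smul_apply, ENNReal.smul_def, smul_eq_mul,
        ENNReal.coe_toNNReal (measure_ne_top _ _), cond_apply hs, cond_apply hs.compl]
      rw [ENNReal.mul_inv_cancel_left h1 (measure_ne_top _ _),
        ENNReal.mul_inv_cancel_left h2 (measure_ne_top _ _), Set.inter_comm, Set.inter_comm sᶜ]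
      exact measure_inter_add_sdiff u hs
    have h3 := hext (x₁ := pInftyMixture (cond m s)) ⟨inferInstance, exchangeable_pInftyMixture _⟩
      (x₂ := pInftyMixture (cond m sᶜ)) ⟨inferInstance, exchangeable_pInftyMixture _⟩
      ⟨(m s).toNNReal, (m sᶜ).toNNReal, ENNReal.toNNReal_pos h1 (measure_ne_top _ _),
        ENNReal.toNNReal_pos h2 (measure_ne_top _ _), hab, by
          rw [← pInftyMixture_combo, hdec]⟩
    have h4 := pInftyMixture_injective h3
    have h5 : cond m s sᶜ = 0 := by
      rw [cond_apply hs]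
      simp
    exact h2 (h4 ▸ h5)
  exact ⟨Γ, by rw [hΓ, pInftyMixture_dirac]⟩

theorem pInftyLaw_injective : Function.Injective pInftyLaw := by
  intro Γ Γ' h
  rw [← pInftyMixture_dirac, ← pInftyMixture_dirac] at h
  exact injective_dirac (pInftyMixture_injective h)

end PosetLimits

end

theorem theorem1p5 :
    -- The functionals `t_ind(Q,·)` extend continuously to the space of poset limits.
    (∀ Q : FinPoset, Continuous (PosetLimit.tInd Q) ∧
      ∀ P : FinPoset, PosetLimit.tInd Q P.toLimit = FinPoset.tInd Q P) ∧
    -- `P(∞,Γ)` is well defined: a representing kernel exists, and any two give the same law.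
    (∀ Γ : ProperPosetLimit,
      (∃ (S : OrderedProbabilitySpace.{0}) (K : PosetKernel S), K.Represents Γ) ∧
      ∀ (S : OrderedProbabilitySpace.{u}) (K : PosetKernel S),
        K.Represents Γ → K.law = pInftyLaw Γ) ∧
    -- (i)
    (Set.BijOn pInftyMixture {m : Measure ProperPosetLimit | IsProbabilityMeasure m}
        exchangeableLaws ∧
      ∀ (m : Measure ProperPosetLimit) (ν : Measure (PosetOn ℕ))
        [IsProbabilityMeasure m] [IsProbabilityMeasure ν], Exchangeable ν →
        (ν = pInftyMixture m ↔
          ∀ (A : Finset ℕ) [Nonempty A] (Q : PosetOn A),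
            ∫ Γ, PosetLimit.t Q.unlabelled Γ.1 ∂m = ν.real (containsEvent Q)) ∧
        (ν = pInftyMixture m ↔
          ∀ (A : Finset ℕ) [Nonempty A] (Q : PosetOn A),
            ∫ Γ, PosetLimit.tInd Q.unlabelled Γ.1 ∂m = ν.real (restrictEvent Q)) ∧
        (ν = pInftyMixture m →
          TendstoInDistribution initialSegment atTop
            (fun Γ : ProperPosetLimit => Γ.1) (fun _ => ν) m)) ∧
    -- (ii)
    (Set.BijOn pInftyLaw Set.univ (Set.extremePoints NNReal exchangeableLaws) ∧
      ∀ (Γ : ProperPosetLimit) (ν : Measure (PosetOn ℕ))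
        [IsProbabilityMeasure ν], Exchangeable ν →
        (ν = pInftyLaw Γ ↔
          ∀ (A : Finset ℕ) [Nonempty A] (Q : PosetOn A),
            PosetLimit.t Q.unlabelled Γ.1 = ν.real (containsEvent Q)) ∧
        (ν = pInftyLaw Γ ↔
          ∀ (A : Finset ℕ) [Nonempty A] (Q : PosetOn A),
            PosetLimit.tInd Q.unlabelled Γ.1 = ν.real (restrictEvent Q)) ∧
        (ν = pInftyLaw Γ →
          ∀ᵐ R ∂ν, Tendsto (fun n => initialSegment n R) atTop (𝓝 Γ.1))) := by
  refine ⟨fun Q => ⟨PosetLimit.continuous_tInd Q, PosetLimit.tInd_toLimit Q⟩,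
    fun Γ => ⟨exists_posetKernel Γ, fun S K hK => ?_⟩, ⟨⟨?_, ?_, ?_⟩, ?_⟩, ⟨?_, ?_, ?_⟩, ?_⟩
  · rw [pInftyLaw_eq_limitLaw]
    exact hK.hasDensities.eq_limitLaw
  · intro m hm
    have hm' : IsProbabilityMeasure m := hm
    exact ⟨inferInstance, exchangeable_pInftyMixture m⟩
  · intro m hm m' hm' h
    have h1 : IsProbabilityMeasure m := hm
    have h2 : IsProbabilityMeasure m' := hm'
    exact pInftyMixture_injective h
  · rintro ν ⟨hν, hex⟩
    exact hex.exists_mixture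
  · intro m ν _ _ _
    refine ⟨⟨?_, fun h => ?_⟩, ⟨?_, fun h => ?_⟩, ?_⟩
    · rintro rfl A _ Q
      exact (pInftyMixture_real_containsEvent m Q).symm
    · refine measure_ext_of_containsEvent fun A _ Q => ?_
      rw [← h A Q, pInftyMixture_real_containsEvent]
    · rintro rfl A _ Q
      exact (pInftyMixture_real_restrictEvent m Q).symm
    · refine measure_ext_of_restrictEvent fun A _ Q => ?_
      rw [← h A Q, pInftyMixture_real_restrictEvent]
    · rintro rfl
      exact tendstoInDistribution_initialSegment m
  · exact fun Γ _ => pInftyLaw_mem_extremePoints Γ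
  · exact pInftyLaw_injective.injOn
  · intro ν hν
    obtain ⟨Γ, rfl⟩ := exists_pInftyLaw_of_mem_extremePoints hν
    exact ⟨Γ, Set.mem_univ _, rfl⟩
  · intro Γ ν _ _
    refine ⟨⟨?_, fun h => ?_⟩, ⟨?_, fun h => ?_⟩, ?_⟩
    · rintro rfl A _ Q
      exact (hasDensities_pInftyLaw Γ A Q).symm
    · refine measure_ext_of_containsEvent fun A _ Q => ?_
      rw [← h A Q, hasDensities_pInftyLaw Γ A Q]
    · rintro rfl A _ Q
      exact (pInftyLaw_real_restrictEvent Γ Q).symm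
    · refine measure_ext_of_restrictEvent fun A _ Q => ?_
      rw [← h A Q, pInftyLaw_real_restrictEvent]
    · rintro rfl
      exact (hasDensities_pInftyLaw Γ).ae_tendsto_initialSegment
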